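/- **Setting.** Let $d\ge 1$, $\beta>0$, $0<\gamma\le 1$, $c>0$ and $0\le\alpha<\nu<\pi/2$. Let $L$ be a sectorial operator of type $\alpha$ on $L^2(\mathbb R^d)$ (complex scalars), i.e. densely defined and closed, such that for every $\theta>\alpha$ the spectrum of $L$ lies in $S_\theta=\{|\arg z|\le\theta\}$ and $\sup_{z\notin S_\theta}\|z(z-L)^{-1}\|<\infty$; let $M\ge\sup_{z\notin S_\nu}\|z(z-L)^{-1}\|$. Assume that $e^{-tL}$, $t>0$, has a kernel $K(t,x,y)$ with, for all $t>0$ and $x,y,h\in\mathbb R^d$, $$|K(t,x,y)|\le\frac{c\,t^\beta}{(t+|x-y|)^{d+\beta}},\qquad \int K(t,x,y)\,dx=\int K(t,x,y)\,dy=1,$$ $$|K(t,x+h,y)-K(t,x,y)|+|K(t,x,y+h)-K(t,x,y)|\le\frac{c|h|^\gamma t^\beta}{(t+|x-y|)^{d+\beta+\gamma}}\quad\text{if } 2|h|\le t+|x-y|.$$ Let $k(t,x,y)=t\,\partial_tK(t,x,y)$ be the kernel of $-tLe^{-tL}$. Let $X$ be a complex Banach space and $1<q<\infty$. Write $\mathcal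 Q(f)(x,t)=-tLe^{-tL}f(x)=\int k(t,x,y)f(y)\,dy$. For strongly measurable $f:\mathbb R^{d+1}_+\to X$ put $$\mathcal A_q(f)(x)=\Big(\int_{|y-x|<t}\|f(y,t)\|^q\frac{dy\,dt}{t^{d+1}}\Big)^{1/q},\qquad \mathcal C_q(f)(x)=\sup_{B\ni x}\Big(\frac1{|B|}\int_{\widehat B}\|f(y,t)\|^q\frac{dy\,dt}{t}\Big)^{1/q},$$ where $B$ runs over the balls containing $x$ and $\widehat B=\{(y,t): t>0,\ |y-z|\ge t\ \text{for all } z\notin B\}$. $T^p_q(X)$, $1\le p<\infty$, is the space of strongly measurable $f$ with $\|f\|_{T^p_q(X)}=\|\mathcal A_q(f)\|_{L^p(\mathbb R^d)}<\infty$. For $\varepsilon\ge 0$ let $\mathcal N_\varepsilon$ be the space of locally integrable $f:\mathbb R^d\to X$ with $\int\|f(x)\|(1+|x|)^{-d-\varepsilon}dx<\infty$. Let $\Theta(L)$ be the supremum of the $b>0$ such that, on some sector $|\arg z|<\varphi$ with $0<\varphi<\pi/2$, $e^{-zL}$ is defined and holomorphic and has kernels bounded by a constant times $|z|^b(|z|+|x-y|)^{-d-b}$.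 Put $\mathcal N=\mathcal N_{\Theta(L)}$ if $\Theta(L)<\infty$ and $\mathcal N=\bigcup_{\varepsilon>0}\mathcal N_\varepsilon$ otherwise. Identifying functions whose difference is annihilated by $\mathcal Q$ (equivalently, is fixed by the semigroup), $H^p_{q,L}(X)$ ($1\le p<\infty$), resp. $BMO^p_{q,L}(X)$ ($1\le p\le\infty$), consists of the $f\in\mathcal N$ for which $\mathcal Q(f)$ is defined (by absolutely convergent integrals) and strongly measurable, with finite norm $\|f\|_{H^p_{q,L}(X)}=\|\mathcal Q(f)\|_{T^p_q(X)}$, resp. $\|f\|_{BMO^p_{q,L}(X)}=\|\mathcal C_q(\mathcal Q(f))\|_{L^p(\mathbb R^d)}$. Let $\overline{H}^p_{q,L}(X)$ be the completion of $H^p_{q,L}(X)$. For $f\in C_c(\mathbb R^{d+1}_+)\otimes X$ (finite sums $\sum_i\varphi_i v_i$ with $\varphi_i\in C_c(\mathbb R^{d+1}_+)$, $v_i\in X$) let $$\pi_L(f)(x)=\int_0^\infty\mathcal Q(f(\cdot,t))(x,t)\,\frac{dt}{t},\qquad x\in\mathbb R^d.$$ **Lemma 3.6.** There is a constant $C$ that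 depends only on $d,\beta,c,\nu,M$ (not on $\alpha$, $\gamma$, $p$, $q$, $X$, nor otherwise on $L$) such that the following hold. 1. For $f\in C_c(\mathbb R^{d+1}_+)\otimes X$ the integrals defining $\pi_L(f)(x)$ converge absolutely for every $x$. 2. For every $1\le p<\infty$, $C_c(\mathbb R^{d+1}_+)\otimes X\subset T^p_q(X)$, $\pi_L$ maps $C_c(\mathbb R^{d+1}_+)\otimes X$ into $H^p_{q,L}(X)$, and it extends in exactly one way to a bounded linear operator $\pi_L:T^p_q(X)\to\overline{H}^p_{q,L}(X)$; moreover $$\|\pi_L(f)\|_{H^p_{q,L}(X)}\le C\,p^{1/q}\,\|f\|_{T^p_q(X)},\qquad f\in T^p_q(X).$$ 3. For every $1\le p\le\infty$ and $f\in C_c(\mathbb R^{d+1}_+)\otimes X$, $\pi_L(f)$ lies in $\mathcal N$, $\mathcal Q(\pi_L(f))$ is defined and strongly measurable, and $$\|\mathcal C_q(\mathcal Q(\pi_L(f)))\|_{L^p(\mathbb R^d)}\le C\,\|\mathcal C_q(f)\|_{L^p(\mathbb R^d)}$$ (the right-hand side may be infinite); when it is finite, $\pi_L(f)\in BMO^p_{q,L}(X)$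 and the left-hand side is $\|\pi_L(f)\|_{BMO^p_{q,L}(X)}$. -/

import Mathlib

open MeasureTheory Set Filter Topology
open scoped ENNReal

namespace TentHardy

noncomputable section

/-- The Euclidean space of dimension `d`. -/
abbrev Euc (d : ℕ) : Type := EuclideanSpace ℝ (Fin d)

/-- The complex Hilbert space of square integrable functions on the Euclidean space. -/
abbrev L2 (d : ℕ) : Type := Lp ℂ 2 (volume : Measure (Euc d))

/-! ### Sectorial operators and their semigroups -/

/-- The closed sector `{z : |arg z| ≤ ν}` (it contains `0`). -/
def sector (ν : ℝ) : Set ℂ := {z | |z.arg| ≤ ν}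

/-- `R` is the bounded inverse `(z - L)⁻¹` of the unbounded operator `z - L`. -/
def IsResolventAt {d : ℕ} (L : L2 d →ₗ.[ℂ] L2 d) (z : ℂ) (R : L2 d →L[ℂ] L2 d) : Prop :=
  (∀ f : L2 d, ∃ h : R f ∈ L.domain, z • R f - L ⟨R f, h⟩ = f) ∧
    ∀ f : L.domain, R (z • (f : L2 d) - L f) = f

/-- The spectrum of `L` lies in the sector of angle `ν`, and `‖z (z - L)⁻¹‖ ≤ M` off that sector. -/
def ResolventBound {d : ℕ} (L : L2 d →ₗ.[ℂ] L2 d) (ν M : ℝ) : Prop :=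
  ∀ z : ℂ, z ∉ sector ν → ∃ R : L2 d →L[ℂ] L2 d, IsResolventAt L z R ∧ ‖z • R‖ ≤ M

/-- `L` is a sectorial operator of type `α`: densely defined, closed, and for each `ν > α` the
spectrum lies in the sector of angle `ν` and `z (z - L)⁻¹` is bounded off that sector. -/
structure IsSectorial {d : ℕ} (L : L2 d →ₗ.[ℂ] L2 d) (α : ℝ) : Prop where
  dense : Dense (L.domain : Set (L2 d))
  closed : L.IsClosed
  resolvent : ∀ ν, α < ν → ∃ M, ResolventBound L ν M

/-- `T` (on `[0, ∞)`) is the strongly continuous semigroup `t ↦ e^{-tL}`, i.e. the strongly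
continuous semigroup whose infinitesimal generator is `-L`. -/
structure IsSemigroupOf {d : ℕ} (L : L2 d →ₗ.[ℂ] L2 d) (T : ℝ → L2 d →L[ℂ] L2 d) : Prop where
  zero : T 0 = 1
  add : ∀ s t, 0 ≤ s → 0 ≤ t → T (s + t) = T s * T t
  cont : ∀ f, Tendsto (fun t => T t f) (𝓝[>] 0) (𝓝 f)
  generator : ∀ f g, (f, g) ∈ L.graph ↔
    Tendsto (fun t : ℝ => ((t : ℂ)⁻¹) • (T t f - f)) (𝓝[>] 0) (𝓝 (-g))

/-- `κ` is an integral kernel of the bounded operator `S` on `L²`. -/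
def IsIntegralKernel {d : ℕ} (S : L2 d →L[ℂ] L2 d) (κ : Euc d → Euc d → ℂ) : Prop :=
  Measurable (Function.uncurry κ) ∧
    ∀ f : L2 d, S f =ᵐ[volume] fun x => ∫ y, κ x y * f y

/-- `K t x y` is the kernel of `e^{-tL}`, `t > 0`. -/
def IsHeatKernel {d : ℕ} (L : L2 d →ₗ.[ℂ] L2 d) (K : ℝ → Euc d → Euc d → ℂ) : Prop :=
  ∃ T : ℝ → L2 d →L[ℂ] L2 d, IsSemigroupOf L T ∧ ∀ t, 0 < t → IsIntegralKernel (T t) (K t)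

/-- The size, regularity and conservation assumptions on the kernel of the semigroup. -/
structure KernelAssumptions {d : ℕ} (β γ c : ℝ) (K : ℝ → Euc d → Euc d → ℂ) : Prop where
  size : ∀ t, 0 < t → ∀ x y, ‖K t x y‖ ≤ c * t ^ β / (t + ‖x - y‖) ^ ((d : ℝ) + β)
  regular : ∀ t, 0 < t → ∀ x y h, 2 * ‖h‖ ≤ t + ‖x - y‖ →
    ‖K t (x + h) y - K t x y‖ + ‖K t x (y + h) - K t x y‖ ≤
      c * ‖h‖ ^ γ * t ^ β / (t + ‖x - y‖) ^ ((d : ℝ) + β + γ)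
  integral_left : ∀ t, 0 < t → ∀ y, ∫ x, K t x y = 1
  integral_right : ∀ t, 0 < t → ∀ x, ∫ y, K t x y = 1

/-- The kernel `k(t, x, y) = t ∂ₜ K(t, x, y)` of the operator `-t L e^{-tL}`. -/
def kerQ {d : ℕ} (K : ℝ → Euc d → Euc d → ℂ) (t : ℝ) (x y : Euc d) : ℂ :=
  (t : ℂ) * deriv (fun s : ℝ => K s x y) t

/-! ### The class of functions on which the semigroup acts -/

/-- The exponent `b` is admissible: on some sector `|arg z| < φ` with `0 < φ < π / 2` the semigroup
has a holomorphic extension `e^{-zL}` whose kernels are bounded by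
`c |z|^b / (|z| + |x - y|)^(d + b)`. -/
def PoissonBound {d : ℕ} (L : L2 d →ₗ.[ℂ] L2 d) (b : ℝ) : Prop :=
  ∃ φ : ℝ, 0 < φ ∧ φ < Real.pi / 2 ∧
  ∃ (S : ℂ → L2 d →L[ℂ] L2 d) (κ : ℂ → Euc d → Euc d → ℂ) (c : ℝ),
    DifferentiableOn ℂ S {z | z ≠ 0 ∧ |z.arg| < φ} ∧
    IsSemigroupOf L (fun t : ℝ => S (t : ℂ)) ∧
    ∀ z : ℂ, z ≠ 0 → |z.arg| < φ → IsIntegralKernel (S z) (κ z) ∧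
      ∀ x y, ‖κ z x y‖ ≤ c * ‖z‖ ^ b / (‖z‖ + ‖x - y‖) ^ ((d : ℝ) + b)

/-- The set of admissible exponents; its supremum is the number `Θ(L)`. -/
def exponents {d : ℕ} (L : L2 d →ₗ.[ℂ] L2 d) : Set ℝ := {b | 0 < b ∧ PoissonBound L b}

section Functions

variable {d : ℕ} {X : Type*} [NormedAddCommGroup X]

/-- Membership in `𝒩_ε`: locally integrable and `∫ ‖f x‖ (1 + |x|)^{-(d+ε)} dx < ∞`. -/
def MemNeps (ε : ℝ) (f : Euc d → X) : Prop :=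
  LocallyIntegrable f volume ∧
    Integrable (fun x : Euc d => ‖f x‖ / (1 + ‖x‖) ^ ((d : ℝ) + ε)) volume

/-- Membership in `𝒩`: this is `𝒩_{Θ(L)}` if `Θ(L) < ∞`, and `⋃_{ε > 0} 𝒩_ε` otherwise. -/
def MemN (L : L2 d →ₗ.[ℂ] L2 d) (f : Euc d → X) : Prop :=
  (BddAbove (exponents L) → MemNeps (sSup (exponents L)) f) ∧
    (¬ BddAbove (exponents L) → ∃ ε, 0 < ε ∧ MemNeps ε f)

lemma MemNeps.zero (ε : ℝ) : MemNeps ε (0 : Euc d → X) :=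
  ⟨locallyIntegrable_zero, by simp⟩

lemma MemNeps.of_bound {ε ε' : ℝ} (h : ε ≤ ε') {f g : Euc d → X} {C : ℝ}
    (hg : LocallyIntegrable g volume) (hf : MemNeps ε f) (hfg : ∀ x, ‖g x‖ ≤ C * ‖f x‖) :
    MemNeps ε' g := by
  refine ⟨hg, Integrable.mono' (hf.2.const_mul C) ?_ ?_⟩
  · have hw : AEStronglyMeasurable (fun x : Euc d => (1 + ‖x‖) ^ ((d : ℝ) + ε')) volume :=
      (Measurable.pow_const (by fun_prop) _).aestronglyMeasurable
    exact (hg.aestronglyMeasurable.norm.aemeasurable.div hw.aemeasurable).aestronglyMeasurable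
  · refine Eventually.of_forall fun x => ?_
    have h1 : (1 : ℝ) ≤ 1 + ‖x‖ := by linarith [norm_nonneg x]
    have hpos : 0 < (1 + ‖x‖) ^ ((d : ℝ) + ε) := Real.rpow_pos_of_pos (by linarith) _
    have hle : (1 + ‖x‖) ^ ((d : ℝ) + ε) ≤ (1 + ‖x‖) ^ ((d : ℝ) + ε') :=
      Real.rpow_le_rpow_of_exponent_le h1 (by linarith)
    rw [norm_div, norm_norm, Real.norm_of_nonneg (hpos.le.trans hle), ← mul_div_assoc]
    exact (div_le_div_of_nonneg_left (norm_nonneg _) hpos hle).trans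
      (div_le_div_of_nonneg_right (hfg x) hpos.le)

lemma MemNeps.add {ε : ℝ} {f g : Euc d → X} (hf : MemNeps ε f) (hg : MemNeps ε g) :
    MemNeps ε (f + g) := by
  refine ⟨hf.1.add hg.1, Integrable.mono' (hf.2.add hg.2) ?_ ?_⟩
  · have hw : AEStronglyMeasurable (fun x : Euc d => (1 + ‖x‖) ^ ((d : ℝ) + ε)) volume :=
      (Measurable.pow_const (by fun_prop) _).aestronglyMeasurable
    exact ((hf.1.add hg.1).aestronglyMeasurable.norm.aemeasurable.div
      hw.aemeasurable).aestronglyMeasurable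
  · refine Eventually.of_forall fun x => ?_
    have hpos : 0 ≤ (1 + ‖x‖) ^ ((d : ℝ) + ε) := Real.rpow_nonneg (by positivity) _
    rw [norm_div, norm_norm, Real.norm_of_nonneg hpos]
    simp only [Pi.add_apply]
    rw [← add_div]
    exact div_le_div_of_nonneg_right (norm_add_le _ _) hpos

lemma MemN.zero (L : L2 d →ₗ.[ℂ] L2 d) : MemN L (0 : Euc d → X) :=
  ⟨fun _ => MemNeps.zero _, fun _ => ⟨1, one_pos, MemNeps.zero _⟩⟩

lemma MemN.add {L : L2 d →ₗ.[ℂ] L2 d} {f g : Euc d → X} (hf : MemN L f) (hg : MemN L g) :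
    MemN L (f + g) := by
  refine ⟨fun h => (hf.1 h).add (hg.1 h), fun h => ?_⟩
  obtain ⟨a, ha, hfa⟩ := hf.2 h
  obtain ⟨b, _, hgb⟩ := hg.2 h
  refine ⟨max a b, lt_max_of_lt_left ha, MemNeps.add ?_ ?_⟩
  · exact hfa.of_bound (C := 1) (le_max_left _ _) hfa.1 (by simp)
  · exact hgb.of_bound (C := 1) (le_max_right _ _) hgb.1 (by simp)

/-! ### Tent spaces -/

/-- The upper half-space. -/
def halfSpace (d : ℕ) : Set (Euc d × ℝ) := {z | 0 < z.2}

/-- The measure `dy dt / t^k` on the upper half-space. -/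
def hsMeasure (d k : ℕ) : Measure (Euc d × ℝ) :=
  (volume.restrict (halfSpace d)).withDensity fun z => ENNReal.ofReal ((z.2 ^ k)⁻¹)

/-- The cone `Γ(x) = {(y, t) : |y - x| < t}`. -/
def cone (x : Euc d) : Set (Euc d × ℝ) := {z | ‖z.1 - x‖ < z.2}

/-- The tent over `O`: the complement in the half-space of the union of the cones with vertex
outside `O`. -/
def tent (O : Set (Euc d)) : Set (Euc d × ℝ) := {z | 0 < z.2 ∧ ∀ x ∉ O, z ∉ cone x}

/-- `𝒜_q(f)(x) = (∫_{Γ(x)} ‖f(y,t)‖^q dy dt / t^{d+1})^{1/q}`. -/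
def areaFun (q : ℝ) (f : Euc d × ℝ → X) (x : Euc d) : ℝ≥0∞ :=
  (∫⁻ z in cone x, ‖f z‖ₑ ^ q ∂hsMeasure d (d + 1)) ^ (1 / q)

/-- `𝒞_q(f)(x) = sup_{B ∋ x} (|B|⁻¹ ∫_{tent B} ‖f(y,t)‖^q dy dt / t)^{1/q}`, the supremum being
over the balls that contain `x`. -/
def carlesonFun (q : ℝ) (f : Euc d × ℝ → X) (x : Euc d) : ℝ≥0∞ :=
  ⨆ (a : Euc d) (r : ℝ) (_ : 0 < r) (_ : x ∈ Metric.ball a r),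
    ((volume (Metric.ball a r))⁻¹ *
      ∫⁻ z in tent (Metric.ball a r), ‖f z‖ₑ ^ q ∂hsMeasure d 1) ^ (1 / q)

/-- The tent space norm `‖𝒜_q(f)‖_p`, `p < ∞`. -/
def tentNorm (p q : ℝ) (f : Euc d × ℝ → X) : ℝ≥0∞ :=
  (∫⁻ x, areaFun q f x ^ p) ^ (1 / p)

/-- The quantity `‖𝒞_q(f)‖_p`, `p ≤ ∞`. -/
def carlesonNorm (p : ℝ≥0∞) (q : ℝ) (f : Euc d × ℝ → X) : ℝ≥0∞ :=
  eLpNorm (carlesonFun q f) p volume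

/-- Membership in the tent space: strongly measurable on the half-space, of finite norm. -/
def MemTent (p q : ℝ) (f : Euc d × ℝ → X) : Prop :=
  AEStronglyMeasurable f (volume.restrict (halfSpace d)) ∧ tentNorm p q f < ∞

lemma ac_hsMeasure (k : ℕ) : hsMeasure d k ≪ volume.restrict (halfSpace d) :=
  withDensity_absolutelyContinuous _ _

lemma aemeasurable_areaFun {q : ℝ} {f : Euc d × ℝ → X}
    (hf : AEStronglyMeasurable f (volume.restrict (halfSpace d))) :
    Measurable (areaFun q f) := by
  have hSF : SFinite (hsMeasure d (d + 1)) := by unfold hsMeasure; infer_instance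
  obtain ⟨g, hg, hfg⟩ := hf
  have hae : f =ᵐ[hsMeasure d (d + 1)] g := (ac_hsMeasure (d + 1)).ae_le hfg
  have h1 : ∀ x : Euc d, MeasurableSet (cone x) := fun x =>
    (isOpen_lt (by fun_prop) (by fun_prop)).measurableSet
  have heq : areaFun q f = fun x : Euc d =>
      (∫⁻ z, (cone x).indicator (fun z => ‖g z‖ₑ ^ q) z ∂hsMeasure d (d + 1)) ^ (1 / q) := by
    funext x
    rw [lintegral_indicator (h1 x)]
    unfold areaFun
    congr 1
    apply lintegral_congr_ae
    filter_upwards [ae_restrict_of_ae hae] with z hz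
    rw [hz]
  rw [heq]
  refine Measurable.pow_const ?_ _
  apply Measurable.lintegral_prod_right
  have hS : MeasurableSet {w : Euc d × (Euc d × ℝ) | ‖w.2.1 - w.1‖ < w.2.2} :=
    (isOpen_lt (by fun_prop) (by fun_prop)).measurableSet
  have hm : Measurable fun w : Euc d × (Euc d × ℝ) => ‖g w.2‖ₑ ^ q :=
    (hg.enorm.pow_const q).comp measurable_snd
  exact hm.indicator hS

lemma areaFun_add_le {q : ℝ} (hq : 1 ≤ q) {f g : Euc d × ℝ → X}
    (hf : AEStronglyMeasurable f (volume.restrict (halfSpace d)))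
    (hg : AEStronglyMeasurable g (volume.restrict (halfSpace d))) (x : Euc d) :
    areaFun q (f + g) x ≤ areaFun q f x + areaFun q g x := by
  have hf' := (hf.enorm.mono_ac (ac_hsMeasure (d + 1))).restrict (s := cone x)
  have hg' := (hg.enorm.mono_ac (ac_hsMeasure (d + 1))).restrict (s := cone x)
  refine le_trans ?_ (ENNReal.lintegral_Lp_add_le hf' hg' hq)
  unfold areaFun
  gcongr
  exact enorm_add_le _ _

lemma tentNorm_add_le {p q : ℝ} (hp : 1 ≤ p) (hq : 1 ≤ q) {f g : Euc d × ℝ → X}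
    (hf : AEStronglyMeasurable f (volume.restrict (halfSpace d)))
    (hg : AEStronglyMeasurable g (volume.restrict (halfSpace d))) :
    tentNorm p q (f + g) ≤ tentNorm p q f + tentNorm p q g := by
  refine le_trans ?_ (ENNReal.lintegral_Lp_add_le (aemeasurable_areaFun hf).aemeasurable
    (aemeasurable_areaFun hg).aemeasurable hp)
  unfold tentNorm
  gcongr with x
  exact areaFun_add_le hq hf hg x

lemma tentNorm_zero {p q : ℝ} (hp : 1 ≤ p) (hq : 1 ≤ q) :
    tentNorm p q (0 : Euc d × ℝ → X) = 0 := by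
  have hp0 : 0 < p := by linarith
  have hq0 : 0 < q := by linarith
  simp [tentNorm, areaFun, hp0, hq0]

lemma tentNorm_neg {p q : ℝ} (f : Euc d × ℝ → X) : tentNorm p q (-f) = tentNorm p q f := by
  simp [tentNorm, areaFun]

variable [NormedSpace ℂ X]

lemma tentNorm_smul {p q : ℝ} (hp : 1 ≤ p) (hq : 1 ≤ q) (a : ℂ) (f : Euc d × ℝ → X) :
    tentNorm p q (a • f) = ‖a‖ₑ * tentNorm p q f := by
  have hp0 : 0 < p := by linarith
  have hq0 : 0 < q := by linarith
  have ha : ‖a‖ₑ ≠ ∞ := enorm_ne_top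
  have h1 : ∀ x, areaFun q (a • f) x = ‖a‖ₑ * areaFun q f x := by
    intro x
    unfold areaFun
    simp only [Pi.smul_apply, enorm_smul, ENNReal.mul_rpow_of_nonneg _ _ hq0.le]
    rw [lintegral_const_mul' _ _ (ENNReal.rpow_ne_top_of_nonneg hq0.le ha),
      ENNReal.mul_rpow_of_nonneg _ _ (by positivity), ← ENNReal.rpow_mul,
      mul_one_div_cancel hq0.ne', ENNReal.rpow_one]
  unfold tentNorm
  simp only [h1, ENNReal.mul_rpow_of_nonneg _ _ hp0.le]
  rw [lintegral_const_mul' _ _ (ENNReal.rpow_ne_top_of_nonneg hp0.le ha),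
    ENNReal.mul_rpow_of_nonneg _ _ (by positivity), ← ENNReal.rpow_mul,
    mul_one_div_cancel hp0.ne', ENNReal.rpow_one]

variable (d X) in
/-- The tent space as a space of functions. -/
def tentSubmodule (p q : ℝ) [hp : Fact (1 ≤ p)] [hq : Fact (1 < q)] :
    Submodule ℂ (Euc d × ℝ → X) where
  carrier := {f | MemTent p q f}
  zero_mem' := ⟨aestronglyMeasurable_zero, by
    rw [tentNorm_zero hp.out hq.out.le]; exact ENNReal.zero_lt_top⟩
  add_mem' := fun hf hg => ⟨hf.1.add hg.1,
    (tentNorm_add_le hp.out hq.out.le hf.1 hg.1).trans_lt (ENNReal.add_lt_top.2 ⟨hf.2, hg.2⟩)⟩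
  smul_mem' := fun a f hf => ⟨hf.1.const_smul a, by
    rw [tentNorm_smul hp.out hq.out.le]; exact ENNReal.mul_lt_top enorm_lt_top hf.2⟩

variable (d X) in
/-- The tent space `T^p_q(X)`, with the seminorm `‖𝒜_q(f)‖_p` (functions that agree almost
everywhere on the half-space are at distance `0` of each other). -/
def TentSpace (p q : ℝ) [Fact (1 ≤ p)] [Fact (1 < q)] : Type _ := tentSubmodule d X p q

section TentInstances

variable (p q : ℝ) [hp : Fact (1 ≤ p)] [hq : Fact (1 < q)]

instance : AddCommGroup (TentSpace d X p q) :=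
  inferInstanceAs (AddCommGroup (tentSubmodule d X p q))

instance : Module ℂ (TentSpace d X p q) :=
  inferInstanceAs (Module ℂ (tentSubmodule d X p q))

instance : SeminormedAddCommGroup (TentSpace d X p q) :=
  AddGroupSeminorm.toSeminormedAddCommGroup
    { toFun := fun f => (tentNorm p q f.1).toReal
      map_zero' := by
        have h : ((0 : TentSpace d X p q).1 : Euc d × ℝ → X) = 0 := rfl
        rw [h, tentNorm_zero hp.out hq.out.le, ENNReal.toReal_zero]
      add_le' := fun f g => by
        have h : (f + g).1 = f.1 + g.1 := rfl
        rw [h, ← ENNReal.toReal_add f.2.2.ne g.2.2.ne]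
        exact ENNReal.toReal_mono (ENNReal.add_ne_top.2 ⟨f.2.2.ne, g.2.2.ne⟩)
          (tentNorm_add_le hp.out hq.out.le f.2.1 g.2.1)
      neg' := fun f => by
        have h : (-f).1 = -f.1 := rfl
        rw [h, tentNorm_neg] }

lemma tentSpace_norm_def (f : TentSpace d X p q) : ‖f‖ = (tentNorm p q f.1).toReal := rfl

instance : NormedSpace ℂ (TentSpace d X p q) where
  norm_smul_le a f := by
    have h : (a • f).1 = a • f.1 := rfl
    rw [tentSpace_norm_def, tentSpace_norm_def, h, tentNorm_smul hp.out hq.out.le,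
      ENNReal.toReal_mul, toReal_enorm]

end TentInstances

variable (d X) in
/-- The space `C_c(ℝ^{d+1}_+) ⊗ X`: linear combinations of the functions `z ↦ φ z • v` with `v ∈ X`
and `φ` continuous and compactly supported in the open half-space. -/
def testFunctions : Submodule ℂ (Euc d × ℝ → X) :=
  Submodule.span ℂ {g | ∃ (φ : Euc d × ℝ → ℂ) (v : X), Continuous φ ∧ HasCompactSupport φ ∧
    tsupport φ ⊆ halfSpace d ∧ g = fun z => φ z • v}

/-! ### The operators `𝒬` and `π_L`, Hardy and BMO spaces -/

/-- `𝒬(f)(x, t) = -t L e^{-tL} f (x) = ∫ k(t, x, y) f(y) dy` on the half-space (`0` outside). -/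
def opQ (K : ℝ → Euc d → Euc d → ℂ) (f : Euc d → X) (z : Euc d × ℝ) : X :=
  open Classical in if 0 < z.2 then ∫ y, kerQ K z.2 z.1 y • f y else 0

/-- `π_L(f)(x) = ∫_0^∞ 𝒬(f(·, t))(x, t) dt / t`. -/
def opPi (K : ℝ → Euc d → Euc d → ℂ) (f : Euc d × ℝ → X) (x : Euc d) : X :=
  ∫ t in Ioi (0 : ℝ), ((t : ℂ)⁻¹) • opQ K (fun y => f (y, t)) (x, t)

/-- The integrals that define `π_L(f)` converge absolutely, at every point. -/
def PiConverges (K : ℝ → Euc d → Euc d → ℂ) (f : Euc d × ℝ → X) : Prop :=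
  ∀ x : Euc d, (∀ t, 0 < t → Integrable fun y => kerQ K t x y • f (y, t)) ∧
    IntegrableOn (fun t : ℝ => ((t : ℂ)⁻¹) • opQ K (fun y => f (y, t)) (x, t)) (Ioi 0)

/-- `f ∈ 𝒩`, and `𝒬(f)` is given by absolutely convergent integrals and strongly measurable. -/
structure InDomain (L : L2 d →ₗ.[ℂ] L2 d) (K : ℝ → Euc d → Euc d → ℂ) (f : Euc d → X) :
    Prop where
  memN : MemN L f
  integrable : ∀ t, 0 < t → ∀ x, Integrable fun y => kerQ K t x y • f y
  measurable : AEStronglyMeasurable (opQ K f) (volume.restrict (halfSpace d))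

/-- The norm `‖f‖ = ‖𝒞_q(𝒬(f))‖_p` of the space `BMO^p_{q,L}(X)`. -/
def bmoNorm (K : ℝ → Euc d → Euc d → ℂ) (p : ℝ≥0∞) (q : ℝ) (f : Euc d → X) : ℝ≥0∞ :=
  carlesonNorm p q (opQ K f)

/-- Membership in `BMO^p_{q,L}(X)`. -/
def MemBMO (L : L2 d →ₗ.[ℂ] L2 d) (K : ℝ → Euc d → Euc d → ℂ) (p : ℝ≥0∞) (q : ℝ)
    (f : Euc d → X) : Prop :=
  InDomain L K f ∧ bmoNorm K p q f < ∞

lemma MemN.smul {L : L2 d →ₗ.[ℂ] L2 d} {f : Euc d → X} (a : ℂ) (hf : MemN L f) :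
    MemN L (a • f) := by
  have key : ∀ ε, MemNeps ε f → MemNeps ε (a • f) := fun ε h =>
    h.of_bound (C := ‖a‖) le_rfl (h.1.smul a) (fun x => by simp [norm_smul])
  exact ⟨fun h => key _ (hf.1 h), fun h => (hf.2 h).imp fun ε hε => ⟨hε.1, key _ hε.2⟩⟩

lemma opQ_zero (K : ℝ → Euc d → Euc d → ℂ) : opQ K (0 : Euc d → X) = 0 := by
  funext z
  simp [opQ]

lemma opQ_add {L : L2 d →ₗ.[ℂ] L2 d} {K : ℝ → Euc d → Euc d → ℂ} {f g : Euc d → X}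
    (hf : InDomain L K f) (hg : InDomain L K g) : opQ K (f + g) = opQ K f + opQ K g := by
  funext z
  by_cases hz : 0 < z.2
  · simp only [opQ, hz, if_true, Pi.add_apply, smul_add]
    exact integral_add (hf.integrable _ hz _) (hg.integrable _ hz _)
  · simp [opQ, hz]

lemma opQ_smul (K : ℝ → Euc d → Euc d → ℂ) (a : ℂ) (f : Euc d → X) :
    opQ K (a • f) = a • opQ K f := by
  funext z
  by_cases hz : 0 < z.2
  · simp only [opQ, hz, if_true, Pi.smul_apply, smul_comm _ a]
    exact integral_smul a _
  · simp [opQ, hz]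

variable (X) in
/-- The functions `f ∈ 𝒩` with `𝒬(f) ∈ T^p_q(X)`, equivalently with `S_{q,L}(f) ∈ L^p`. -/
def hardySubmodule (L : L2 d →ₗ.[ℂ] L2 d) (K : ℝ → Euc d → Euc d → ℂ) (p q : ℝ)
    [hp : Fact (1 ≤ p)] [hq : Fact (1 < q)] : Submodule ℂ (Euc d → X) where
  carrier := {f | InDomain L K f ∧ opQ K f ∈ tentSubmodule d X p q}
  zero_mem' := ⟨⟨MemN.zero L, fun t _ x => by simp,
    by rw [opQ_zero]; exact aestronglyMeasurable_zero⟩, by rw [opQ_zero]; exact zero_mem _⟩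
  add_mem' := fun {f g} hf hg => by
    have h := opQ_add hf.1 hg.1
    have hmem : opQ K (f + g) ∈ tentSubmodule d X p q := h ▸ add_mem hf.2 hg.2
    refine ⟨⟨hf.1.memN.add hg.1.memN, fun t ht x => ?_, hmem.1⟩, hmem⟩
    simp only [Pi.add_apply, smul_add]
    exact (hf.1.integrable t ht x).add (hg.1.integrable t ht x)
  smul_mem' := fun a f hf => by
    have hmem : opQ K (a • f) ∈ tentSubmodule d X p q :=
      (opQ_smul K a f) ▸ Submodule.smul_mem _ a hf.2
    refine ⟨⟨hf.1.memN.smul a, fun t ht x => ?_, hmem.1⟩, hmem⟩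
    simp only [Pi.smul_apply, smul_comm _ a]
    exact (hf.1.integrable t ht x).smul a

variable (X) in
/-- The space `H^p_{q,L}(X)`, with the seminorm `‖𝒬(f)‖_{T^p_q(X)} = ‖S_{q,L}(f)‖_p`. Functions whose
difference is in the null space of `𝒬`, that is, is a fixed point of the semigroup, are at distance
`0` of each other, so that they are identified in the completion. -/
def HardySpace (L : L2 d →ₗ.[ℂ] L2 d) (K : ℝ → Euc d → Euc d → ℂ) (p q : ℝ)
    [Fact (1 ≤ p)] [Fact (1 < q)] : Type _ := hardySubmodule X L K p q

section HardyInstances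

variable (L : L2 d →ₗ.[ℂ] L2 d) (K : ℝ → Euc d → Euc d → ℂ) (p q : ℝ)
  [hp : Fact (1 ≤ p)] [hq : Fact (1 < q)]

instance : AddCommGroup (HardySpace X L K p q) :=
  inferInstanceAs (AddCommGroup (hardySubmodule X L K p q))

instance : Module ℂ (HardySpace X L K p q) :=
  inferInstanceAs (Module ℂ (hardySubmodule X L K p q))

variable (X) in
/-- The operator `𝒬` as a linear map from the Hardy space to the tent space. -/
def linQ : HardySpace X L K p q →ₗ[ℂ] TentSpace d X p q where
  toFun f := ⟨opQ K f.1, f.2.2⟩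
  map_add' f g := Subtype.ext (opQ_add f.2.1 g.2.1)
  map_smul' a f := Subtype.ext (opQ_smul K a f.1)

instance : SeminormedAddCommGroup (HardySpace X L K p q) :=
  SeminormedAddCommGroup.induced _ _ (linQ X L K p q)

instance : NormedSpace ℂ (HardySpace X L K p q) :=
  NormedSpace.induced ℂ _ _ (linQ X L K p q)

lemma hardySpace_norm_def (f : HardySpace X L K p q) :
    ‖f‖ = (tentNorm p q (opQ K f.1)).toReal := rfl

variable (X) in
/-- The Banach space obtained from `H^p_{q,L}(X)`. -/
abbrev HardyCompletion : Type _ := UniformSpace.Completion (HardySpace X L K p q)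

/-- On `C_c(ℝ^{d+1}_+) ⊗ X`, which is contained in the tent space, the operator `P` coincides with
`π_L`, and there `π_L` takes its values in `H^p_{q,L}(X)` itself. -/
def ExtendsPi (P : TentSpace d X p q →L[ℂ] HardyCompletion X L K p q) : Prop :=
  ∀ f ∈ testFunctions d X,
    ∃ (hT : f ∈ tentSubmodule d X p q) (hH : opPi K f ∈ hardySubmodule X L K p q),
      P (⟨f, hT⟩ : tentSubmodule d X p q) =
        UniformSpace.Completion.coe' (α := HardySpace X L K p q)
          (⟨opPi K f, hH⟩ : hardySubmodule X L K p q)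

end HardyInstances

end Functions

end

end TentHardy

open TentHardy

universe u

/-!
The proof reduces the vector valued operator `𝒬 π_L` to a positive integral operator on scalar
functions, for which the tent space estimates hold with constants that do not depend on `p` and `q`.

*Kernel estimates.* The size condition makes `e^{-tL}` a bounded semigroup on `L²` (Schur). Since
`ν < π / 2`, the resolvent set of `-L` contains the right half-plane, and there the Laplace transform
of `t² e^{-tL} f` is `2 (λ + L)⁻³ f`, of size `|λ|⁻³`. Fourier inversion on a vertical line then gives
`‖∂ₜ e^{-tL}‖ ≲ 1 / t` (`exists_hasDerivAt_semigroup`), with a constant that depends on `M` and the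
bound of the semigroup, so no contour integral is needed. Iteration and the factorization
`K(t) = K(t/4) e^{-(t/2)L} K(t/4)` bound all the time derivatives of `K(t, x, y)` by powers of `t`, and
interpolation with the size condition (`exists_norm_deriv_le`) gives
`|k(t, x, y)| ≲ t^b / (t + |x - y|)^{d+b}` for each `b < β` (`exists_norm_kerQ_le`). By the semigroup
law, `∫ k(t, x, u) k(s, u, y) du = t s ∂ₜ² K(t + s, x, y)`, which is `4 t s / (t + s)²` times the same
integral with both times equal to `(t + s) / 2`. Hence `‖𝒬 (π_L f)‖ ≲ T ‖f‖`, where `T` is the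
operator `tentOp` with the kernel `t s (t + s)⁻² (t + s)^b / (t + s + |x - y|)^{d+b}`
(`exists_isCalderonKernel`, `IsCalderonKernel.enorm_opQ_opPi_le`). The constants depend on `d`, `β`,
`c` and `M` only; here `b = min(β, 1) / 2`.

*The positive operator.* The pointwise bound `𝒞_q(T f) ≲ 𝒞_q(f)` (`exists_carlFun_tentOp_le`)
splits `f` into a local part, controlled by Schur's test, and annular parts, which decay
geometrically. For the tent space norm (`exists_areaNorm_tentOp_le`), the case `q ≤ p` is dual to
the Hardy-Littlewood maximal theorem: `∫ 𝒜_q(T f)^q g ≲ ∫ 𝒜_q(f)^q M g`, and the norm of `M` on the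
dual of `L^{p/q}` is of order `p / q`. It enters with the power `1 / q`, whence the factor `p^{1/q}`.
For `p < q` one tests against `F^{q-1}` times averages of `𝒜_q(F)^{p-q}`, where `F ≤ T f` has finite
norm. If `p' ≤ 2 q'` this is controlled by the first case for the dual exponents; otherwise, including
`p = 1`, by the Coifman-Meyer-Stein duality of `𝒜_q` and `𝒞_{q'}` and the Carleson bound.

*Extension.* `C_c(ℝ^{d+1}_+) ⊗ X` is dense in the tent space
(`exists_testFunction_tentNorm_sub_lt`), so that the bounded extension of `π_L` exists and is unique.
-/


namespace TentHardy

noncomputable section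

/-! ### Suprema over balls and the maximal function -/

/-- The supremum of `φ a r` over the balls `B(a, r)` that contain `x`. -/
def ballSup {d : ℕ} (φ : Euc d → ℝ → ℝ≥0∞) (x : Euc d) : ℝ≥0∞ :=
  ⨆ (a : Euc d) (r : ℝ) (_ : 0 < r) (_ : x ∈ Metric.ball a r), φ a r

variable {d : ℕ}

lemma le_ballSup (φ : Euc d → ℝ → ℝ≥0∞) {x a : Euc d} {r : ℝ} (hr : 0 < r)
    (hx : x ∈ Metric.ball a r) : φ a r ≤ ballSup φ x :=
  le_iSup_of_le a <| le_iSup_of_le r <| le_iSup_of_le hr <| le_iSup_of_le hx le_rfl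

lemma ballSup_le {φ : Euc d → ℝ → ℝ≥0∞} {x : Euc d} {c : ℝ≥0∞}
    (h : ∀ a r, 0 < r → x ∈ Metric.ball a r → φ a r ≤ c) : ballSup φ x ≤ c :=
  iSup_le fun a => iSup_le fun r => iSup_le fun hr => iSup_le fun hx => h a r hr hx

lemma lt_ballSup_iff {φ : Euc d → ℝ → ℝ≥0∞} {x : Euc d} {c : ℝ≥0∞} :
    c < ballSup φ x ↔ ∃ a r, 0 < r ∧ x ∈ Metric.ball a r ∧ c < φ a r := by
  simp only [ballSup, lt_iSup_iff, exists_prop]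

/-- A supremum over the open balls containing the point is lower semicontinuous. -/
lemma measurable_ballSup (φ : Euc d → ℝ → ℝ≥0∞) : Measurable (ballSup φ) := by
  refine measurable_of_Ioi fun c => ?_
  have : ballSup φ ⁻¹' Ioi c =
      ⋃ (a : Euc d) (r : ℝ) (_ : 0 < r ∧ c < φ a r), Metric.ball a r := by
    ext x
    simp only [mem_preimage, mem_Ioi, lt_ballSup_iff, mem_iUnion, exists_prop]
    refine exists_congr fun a => exists_congr fun r => ?_
    tauto
  rw [this]
  exact (isOpen_iUnion fun a => isOpen_iUnion fun r => isOpen_iUnion fun _ =>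
    Metric.isOpen_ball).measurableSet

/-- The average of `h` over the ball `B(a, r)`. -/
def ballAvg (h : Euc d → ℝ≥0∞) (a : Euc d) (r : ℝ) : ℝ≥0∞ :=
  (volume (Metric.ball a r))⁻¹ * ∫⁻ y in Metric.ball a r, h y

/-- The uncentered Hardy-Littlewood maximal function. -/
def maxFun (h : Euc d → ℝ≥0∞) : Euc d → ℝ≥0∞ := ballSup (ballAvg h)

lemma volume_ball_pos (a : Euc d) {r : ℝ} (hr : 0 < r) : volume (Metric.ball a r) ≠ 0 :=
  (Metric.measure_ball_pos volume a hr).ne'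

lemma volume_ball_ne_top (a : Euc d) (r : ℝ) : volume (Metric.ball a r) ≠ ∞ :=
  measure_ball_lt_top.ne

/-- The volume of the unit ball. -/
def unitVol (d : ℕ) : ℝ≥0∞ := volume (Metric.ball (0 : Euc d) 1)

lemma unitVol_ne_zero : unitVol d ≠ 0 := volume_ball_pos _ one_pos

lemma unitVol_ne_top : unitVol d ≠ ∞ := volume_ball_ne_top _ _

lemma volume_ball_eq (a : Euc d) {r : ℝ} (hr : 0 < r) :
    volume (Metric.ball a r) = ENNReal.ofReal (r ^ d) * unitVol d := by
  have := Measure.addHaar_ball_of_pos (volume : Measure (Euc d)) a hr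
  simpa [unitVol] using this

lemma volume_ball_mul (a b : Euc d) {r s : ℝ} (hr : 0 < r) (hs : 0 < s) :
    volume (Metric.ball a (s * r)) = ENNReal.ofReal (s ^ d) * volume (Metric.ball b r) := by
  rw [volume_ball_eq a (by positivity), volume_ball_eq b hr, mul_pow,
    ENNReal.ofReal_mul (by positivity), mul_assoc]

lemma lintegral_ball_eq (h : Euc d → ℝ≥0∞) (a : Euc d) {r : ℝ} (hr : 0 < r) :
    ∫⁻ y in Metric.ball a r, h y = volume (Metric.ball a r) * ballAvg h a r := by
  rw [ballAvg, ← mul_assoc, ENNReal.mul_inv_cancel (volume_ball_pos a hr)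
    (volume_ball_ne_top a r), one_mul]

lemma ballAvg_le_maxFun (h : Euc d → ℝ≥0∞) {x a : Euc d} {r : ℝ} (hr : 0 < r)
    (hx : x ∈ Metric.ball a r) : ballAvg h a r ≤ maxFun h x :=
  le_ballSup (ballAvg h) hr hx

lemma measurable_maxFun (h : Euc d → ℝ≥0∞) : Measurable (maxFun h) := measurable_ballSup _

lemma ballAvg_mono {h g : Euc d → ℝ≥0∞} (hg : ∀ x, h x ≤ g x) (a : Euc d) (r : ℝ) :
    ballAvg h a r ≤ ballAvg g a r := by
  unfold ballAvg; gcongr; exact hg _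

lemma ballAvg_const (c : ℝ≥0∞) (a : Euc d) {r : ℝ} (hr : 0 < r) :
    ballAvg (fun _ => c) a r = c := by
  simp only [ballAvg, lintegral_const, Measure.restrict_apply_univ]
  rw [mul_comm c, ← mul_assoc, ENNReal.inv_mul_cancel (volume_ball_pos a hr)
    (volume_ball_ne_top a r), one_mul]

lemma maxFun_const_le (c : ℝ≥0∞) (x : Euc d) : maxFun (fun _ => c) x ≤ c :=
  ballSup_le fun a _ hr _ => (ballAvg_const c a hr).le

/-- The weak type `(1, 1)` inequality, from the Vitali covering lemma. -/
lemma volume_maxFun_gt_le (hd : 0 < d) {h : Euc d → ℝ≥0∞} {l : ℝ≥0∞}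
    (hl : l ≠ 0) (hl' : l ≠ ∞) :
    l * volume {x | l < maxFun h x} ≤ 5 ^ d * ∫⁻ x, h x := by
  by_cases htop : ∫⁻ x, h x = ∞
  · rw [htop, ENNReal.mul_top (by simp)]; exact le_top
  let t : Set (Euc d × ℝ) := {p | 0 < p.2 ∧ l < ballAvg h p.1 p.2}
  have hball : ∀ p ∈ t, l * volume (Metric.ball p.1 p.2) ≤ ∫⁻ y in Metric.ball p.1 p.2, h y := by
    intro p hp
    rw [lintegral_ball_eq h p.1 hp.1, mul_comm]
    gcongr
    exact hp.2.le
  -- the radii are bounded because `h` is integrable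
  obtain ⟨R, hR⟩ : ∃ R, ∀ p ∈ t, p.2 ≤ R := by
    let V := (∫⁻ x, h x) / (l * unitVol d)
    have hV : V ≠ ∞ := ENNReal.div_ne_top htop (mul_ne_zero hl unitVol_ne_zero)
    refine ⟨max 1 V.toReal, fun p hp => ?_⟩
    by_cases h1 : p.2 ≤ 1
    · exact h1.trans (le_max_left _ _)
    push Not at h1
    refine le_trans ?_ (le_max_right _ _)
    have h2 : ENNReal.ofReal (p.2 ^ d) ≤ V := by
      rw [ENNReal.le_div_iff_mul_le (Or.inl (mul_ne_zero hl unitVol_ne_zero))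
        (Or.inl (ENNReal.mul_ne_top hl' unitVol_ne_top))]
      calc ENNReal.ofReal (p.2 ^ d) * (l * unitVol d)
          = l * volume (Metric.ball p.1 p.2) := by rw [volume_ball_eq _ hp.1]; ring
        _ ≤ _ := (hball p hp).trans (setLIntegral_le_lintegral _ _)
    have h3 := (ENNReal.ofReal_le_iff_le_toReal hV).1 h2
    exact (le_self_pow₀ h1.le hd.ne').trans h3
  obtain ⟨u, hut, hdisj, hcov⟩ := Vitali.exists_disjoint_subfamily_covering_enlargement_ball t
    (fun p => p.1) (fun p => p.2) R hR 5 (by norm_num)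
  have hcount : u.Countable := hdisj.countable_of_isOpen (fun _ _ => Metric.isOpen_ball)
    (fun p hp => Metric.nonempty_ball.2 (hut hp).1)
  have hsub : {x | l < maxFun h x} ⊆ ⋃ p ∈ u, Metric.ball p.1 (5 * p.2) := by
    intro x hx
    obtain ⟨a, r, hr, hxa, hlt⟩ := lt_ballSup_iff.1 hx
    obtain ⟨b, hb, hsub⟩ := hcov (a, r) ⟨hr, hlt⟩
    exact mem_biUnion hb (hsub hxa)
  have : Countable u := hcount.to_subtype
  calc l * volume {x | l < maxFun h x}
      ≤ l * ∑' p : u, volume (Metric.ball p.1.1 (5 * p.1.2)) := by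
        gcongr
        exact (measure_mono hsub).trans (measure_biUnion_le _ hcount _)
    _ = ∑' p : u, 5 ^ d * (l * volume (Metric.ball p.1.1 p.1.2)) := by
        rw [← ENNReal.tsum_mul_left]
        refine tsum_congr fun p => ?_
        rw [volume_ball_mul p.1.1 p.1.1 (hut p.2).1 (by norm_num : (0 : ℝ) < 5),
          ENNReal.ofReal_pow (by norm_num)]
        norm_num
        ring
    _ ≤ ∑' p : u, 5 ^ d * ∫⁻ y in Metric.ball p.1.1 p.1.2, h y :=
        ENNReal.tsum_le_tsum fun p => by gcongr; exact hball _ (hut p.2)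
    _ = 5 ^ d * ∫⁻ y in ⋃ p ∈ u, Metric.ball p.1 p.2, h y := by
        rw [ENNReal.tsum_mul_left, lintegral_biUnion hcount
          (fun _ _ => Metric.isOpen_ball.measurableSet) hdisj]
    _ ≤ _ := by gcongr; exact Measure.restrict_le_self

/-- The layer cake formula for one number. -/
lemma lintegral_layer (a : ℝ≥0∞) {s : ℝ} (hs : 0 < s) :
    ∫⁻ l in Ioi (0 : ℝ), ENNReal.ofReal (s * l ^ (s - 1)) *
      {l : ℝ | ENNReal.ofReal l < a}.indicator 1 l = a ^ s := by
  have hfin : ∀ b : ℝ, 0 ≤ b → ∫⁻ l in Ioc (0 : ℝ) b, ENNReal.ofReal (s * l ^ (s - 1)) =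
      ENNReal.ofReal b ^ s := by
    intro b hb
    have hint : IntervalIntegrable (fun l : ℝ => s * l ^ (s - 1)) volume 0 b :=
      (intervalIntegral.intervalIntegrable_rpow' (by linarith)).const_mul s
    rw [← ofReal_integral_eq_lintegral_ofReal
      ((intervalIntegrable_iff_integrableOn_Ioc_of_le hb).1 hint), ←
      intervalIntegral.integral_of_le hb, intervalIntegral.integral_const_mul,
      integral_rpow (Or.inl (by linarith))]
    · simp only [sub_add_cancel]
      rw [Real.zero_rpow hs.ne', sub_zero, mul_div_cancel₀ _ hs.ne',
        ENNReal.ofReal_rpow_of_nonneg hb hs.le]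
    · filter_upwards [ae_restrict_mem measurableSet_Ioc] with l hl
      exact mul_nonneg hs.le (Real.rpow_nonneg hl.1.le _)
  have hind : ∀ S : Set ℝ, MeasurableSet S →
      ∫⁻ l in Ioi (0 : ℝ), ENNReal.ofReal (s * l ^ (s - 1)) * S.indicator 1 l =
      ∫⁻ l in S ∩ Ioi (0 : ℝ), ENNReal.ofReal (s * l ^ (s - 1)) := by
    intro S hS
    rw [← Measure.restrict_restrict hS, ← lintegral_indicator hS]
    refine lintegral_congr fun l => ?_
    by_cases h : l ∈ S <;> simp [h]
  have hmeas : MeasurableSet {l : ℝ | ENNReal.ofReal l < a} :=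
    measurableSet_lt (by fun_prop) measurable_const
  rw [hind _ hmeas]
  by_cases ha : a = ∞
  · subst ha
    rw [ENNReal.top_rpow_of_pos hs, eq_top_iff]
    refine ENNReal.le_of_forall_nnreal_lt fun r _ => ?_
    calc (r : ℝ≥0∞) = ENNReal.ofReal ((r : ℝ) ^ (1 / s)) ^ s := by
          rw [ENNReal.ofReal_rpow_of_nonneg (by positivity) hs.le, ← Real.rpow_mul (by positivity),
            one_div_mul_cancel hs.ne', Real.rpow_one, ENNReal.ofReal_coe_nnreal]
      _ = ∫⁻ l in Ioc (0 : ℝ) ((r : ℝ) ^ (1 / s)), ENNReal.ofReal (s * l ^ (s - 1)) :=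
          (hfin _ (by positivity)).symm
      _ ≤ _ := by
          refine lintegral_mono_set ?_
          intro l hl
          exact ⟨ENNReal.ofReal_lt_top, hl.1⟩
  · have heq : ({l : ℝ | ENNReal.ofReal l < a} ∩ Ioi 0) = Ioo 0 a.toReal := by
      ext l
      simp only [mem_inter_iff, mem_ofPred_eq, mem_Ioi, mem_Ioo]
      constructor
      · rintro ⟨h1, h2⟩; exact ⟨h2, (ENNReal.ofReal_lt_iff_lt_toReal h2.le ha).1 h1⟩
      · rintro ⟨h1, h2⟩; exact ⟨(ENNReal.ofReal_lt_iff_lt_toReal h1.le ha).2 h2, h1⟩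
    rw [heq, Measure.restrict_congr_set Ioo_ae_eq_Ioc, hfin _ ENNReal.toReal_nonneg,
      ENNReal.ofReal_toReal ha]

lemma maxFun_le_add (h : Euc d → ℝ≥0∞) (hm : Measurable h) (c : ℝ≥0∞) (x : Euc d) :
    maxFun h x ≤ maxFun ({y | c < h y}.indicator h) x + c := by
  have hS : MeasurableSet {y | c < h y} := measurableSet_lt measurable_const hm
  refine ballSup_le fun a r hr hx => ?_
  calc ballAvg h a r ≤ ballAvg (fun y => {y | c < h y}.indicator h y + c) a r := by
        refine ballAvg_mono (fun y => ?_) a r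
        by_cases hy : c < h y
        · simp [hy]
        · simp [hy]; exact not_lt.1 hy
    _ = ballAvg ({y | c < h y}.indicator h) a r + ballAvg (fun _ => c) a r := by
        unfold ballAvg
        rw [lintegral_add_right _ measurable_const, mul_add]
    _ ≤ _ := by
        gcongr
        · exact ballAvg_le_maxFun _ hr hx
        · exact (ballAvg_const c a hr).le

/-- The maximal theorem in `L^s`, `1 < s < ∞`, with the sharp order of growth as `s → 1`. -/
lemma lintegral_maxFun_rpow_le (hd : 0 < d) {s : ℝ} (hs : 1 < s) {h : Euc d → ℝ≥0∞}
    (hm : Measurable h) :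
    ∫⁻ x, maxFun h x ^ s ≤
      ENNReal.ofReal (2 ^ s * 5 ^ d * (s / (s - 1))) * ∫⁻ x, h x ^ s := by
  have hs0 : 0 < s := by linarith
  have hs1 : 0 < s - 1 := by linarith
  have hmM : Measurable fun p : Euc d × ℝ => {l : ℝ | ENNReal.ofReal l < maxFun h p.1}.indicator
      (1 : ℝ → ℝ≥0∞) p.2 := by
    have : MeasurableSet {p : Euc d × ℝ | ENNReal.ofReal p.2 < maxFun h p.1} :=
      measurableSet_lt (by fun_prop) ((measurable_maxFun h).comp measurable_fst)
    exact (measurable_one.indicator this)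
  have hmh : Measurable fun p : Euc d × ℝ => {l : ℝ | ENNReal.ofReal l < 2 * h p.1}.indicator
      (1 : ℝ → ℝ≥0∞) p.2 := by
    have : MeasurableSet {p : Euc d × ℝ | ENNReal.ofReal p.2 < 2 * h p.1} :=
      measurableSet_lt (by fun_prop) ((hm.comp measurable_fst).const_mul 2)
    exact (measurable_one.indicator this)
  -- the weak type inequality for the part of `h` above `l / 2`
  have hweak : ∀ l : ℝ, 0 < l → volume {x | ENNReal.ofReal l < maxFun h x} ≤
      ENNReal.ofReal (2 * 5 ^ d * l⁻¹) *
        ∫⁻ x, {l : ℝ | ENNReal.ofReal l < 2 * h x}.indicator 1 l * h x := by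
    intro l hl
    set c : ℝ≥0∞ := ENNReal.ofReal (l / 2) with hc
    have hc0 : c ≠ 0 := by simp [hc, hl]
    have hcc : ENNReal.ofReal l = c + c := by
      rw [hc, ← ENNReal.ofReal_add (by positivity) (by positivity)]; congr 1; ring
    have h1 : {x | ENNReal.ofReal l < maxFun h x} ⊆
        {x | c < maxFun ({y | c < h y}.indicator h) x} := by
      intro x hx
      have h2 := lt_of_lt_of_le (mem_ofPred_eq ▸ hx) (maxFun_le_add h hm c x)
      rw [hcc] at h2
      exact lt_of_add_lt_add_right h2
    have h3 := volume_maxFun_gt_le hd (h := {y | c < h y}.indicator h) hc0 ENNReal.ofReal_ne_top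
    have h4 : ∫⁻ x, {y | c < h y}.indicator h x =
        ∫⁻ x, {l : ℝ | ENNReal.ofReal l < 2 * h x}.indicator 1 l * h x := by
      refine lintegral_congr fun x => ?_
      have : c < h x ↔ ENNReal.ofReal l < 2 * h x := by
        rw [hcc, ← two_mul]
        exact (ENNReal.mul_lt_mul_iff_right (by simp) (by simp)).symm
      by_cases hx : c < h x
      · rw [indicator_of_mem (by exact hx), indicator_of_mem (by exact this.1 hx)]; simp
      · rw [indicator_of_notMem (by exact hx),
          indicator_of_notMem (by exact fun h => hx (this.2 h))]; simp
    calc volume {x | ENNReal.ofReal l < maxFun h x}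
        ≤ volume {x | c < maxFun ({y | c < h y}.indicator h) x} := measure_mono h1
      _ = c⁻¹ * (c * volume {x | c < maxFun ({y | c < h y}.indicator h) x}) := by
          rw [← mul_assoc, ENNReal.inv_mul_cancel hc0 ENNReal.ofReal_ne_top, one_mul]
      _ ≤ c⁻¹ * (5 ^ d * ∫⁻ x, {y | c < h y}.indicator h x) := by gcongr
      _ = _ := by
          rw [h4, ← mul_assoc]
          congr 1
          rw [hc, ← ENNReal.ofReal_inv_of_pos (by positivity)]
          have : (5 : ℝ≥0∞) ^ d = ENNReal.ofReal (5 ^ d) := by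
            rw [ENNReal.ofReal_pow (by norm_num)]; norm_num
          rw [this, ← ENNReal.ofReal_mul (by positivity)]
          congr 1
          field_simp
  calc ∫⁻ x, maxFun h x ^ s
      = ∫⁻ x, ∫⁻ l in Ioi (0 : ℝ), ENNReal.ofReal (s * l ^ (s - 1)) *
          {l : ℝ | ENNReal.ofReal l < maxFun h x}.indicator 1 l := by
        simp_rw [lintegral_layer _ hs0]
    _ = ∫⁻ l in Ioi (0 : ℝ), ENNReal.ofReal (s * l ^ (s - 1)) *
          volume {x | ENNReal.ofReal l < maxFun h x} := by
        rw [lintegral_lintegral_swap]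
        · refine lintegral_congr fun l => ?_
          rw [lintegral_const_mul']
          · congr 1
            have : (fun x => {l : ℝ | ENNReal.ofReal l < maxFun h x}.indicator
                (1 : ℝ → ℝ≥0∞) l) = {x | ENNReal.ofReal l < maxFun h x}.indicator 1 := by
              ext x; simp [indicator]
            rw [this, lintegral_indicator_one
              (measurableSet_lt measurable_const (measurable_maxFun h))]
          · exact ENNReal.ofReal_ne_top
        · exact (Measurable.mul (by fun_prop) hmM).aemeasurable
    _ ≤ ∫⁻ l in Ioi (0 : ℝ), ENNReal.ofReal (2 * 5 ^ d * (s / (s - 1))) *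
          ∫⁻ x, (ENNReal.ofReal ((s - 1) * l ^ (s - 1 - 1)) *
            {l : ℝ | ENNReal.ofReal l < 2 * h x}.indicator 1 l) * h x := by
        refine setLIntegral_mono' measurableSet_Ioi fun l hl => ?_
        have hl : 0 < l := hl
        refine (mul_le_mul_right (hweak l hl) _).trans (le_of_eq ?_)
        simp_rw [mul_assoc (ENNReal.ofReal ((s - 1) * l ^ (s - 1 - 1)))]
        rw [lintegral_const_mul' _ _ ENNReal.ofReal_ne_top, ← mul_assoc, ← mul_assoc,
          ← ENNReal.ofReal_mul (by positivity), ← ENNReal.ofReal_mul (by positivity)]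
        congr 2
        rw [Real.rpow_sub_one hl.ne' (s - 1)]
        field_simp
    _ = ENNReal.ofReal (2 * 5 ^ d * (s / (s - 1))) * ∫⁻ x, (2 * h x) ^ (s - 1) * h x := by
        rw [lintegral_const_mul' _ _ ENNReal.ofReal_ne_top, lintegral_lintegral_swap]
        · congr 1
          refine lintegral_congr fun x => ?_
          rw [lintegral_mul_const, lintegral_layer _ hs1]
          exact Measurable.mul (by fun_prop) (hmh.comp (by fun_prop : Measurable fun l : ℝ => (x, l)))
        · refine (Measurable.mul (Measurable.mul (by fun_prop) ?_) ?_).aemeasurable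
          · exact hmh.comp measurable_swap
          · exact hm.comp measurable_snd
    _ = _ := by
        have : ∀ x, (2 * h x) ^ (s - 1) * h x = ENNReal.ofReal (2 ^ (s - 1)) * h x ^ s := by
          intro x
          rw [ENNReal.mul_rpow_of_nonneg _ _ hs1.le, mul_assoc]
          congr 1
          · rw [← ENNReal.ofReal_rpow_of_pos (by norm_num)]; simp
          · by_cases h0 : h x = 0
            · simp [h0, hs0]
            by_cases hi : h x = ∞
            · simp [hi, hs0, hs1]
            nth_rewrite 2 [← ENNReal.rpow_one (h x)]
            rw [← ENNReal.rpow_add _ _ h0 hi, sub_add_cancel]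
        simp_rw [this]
        rw [lintegral_const_mul' _ _ ENNReal.ofReal_ne_top, ← mul_assoc,
          ← ENNReal.ofReal_mul (by positivity)]
        congr 2
        rw [Real.rpow_sub_one (by norm_num)]
        ring

/-- The converse of Hölder's inequality: the `L^r` norm is obtained by duality. -/
lemma rpow_lintegral_le_of_forall_mul {a : Euc d → ℝ≥0∞} (ha : Measurable a) {r r' : ℝ}
    (hr : r.HolderConjugate r') {B : ℝ≥0∞}
    (h : ∀ g : Euc d → ℝ≥0∞, Measurable g →
      ∫⁻ x, a x * g x ≤ B * (∫⁻ x, g x ^ r') ^ (1 / r')) :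
    (∫⁻ x, a x ^ r) ^ (1 / r) ≤ B := by
  have hr0 : 0 < r := hr.pos
  -- truncations of `a`, for which the integral is finite
  let b : ℕ → Euc d → ℝ≥0∞ := fun n => (Metric.ball (0 : Euc d) n).indicator (fun x => min (a x) n)
  have hb : ∀ n, Measurable (b n) := fun n =>
    (ha.min measurable_const).indicator Metric.isOpen_ball.measurableSet
  have hbmono : Monotone b := by
    intro m n hmn x
    have hc : (m : ℝ) ≤ n := by exact_mod_cast hmn
    have hc' : (m : ℝ≥0∞) ≤ n := by exact_mod_cast hmn
    simp only [b]
    by_cases hx : x ∈ Metric.ball (0 : Euc d) m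
    · rw [indicator_of_mem hx, indicator_of_mem (Metric.ball_subset_ball hc hx)]
      exact min_le_min le_rfl hc'
    · rw [indicator_of_notMem hx]; exact zero_le
  have hba : ∀ n x, b n x ≤ a x := fun n x =>
    (indicator_le_self' (fun _ _ => zero_le) x).trans (min_le_left _ _)
  have hsup : ∀ x, ⨆ n, b n x = a x := by
    intro x
    refine le_antisymm (iSup_le fun n => hba n x) ?_
    refine le_of_forall_lt fun c hc => ?_
    obtain ⟨n, hn⟩ := exists_nat_gt ‖x‖
    obtain ⟨m, hm⟩ := ENNReal.exists_nat_gt (ne_top_of_lt hc)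
    refine lt_of_lt_of_le ?_ (le_iSup _ (max n m))
    have hx : x ∈ Metric.ball (0 : Euc d) ((max n m : ℕ) : ℝ) := by
      rw [mem_ball_zero_iff]
      exact hn.trans_le (by exact_mod_cast le_max_left n m)
    simp only [b, indicator_of_mem hx]
    exact lt_min hc (hm.trans_le (by exact_mod_cast le_max_right n m))
  have hfin : ∀ n, ∫⁻ x, b n x ^ r ≠ ∞ := by
    intro n
    refine ne_top_of_le_ne_top (b := (n : ℝ≥0∞) ^ r * volume (Metric.ball (0 : Euc d) n))
      (ENNReal.mul_ne_top (ENNReal.rpow_ne_top_of_nonneg hr0.le (by simp))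
        (volume_ball_ne_top _ _)) ?_
    rw [← setLIntegral_const, ← lintegral_indicator Metric.isOpen_ball.measurableSet]
    refine lintegral_mono fun x => ?_
    simp only [b]
    by_cases hx : x ∈ Metric.ball (0 : Euc d) n
    · rw [indicator_of_mem hx, indicator_of_mem hx]
      exact ENNReal.rpow_le_rpow (min_le_right _ _) hr0.le
    · rw [indicator_of_notMem hx, indicator_of_notMem hx, ENNReal.zero_rpow_of_pos hr0]
  have hbound : ∀ n, ∫⁻ x, b n x ^ r ≤ B ^ r := by
    intro n
    set I := ∫⁻ x, b n x ^ r with hI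
    by_cases hI0 : I = 0
    · rw [hI0]; exact zero_le
    have h1 : I ≤ B * I ^ (1 / r') := by
      calc I ≤ ∫⁻ x, a x * b n x ^ (r - 1) := by
            refine lintegral_mono fun x => ?_
            by_cases h0 : b n x = 0
            · simp [h0, hr0]
            have hi : b n x ≠ ∞ := by
              simp only [b, indicator]
              split_ifs
              · exact ne_top_of_le_ne_top (by simp) (min_le_right _ _)
              · simp
            calc b n x ^ r = b n x ^ (1 + (r - 1)) := by congr 1; ring
              _ = b n x * b n x ^ (r - 1) := by rw [ENNReal.rpow_add _ _ h0 hi, ENNReal.rpow_one]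
              _ ≤ _ := by gcongr; exact hba n x
        _ ≤ B * (∫⁻ x, (b n x ^ (r - 1)) ^ r') ^ (1 / r') := h _ ((hb n).pow_const _)
        _ = B * I ^ (1 / r') := by
            simp_rw [← ENNReal.rpow_mul, hr.sub_one_mul_conj]; rfl
    have h2 : I = I ^ (1 / r) * I ^ (1 / r') := by
      rw [← ENNReal.rpow_add _ _ hI0 (hfin n), one_div, one_div, hr.inv_add_inv_eq_one,
        ENNReal.rpow_one]
    have h3 : I ^ (1 / r) ≤ B := by
      have h4 := h2.symm.le.trans h1
      rw [ENNReal.mul_le_mul_iff_left] at h4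
      · exact h4
      · exact (ENNReal.rpow_pos (pos_iff_ne_zero.2 hI0) (hfin n)).ne'
      · exact ENNReal.rpow_ne_top_of_nonneg (by have := hr.symm.pos; positivity) (hfin n)
    calc I = (I ^ (1 / r)) ^ r := by
          rw [← ENNReal.rpow_mul, one_div_mul_cancel hr0.ne', ENNReal.rpow_one]
      _ ≤ B ^ r := ENNReal.rpow_le_rpow h3 hr0.le
  have hlim : ∫⁻ x, a x ^ r = ⨆ n, ∫⁻ x, b n x ^ r := by
    rw [← lintegral_iSup (fun n => (hb n).pow_const r)
      (fun m n hmn x => ENNReal.rpow_le_rpow (hbmono hmn x) hr0.le)]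
    refine lintegral_congr fun x => ?_
    rw [← hsup x]
    exact (ENNReal.monotone_rpow_of_nonneg hr0.le).map_iSup_of_continuousAt
      ENNReal.continuous_rpow_const.continuousAt (by simp [hr0])
  calc (∫⁻ x, a x ^ r) ^ (1 / r) ≤ (B ^ r) ^ (1 / r) := by
        rw [hlim]; gcongr; exact iSup_le hbound
    _ = B := by rw [← ENNReal.rpow_mul, mul_one_div_cancel hr0.ne', ENNReal.rpow_one]

end

end TentHardy

namespace TentHardy

noncomputable section

open scoped NNReal

variable {d : ℕ}

/-! ### Integration over the half-space and over cones -/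

instance (k : ℕ) : SFinite (hsMeasure d k) := by unfold hsMeasure; infer_instance

lemma measurableSet_halfSpace : MeasurableSet (halfSpace d) :=
  (isOpen_lt continuous_const continuous_snd).measurableSet

lemma measurableSet_cone (x : Euc d) : MeasurableSet (cone x) :=
  (isOpen_lt (by fun_prop) (by fun_prop)).measurableSet

lemma ae_hsMeasure_pos (k : ℕ) : ∀ᵐ z ∂hsMeasure d k, 0 < z.2 :=
  (ac_hsMeasure k).ae_le (ae_restrict_mem measurableSet_halfSpace)

lemma volume_restrict_halfSpace :
    (volume : Measure (Euc d × ℝ)).restrict (halfSpace d) =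
      (volume : Measure (Euc d)).prod (volume.restrict (Ioi (0 : ℝ))) := by
  have : halfSpace d = univ ×ˢ Ioi (0 : ℝ) := by ext z; simp [halfSpace]
  rw [this, Measure.volume_eq_prod, ← Measure.prod_restrict, Measure.restrict_univ]

lemma lintegral_hsMeasure (k : ℕ) {g : Euc d × ℝ → ℝ≥0∞} (hg : Measurable g) :
    ∫⁻ z, g z ∂hsMeasure d k =
      ∫⁻ t in Ioi (0 : ℝ), ENNReal.ofReal ((t ^ k)⁻¹) * ∫⁻ y, g (y, t) := by
  have hd : Measurable fun z : Euc d × ℝ => ENNReal.ofReal ((z.2 ^ k)⁻¹) := by fun_prop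
  rw [hsMeasure, lintegral_withDensity_eq_lintegral_mul _ hd hg, volume_restrict_halfSpace,
    lintegral_prod_symm _ (hd.mul hg).aemeasurable]
  refine lintegral_congr fun t => ?_
  simp only [Pi.mul_apply]
  rw [lintegral_const_mul' _ _ ENNReal.ofReal_ne_top]

lemma lintegral_hsMeasure_succ {g : Euc d × ℝ → ℝ≥0∞} (hg : Measurable g) :
    ∫⁻ z, g z ∂hsMeasure d (d + 1) =
      ∫⁻ z, ENNReal.ofReal ((z.2 ^ d)⁻¹) * g z ∂hsMeasure d 1 := by
  have h1 : Measurable fun z : Euc d × ℝ => ENNReal.ofReal ((z.2 ^ d)⁻¹) * g z :=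
    Measurable.mul (by fun_prop) hg
  rw [lintegral_hsMeasure _ hg, lintegral_hsMeasure _ h1]
  refine setLIntegral_congr_fun measurableSet_Ioi fun t ht => ?_
  have ht : 0 < t := ht
  simp only
  rw [lintegral_const_mul' _ _ ENNReal.ofReal_ne_top, ← mul_assoc,
    ← ENNReal.ofReal_mul (by positivity)]
  congr 2
  rw [pow_succ, pow_one, mul_inv_rev]

lemma mem_cone_iff {x : Euc d} {z : Euc d × ℝ} : z ∈ cone x ↔ x ∈ Metric.ball z.1 z.2 := by
  rw [Metric.mem_ball, dist_eq_norm, norm_sub_rev]; rfl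

lemma measurableSet_cone_prod :
    MeasurableSet {p : Euc d × (Euc d × ℝ) | p.2 ∈ cone p.1} :=
  (isOpen_lt (by fun_prop) (by fun_prop) :
    IsOpen {p : Euc d × (Euc d × ℝ) | ‖p.2.1 - p.1‖ < p.2.2}).measurableSet

/-- Fubini's theorem for the cones: integrating over the vertex of the cone replaces the integral
over the cone by an average over the shadow of the point. -/
lemma lintegral_cone {Φ : Euc d → Euc d × ℝ → ℝ≥0∞} (hΦ : Measurable (Function.uncurry Φ)) :
    ∫⁻ x, ∫⁻ z in cone x, Φ x z ∂hsMeasure d (d + 1) =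
      unitVol d * ∫⁻ z, ballAvg (fun x => Φ x z) z.1 z.2 ∂hsMeasure d 1 := by
  have hm : Measurable fun p : Euc d × (Euc d × ℝ) =>
      {p : Euc d × (Euc d × ℝ) | p.2 ∈ cone p.1}.indicator (Function.uncurry Φ) p :=
    hΦ.indicator measurableSet_cone_prod
  have hin : ∀ z : Euc d × ℝ, ∫⁻ x, {p : Euc d × (Euc d × ℝ) | p.2 ∈ cone p.1}.indicator
      (Function.uncurry Φ) (x, z) = ∫⁻ x in Metric.ball z.1 z.2, Φ x z := by
    intro z
    rw [← lintegral_indicator Metric.isOpen_ball.measurableSet]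
    refine lintegral_congr fun x => ?_
    by_cases h : x ∈ Metric.ball z.1 z.2
    · rw [indicator_of_mem h, indicator_of_mem (by exact mem_cone_iff.2 h)]; rfl
    · rw [indicator_of_notMem h, indicator_of_notMem (by exact fun h' => h (mem_cone_iff.1 h'))]
  calc ∫⁻ x, ∫⁻ z in cone x, Φ x z ∂hsMeasure d (d + 1)
      = ∫⁻ x, ∫⁻ z, {p : Euc d × (Euc d × ℝ) | p.2 ∈ cone p.1}.indicator
          (Function.uncurry Φ) (x, z) ∂hsMeasure d (d + 1) := by
        refine lintegral_congr fun x => ?_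
        rw [← lintegral_indicator (measurableSet_cone x)]
        refine lintegral_congr fun z => ?_
        by_cases h : z ∈ cone x
        · rw [indicator_of_mem h, indicator_of_mem (by exact h)]; rfl
        · rw [indicator_of_notMem h, indicator_of_notMem (by exact h)]
    _ = ∫⁻ z, (∫⁻ x in Metric.ball z.1 z.2, Φ x z) ∂hsMeasure d (d + 1) := by
        rw [lintegral_lintegral_swap hm.aemeasurable]
        simp_rw [hin]
    _ = unitVol d * ∫⁻ z, ballAvg (fun x => Φ x z) z.1 z.2 ∂hsMeasure d 1 := by
        rw [lintegral_hsMeasure_succ, ← lintegral_const_mul' _ _ unitVol_ne_top]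
        · refine lintegral_congr_ae ?_
          filter_upwards [ae_hsMeasure_pos 1] with z hz
          rw [lintegral_ball_eq _ _ hz, volume_ball_eq _ hz, ← mul_assoc, ← mul_assoc,
            ← ENNReal.ofReal_mul (by positivity), inv_mul_cancel₀ (by positivity)]
          simp
        · simp_rw [← hin]
          exact hm.lintegral_prod_left

/-- The area integral `∫_{Γ(x)} f^q dy dt / t^{d+1}` of a nonnegative function. -/
def areaPow (q : ℝ) (f : Euc d × ℝ → ℝ≥0∞) (x : Euc d) : ℝ≥0∞ :=
  ∫⁻ z in cone x, f z ^ q ∂hsMeasure d (d + 1)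

lemma measurable_areaPow {q : ℝ} {f : Euc d × ℝ → ℝ≥0∞} (hf : Measurable f) :
    Measurable (areaPow q f) := by
  have : areaPow q f = fun x => ∫⁻ z, {p : Euc d × (Euc d × ℝ) | p.2 ∈ cone p.1}.indicator
      (fun p => f p.2 ^ q) (x, z) ∂hsMeasure d (d + 1) := by
    funext x
    rw [areaPow, ← lintegral_indicator (measurableSet_cone x)]
    refine lintegral_congr fun z => ?_
    by_cases h : z ∈ cone x
    · rw [indicator_of_mem h, indicator_of_mem (by exact h)]
    · rw [indicator_of_notMem h, indicator_of_notMem (by exact h)]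
  rw [this]
  exact Measurable.lintegral_prod_right
    (((hf.comp measurable_snd).pow_const q).indicator measurableSet_cone_prod)

lemma measurable_ballAvg {h : Euc d → ℝ≥0∞} (hh : Measurable h) :
    Measurable fun z : Euc d × ℝ => ballAvg h z.1 z.2 := by
  have hS : MeasurableSet {p : (Euc d × ℝ) × Euc d | p.2 ∈ Metric.ball p.1.1 p.1.2} :=
    (isOpen_lt (by fun_prop) (by fun_prop) :
      IsOpen {p : (Euc d × ℝ) × Euc d | dist p.2 p.1.1 < p.1.2}).measurableSet
  have h1 : ∀ g : Euc d → ℝ≥0∞, Measurable g → Measurable fun z : Euc d × ℝ =>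
      ∫⁻ y in Metric.ball z.1 z.2, g y := by
    intro g hg
    have : (fun z : Euc d × ℝ => ∫⁻ y in Metric.ball z.1 z.2, g y) = fun z => ∫⁻ y,
        {p : (Euc d × ℝ) × Euc d | p.2 ∈ Metric.ball p.1.1 p.1.2}.indicator
          (fun p => g p.2) (z, y) := by
      funext z
      rw [← lintegral_indicator Metric.isOpen_ball.measurableSet]
      refine lintegral_congr fun y => ?_
      by_cases h : y ∈ Metric.ball z.1 z.2
      · rw [indicator_of_mem h, indicator_of_mem (by exact h)]
      · rw [indicator_of_notMem h, indicator_of_notMem (by exact h)]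
    rw [this]
    exact Measurable.lintegral_prod_right ((hg.comp measurable_snd).indicator hS)
  unfold ballAvg
  refine Measurable.mul (Measurable.inv ?_) (h1 h hh)
  simpa using h1 (fun _ => 1) measurable_const

/-- Integrals of the area function against a weight. -/
lemma lintegral_areaPow_mul {q : ℝ} {f : Euc d × ℝ → ℝ≥0∞} (hf : Measurable f)
    {h : Euc d → ℝ≥0∞} (hh : Measurable h) :
    ∫⁻ x, areaPow q f x * h x =
      unitVol d * ∫⁻ z, f z ^ q * ballAvg h z.1 z.2 ∂hsMeasure d 1 := by
  have hm : Measurable (Function.uncurry fun (x : Euc d) (z : Euc d × ℝ) => f z ^ q * h x) :=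
    ((hf.comp measurable_snd).pow_const q).mul (hh.comp measurable_fst)
  have h1 := lintegral_cone hm
  have h2 : ∀ x, ∫⁻ z in cone x, f z ^ q * h x ∂hsMeasure d (d + 1) = areaPow q f x * h x :=
    fun x => lintegral_mul_const _ (hf.pow_const q)
  have h3 : ∀ z : Euc d × ℝ, ballAvg (fun x => f z ^ q * h x) z.1 z.2 =
      f z ^ q * ballAvg h z.1 z.2 := by
    intro z
    rw [ballAvg, lintegral_const_mul _ hh, ballAvg, mul_left_comm]
  simp_rw [h2, h3] at h1
  exact h1

/-- Jensen's inequality for an integral operator. -/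
lemma rpow_lintegral_mul_le {α : Type*} [MeasurableSpace α] (μ : Measure α) {q : ℝ} (hq : 1 < q)
    {k f : α → ℝ≥0∞} (hk : AEMeasurable k μ) (hf : AEMeasurable f μ) :
    (∫⁻ w, k w * f w ∂μ) ^ q ≤ (∫⁻ w, k w ∂μ) ^ (q - 1) * ∫⁻ w, k w * f w ^ q ∂μ := by
  have hq0 : 0 < q := by linarith
  have hc : q.HolderConjugate q.conjExponent := Real.HolderConjugate.conjExponent hq
  set q' := q.conjExponent
  have hq'0 : 0 < q' := hc.symm.pos
  have h1 := ENNReal.lintegral_mul_le_Lp_mul_Lq μ hc.symm (f := fun w => k w ^ (1 / q'))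
    (g := fun w => k w ^ (1 / q) * f w) (hk.pow_const _) ((hk.pow_const _).mul hf)
  have h2 : ∀ w, ((fun w => k w ^ (1 / q')) * fun w => k w ^ (1 / q) * f w) w = k w * f w := by
    intro w
    simp only [Pi.mul_apply]
    rw [← mul_assoc, ← ENNReal.rpow_add_of_nonneg _ _ (by positivity) (by positivity), one_div,
      one_div, add_comm, hc.inv_add_inv_eq_one, ENNReal.rpow_one]
  have h3 : ∀ w, (k w ^ (1 / q')) ^ q' = k w := by
    intro w
    rw [← ENNReal.rpow_mul, one_div_mul_cancel hq'0.ne', ENNReal.rpow_one]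
  have h4 : ∀ w, (k w ^ (1 / q) * f w) ^ q = k w * f w ^ q := by
    intro w
    rw [ENNReal.mul_rpow_of_nonneg _ _ hq0.le, ← ENNReal.rpow_mul, one_div_mul_cancel hq0.ne',
      ENNReal.rpow_one]
  simp_rw [h2, h3, h4] at h1
  calc (∫⁻ w, k w * f w ∂μ) ^ q
      ≤ ((∫⁻ w, k w ∂μ) ^ (1 / q') * (∫⁻ w, k w * f w ^ q ∂μ) ^ (1 / q)) ^ q := by gcongr
    _ = _ := by
        rw [ENNReal.mul_rpow_of_nonneg _ _ hq0.le, ← ENNReal.rpow_mul, ← ENNReal.rpow_mul,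
          one_div_mul_cancel hq0.ne', ENNReal.rpow_one]
        congr 2
        rw [one_div, inv_mul_eq_div, hc.div_conj_eq_sub_one]

lemma ballAvg_rpow_le {q : ℝ} (hq : 1 < q) {h : Euc d → ℝ≥0∞} (hh : Measurable h) (a : Euc d)
    {r : ℝ} (hr : 0 < r) : ballAvg h a r ^ q ≤ ballAvg (fun x => h x ^ q) a r := by
  have h0 : (volume (Metric.ball a r))⁻¹ ≠ ∞ := ENNReal.inv_ne_top.2 (volume_ball_pos a hr)
  have h1 := rpow_lintegral_mul_le (volume.restrict (Metric.ball a r)) hq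
    (k := fun _ => (volume (Metric.ball a r))⁻¹) (f := h) (by fun_prop) (by fun_prop)
  rw [lintegral_const_mul' _ _ h0, lintegral_const_mul' _ _ h0] at h1
  refine h1.trans (le_of_eq ?_)
  simp only [lintegral_const, Measure.restrict_apply_univ]
  rw [ENNReal.inv_mul_cancel (volume_ball_pos a hr) (volume_ball_ne_top a r), ENNReal.one_rpow,
    one_mul, ballAvg]

/-! ### The Poisson type kernel -/

/-- The Poisson type kernel `r^b / (r + |x|)^{d+b}`. -/
def pois (d : ℕ) (b r : ℝ) (x : Euc d) : ℝ := r ^ b / (r + ‖x‖) ^ ((d : ℝ) + b)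

lemma pois_nonneg {b r : ℝ} (hr : 0 < r) (x : Euc d) : 0 ≤ pois d b r x := by
  unfold pois; positivity

lemma pois_neg (b r : ℝ) (x y : Euc d) : pois d b r (x - y) = pois d b r (y - x) := by
  unfold pois; rw [norm_sub_rev]

lemma measurable_pois (b : ℝ) : Measurable fun p : ℝ × Euc d => pois d b p.1 p.2 := by
  unfold pois
  exact Measurable.div (by fun_prop) (Measurable.pow_const (by fun_prop) _)

/-- The kernel is dominated by a convergent series of normalized indicators of balls. -/
lemma pois_le_tsum {b r : ℝ} (hb : 0 < b) (hr : 0 < r) (x : Euc d) :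
    ENNReal.ofReal (pois d b r x) ≤ ∑' k : ℕ, ENNReal.ofReal (2 ^ ((d : ℝ) + b) * (2 ^ (-b)) ^ k) *
      (ENNReal.ofReal ((2 ^ k * r) ^ d)⁻¹ * (Metric.ball (0 : Euc d) (2 ^ k * r)).indicator 1 x) := by
  have hdb : 0 < (d : ℝ) + b := by positivity
  have hex : ∃ n : ℕ, ‖x‖ < 2 ^ n * r := by
    obtain ⟨n, hn⟩ := pow_unbounded_of_one_lt (‖x‖ / r) (by norm_num : (1 : ℝ) < 2)
    exact ⟨n, by rwa [div_lt_iff₀ hr] at hn⟩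
  classical
  let k := Nat.find hex
  have hk : ‖x‖ < 2 ^ k * r := Nat.find_spec hex
  refine le_trans ?_ (ENNReal.le_tsum k)
  rw [indicator_of_mem (by simpa using hk), Pi.one_apply, mul_one,
    ← ENNReal.ofReal_mul (by positivity)]
  refine ENNReal.ofReal_le_ofReal ?_
  -- the size of the argument is at least half of the radius
  have hlow : 2 ^ k * r / 2 ≤ r + ‖x‖ := by
    rcases Nat.eq_zero_or_pos k with h0 | h0
    · rw [h0]; have := norm_nonneg x; simp; linarith
    · have := Nat.find_min hex (show k - 1 < k by omega)
      have h2 : (2 : ℝ) ^ k = 2 ^ (k - 1) * 2 := by rw [← pow_succ]; congr 1; omega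
      rw [h2]; push Not at this; linarith
  calc pois d b r x ≤ r ^ b / (2 ^ k * r / 2) ^ ((d : ℝ) + b) := by
        unfold pois; gcongr
    _ = 2 ^ ((d : ℝ) + b) * (2 ^ (-b)) ^ k * ((2 ^ k * r) ^ d)⁻¹ := by
        have e1 : (2 ^ k * r / 2) ^ ((d : ℝ) + b) =
            (2 ^ k * r) ^ d * ((2 ^ b) ^ k * r ^ b) / 2 ^ ((d : ℝ) + b) := by
          rw [Real.div_rpow (by positivity) (by norm_num), Real.rpow_add (by positivity),
            Real.rpow_natCast, Real.mul_rpow (by positivity) hr.le, ← Real.rpow_natCast,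
            ← Real.rpow_natCast, ← Real.rpow_natCast, ← Real.rpow_mul (by norm_num),
            ← Real.rpow_mul (by norm_num), mul_comm b]
        rw [e1, Real.rpow_neg (by norm_num), inv_pow]
        have : 0 < r ^ b := by positivity
        field_simp

/-- Averages against the Poisson type kernel are dominated by the maximal function at every point of
the shadow. -/
lemma exists_lintegral_pois_mul_le (d : ℕ) {b : ℝ} (hb : 0 < b) :
    ∃ C : ℝ≥0, 1 ≤ C ∧ ∀ (r : ℝ) (y u : Euc d) (g : Euc d → ℝ≥0∞), 0 < r → Measurable g →
      ‖u - y‖ < r →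
        ∫⁻ v, ENNReal.ofReal (pois d b r (v - y)) * g v ≤ C * maxFun g u := by
  let S : ℝ≥0∞ := ∑' k : ℕ, ENNReal.ofReal (2 ^ ((d : ℝ) + b) * (2 ^ (-b)) ^ k)
  have hS : S ≠ ∞ := by
    have hlt : (2 : ℝ) ^ (-b) < 1 := Real.rpow_lt_one_of_one_lt_of_neg (by norm_num) (by linarith)
    exact ((summable_geometric_of_lt_one (by positivity) hlt).mul_left _).tsum_ofReal_ne_top
  have hfin : S * unitVol d ≠ ∞ := ENNReal.mul_ne_top hS unitVol_ne_top
  refine ⟨max 1 (S * unitVol d).toNNReal, le_max_left _ _, fun r y u g hr hg hu => ?_⟩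
  have hmeas : ∀ k : ℕ, Measurable fun v : Euc d =>
      (Metric.ball (0 : Euc d) (2 ^ k * r)).indicator (1 : Euc d → ℝ≥0∞) (v - y) := fun k =>
    (measurable_one.indicator Metric.isOpen_ball.measurableSet).comp (by fun_prop)
  calc ∫⁻ v, ENNReal.ofReal (pois d b r (v - y)) * g v
      ≤ ∫⁻ v, ∑' k : ℕ, ENNReal.ofReal (2 ^ ((d : ℝ) + b) * (2 ^ (-b)) ^ k) *
          (ENNReal.ofReal ((2 ^ k * r) ^ d)⁻¹ *
            ((Metric.ball (0 : Euc d) (2 ^ k * r)).indicator 1 (v - y) * g v)) := by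
        refine lintegral_mono fun v => ?_
        refine (mul_le_mul_left (pois_le_tsum hb hr (v - y)) (g v)).trans (le_of_eq ?_)
        rw [← ENNReal.tsum_mul_right]
        simp only [mul_assoc]
    _ = ∑' k : ℕ, ENNReal.ofReal (2 ^ ((d : ℝ) + b) * (2 ^ (-b)) ^ k) *
          (unitVol d * ballAvg g y (2 ^ k * r)) := by
        rw [lintegral_tsum]
        swap
        · intro k
          exact ((((hmeas k).mul hg).const_mul _).const_mul _).aemeasurable
        refine tsum_congr fun k => ?_
        have hkr : 0 < 2 ^ k * r := by positivity
        rw [lintegral_const_mul' _ _ ENNReal.ofReal_ne_top,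
          lintegral_const_mul' _ _ ENNReal.ofReal_ne_top]
        congr 1
        have : ∀ v, (Metric.ball (0 : Euc d) (2 ^ k * r)).indicator (1 : Euc d → ℝ≥0∞) (v - y) * g v
            = (Metric.ball y (2 ^ k * r)).indicator g v := by
          intro v
          by_cases h : v ∈ Metric.ball y (2 ^ k * r)
          · rw [indicator_of_mem h, indicator_of_mem]
            · simp
            · simpa [dist_eq_norm] using h
          · rw [indicator_of_notMem h, indicator_of_notMem]
            · simp
            · simpa [dist_eq_norm] using h
        simp_rw [this]
        rw [lintegral_indicator Metric.isOpen_ball.measurableSet, lintegral_ball_eq _ _ hkr,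
          volume_ball_eq _ hkr, ← mul_assoc, ← mul_assoc, ← ENNReal.ofReal_mul (by positivity),
          inv_mul_cancel₀ (by positivity)]
        simp
    _ ≤ ∑' k : ℕ, ENNReal.ofReal (2 ^ ((d : ℝ) + b) * (2 ^ (-b)) ^ k) *
          (unitVol d * maxFun g u) := by
        refine ENNReal.tsum_le_tsum fun k => ?_
        gcongr
        have h1 : r ≤ 2 ^ k * r := le_mul_of_one_le_left hr.le (one_le_pow₀ (by norm_num))
        refine ballAvg_le_maxFun g (by positivity) ?_
        rw [Metric.mem_ball, dist_eq_norm]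
        exact hu.trans_le h1
    _ = S * unitVol d * maxFun g u := by rw [ENNReal.tsum_mul_right, mul_assoc]
    _ ≤ _ := by
        gcongr
        rw [← ENNReal.coe_toNNReal hfin]
        exact_mod_cast le_max_right _ _

lemma lintegral_pois_le {d : ℕ} {b : ℝ} {C : ℝ≥0}
    (hC : ∀ (r : ℝ) (y u : Euc d) (g : Euc d → ℝ≥0∞), 0 < r → Measurable g → ‖u - y‖ < r →
        ∫⁻ v, ENNReal.ofReal (pois d b r (v - y)) * g v ≤ C * maxFun g u) {r : ℝ} (hr : 0 < r)
    (y : Euc d) : ∫⁻ v, ENNReal.ofReal (pois d b r (v - y)) ≤ C := by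
  have h := hC r y y (fun _ => 1) hr measurable_const (by simpa using hr)
  simp only [mul_one] at h
  refine h.trans ?_
  calc (C : ℝ≥0∞) * maxFun (fun _ => 1) y ≤ C * 1 := by gcongr; exact maxFun_const_le _ _
    _ = C := mul_one _

/-- The kernel varies slowly: moving the point by at most `r` costs a constant factor. -/
lemma pois_le_of_norm_sub_lt {b r : ℝ} (hb : 0 < b) (hr : 0 < r) {x v : Euc d}
    (h : ‖x - v‖ ≤ r) : pois d b r x ≤ 2 ^ ((d : ℝ) + b) * pois d b r v := by
  have h1 : r + ‖v‖ ≤ 2 * (r + ‖x‖) := by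
    have := norm_sub_norm_le v x
    rw [norm_sub_rev] at this
    have := norm_nonneg x
    linarith
  unfold pois
  rw [← mul_div_assoc, div_le_div_iff₀ (by positivity) (by positivity)]
  calc r ^ b * (r + ‖v‖) ^ ((d : ℝ) + b) ≤ r ^ b * (2 * (r + ‖x‖)) ^ ((d : ℝ) + b) := by
        gcongr
    _ = _ := by rw [Real.mul_rpow (by norm_num) (by positivity)]; ring

/-- Averaging over balls of radius `t ≤ r` can be transferred to the kernel of scale `r`, since the
kernel varies slowly at that scale. -/
lemma lintegral_pois_mul_ballAvg_le {b r t : ℝ} (hb : 0 < b) (ht : 0 < t) (htr : t ≤ r)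
    (y : Euc d) {g : Euc d → ℝ≥0∞} (hg : Measurable g) :
    ∫⁻ x, ENNReal.ofReal (pois d b r (x - y)) * ballAvg g x t ≤
      ENNReal.ofReal (2 ^ ((d : ℝ) + b)) * ∫⁻ v, ENNReal.ofReal (pois d b r (v - y)) * g v := by
  have hr : 0 < r := ht.trans_le htr
  set V := volume (Metric.ball (0 : Euc d) t) with hV
  have hVx : ∀ x : Euc d, volume (Metric.ball x t) = V := fun x => by
    rw [hV, volume_ball_eq _ ht, volume_ball_eq _ ht]
  have hV0 : V ≠ 0 := volume_ball_pos _ ht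
  have hVt : V ≠ ∞ := volume_ball_ne_top _ _
  have hS : MeasurableSet {p : Euc d × Euc d | dist p.2 p.1 < t} :=
    (isOpen_lt (by fun_prop) (by fun_prop)).measurableSet
  have hp : Measurable fun x : Euc d => ENNReal.ofReal (pois d b r (x - y)) :=
    ((measurable_pois b).comp (by fun_prop : Measurable fun x : Euc d => (r, x - y))).ennreal_ofReal
  have hind : ∀ x v : Euc d, (Metric.ball x t).indicator g v =
      {p : Euc d × Euc d | dist p.2 p.1 < t}.indicator (fun p => g p.2) (x, v) := by
    intro x v; rfl
  calc ∫⁻ x, ENNReal.ofReal (pois d b r (x - y)) * ballAvg g x t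
      = ∫⁻ x, ∫⁻ v, V⁻¹ * (ENNReal.ofReal (pois d b r (x - y)) *
          {p : Euc d × Euc d | dist p.2 p.1 < t}.indicator (fun p => g p.2) (x, v)) := by
        refine lintegral_congr fun x => ?_
        rw [lintegral_const_mul' _ _ (ENNReal.inv_ne_top.2 hV0),
          lintegral_const_mul' _ _ ENNReal.ofReal_ne_top]
        simp_rw [← hind]
        rw [lintegral_indicator Metric.isOpen_ball.measurableSet, ballAvg, hVx, mul_left_comm]
    _ = ∫⁻ v, ∫⁻ x, V⁻¹ * (ENNReal.ofReal (pois d b r (x - y)) *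
          {p : Euc d × Euc d | dist p.2 p.1 < t}.indicator (fun p => g p.2) (x, v)) := by
        refine lintegral_lintegral_swap (Measurable.aemeasurable ?_)
        exact (((hp.comp measurable_fst).mul
          ((hg.comp measurable_snd).indicator hS)).const_mul _)
    _ ≤ ∫⁻ v, ∫⁻ x in Metric.ball v t, V⁻¹ * (ENNReal.ofReal (2 ^ ((d : ℝ) + b)) *
          (ENNReal.ofReal (pois d b r (v - y)) * g v)) := by
        refine lintegral_mono fun v => ?_
        rw [← lintegral_indicator Metric.isOpen_ball.measurableSet]
        refine lintegral_mono fun x => ?_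
        by_cases h : dist v x < t
        · rw [indicator_of_mem (by exact h), indicator_of_mem (by simpa [dist_comm] using h),
            ← mul_assoc (ENNReal.ofReal (2 ^ ((d : ℝ) + b))), ← ENNReal.ofReal_mul (by positivity)]
          gcongr
          refine pois_le_of_norm_sub_lt hb hr ?_
          rw [sub_sub_sub_cancel_right, ← dist_eq_norm, dist_comm]
          exact h.le.trans htr
        · rw [indicator_of_notMem (by exact h)]
          simp
    _ = _ := by
        simp only [lintegral_const, Measure.restrict_apply_univ, hVx]
        rw [← lintegral_const_mul' _ _ ENNReal.ofReal_ne_top]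
        refine lintegral_congr fun v => ?_
        rw [mul_comm, ← mul_assoc, ENNReal.mul_inv_cancel hV0 hVt, one_mul]

end

end TentHardy

namespace TentHardy

noncomputable section

open scoped NNReal

variable {d : ℕ}

/-! ### The positive integral operator on the half-space -/

/-- The positive kernel that dominates the kernel of `Q_t Q_s`: it is the Poisson type kernel at
the scale `t + s`, damped by the factor `t s / (t + s)²`. -/
def nker (b : ℝ) (z w : Euc d × ℝ) : ℝ≥0∞ :=
  ENNReal.ofReal (z.2 * w.2 / (z.2 + w.2) ^ 2 * pois d b (z.2 + w.2) (z.1 - w.1))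

/-- The positive integral operator with kernel `nker`. -/
def tentOp (b : ℝ) (f : Euc d × ℝ → ℝ≥0∞) (z : Euc d × ℝ) : ℝ≥0∞ :=
  ∫⁻ w, nker b z w * f w ∂hsMeasure d 1

lemma nker_comm (b : ℝ) (z w : Euc d × ℝ) : nker b z w = nker b w z := by
  unfold nker
  rw [mul_comm z.2, add_comm z.2, pois_neg]

lemma measurable_nker (b : ℝ) :
    Measurable fun p : (Euc d × ℝ) × (Euc d × ℝ) => nker b p.1 p.2 := by
  unfold nker
  refine Measurable.ennreal_ofReal (Measurable.mul (by fun_prop) ?_)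
  exact (measurable_pois b).comp (by fun_prop :
    Measurable fun p : (Euc d × ℝ) × (Euc d × ℝ) => (p.1.2 + p.2.2, p.1.1 - p.2.1))

lemma measurable_nker_left (b : ℝ) (w : Euc d × ℝ) : Measurable fun z => nker b z w :=
  (measurable_nker b).comp (by fun_prop : Measurable fun z => (z, w))

lemma measurable_nker_right (b : ℝ) (z : Euc d × ℝ) : Measurable fun w => nker b z w :=
  (measurable_nker b).comp (by fun_prop : Measurable fun w => (z, w))

lemma measurable_tentOp (b : ℝ) {f : Euc d × ℝ → ℝ≥0∞} (hf : Measurable f) :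
    Measurable (tentOp b f) :=
  Measurable.lintegral_prod_right ((measurable_nker b).mul (hf.comp measurable_snd))

lemma lintegral_tentOp_mul (b : ℝ) {f g : Euc d × ℝ → ℝ≥0∞} (hf : Measurable f)
    (hg : Measurable g) :
    ∫⁻ z, tentOp b f z * g z ∂hsMeasure d 1 = ∫⁻ w, f w * tentOp b g w ∂hsMeasure d 1 := by
  have hm : Measurable fun p : (Euc d × ℝ) × (Euc d × ℝ) => nker b p.1 p.2 * f p.2 * g p.1 :=
    ((measurable_nker b).mul (hf.comp measurable_snd)).mul (hg.comp measurable_fst)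
  calc ∫⁻ z, tentOp b f z * g z ∂hsMeasure d 1
      = ∫⁻ z, ∫⁻ w, nker b z w * f w * g z ∂hsMeasure d 1 ∂hsMeasure d 1 := by
        refine lintegral_congr fun z => ?_
        rw [lintegral_mul_const _ ((measurable_nker_right b z).fun_mul hf), tentOp]
    _ = ∫⁻ w, ∫⁻ z, nker b z w * f w * g z ∂hsMeasure d 1 ∂hsMeasure d 1 :=
        lintegral_lintegral_swap hm.aemeasurable
    _ = _ := by
        refine lintegral_congr fun w => ?_
        rw [tentOp, ← lintegral_const_mul _ ((measurable_nker_right b w).fun_mul hg)]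
        refine lintegral_congr fun z => ?_
        rw [nker_comm b w z]; ring

lemma lintegral_ratio_le {a t : ℝ} (ha : 0 < a) (ht : 0 < t) :
    ∫⁻ s in Ioi (0 : ℝ), ENNReal.ofReal (t ^ a / (t + s) ^ (1 + a)) ≤ ENNReal.ofReal (1 / a) := by
  let g : ℝ → ℝ := fun s => -(t ^ a / a * (t + s) ^ (-a))
  have hderiv : ∀ s ∈ Ici (0 : ℝ), HasDerivAt g (t ^ a / (t + s) ^ (1 + a)) s := by
    intro s hs
    have hs : 0 ≤ s := hs
    have h1 : HasDerivAt (fun s => (t + s) ^ (-a)) (1 * (-a) * (t + s) ^ (-a - 1)) s :=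
      ((hasDerivAt_id s).const_add t).rpow_const (Or.inl (by simp; linarith))
    refine (h1.const_mul (t ^ a / a)).neg.congr_deriv ?_
    rw [show -a - 1 = -(1 + a) by ring, Real.rpow_neg (by linarith)]
    field_simp
  have hpos : ∀ s ∈ Ioi (0 : ℝ), 0 ≤ t ^ a / (t + s) ^ (1 + a) := by
    intro s hs
    have hs : 0 < s := hs
    positivity
  have hlim : Tendsto g atTop (𝓝 0) := by
    have h1 : Tendsto (fun s : ℝ => (t + s) ^ (-a)) atTop (𝓝 0) :=
      (tendsto_rpow_neg_atTop ha).comp (tendsto_atTop_add_const_left _ _ tendsto_id)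
    simpa using (h1.const_mul (t ^ a / a)).neg
  rw [← ofReal_integral_eq_lintegral_ofReal (integrableOn_Ioi_deriv_of_nonneg' hderiv hpos hlim)
    ((ae_restrict_iff' measurableSet_Ioi).2 (Eventually.of_forall hpos)),
    integral_Ioi_of_hasDerivAt_of_nonneg' hderiv hpos hlim]
  refine ENNReal.ofReal_le_ofReal (le_of_eq ?_)
  simp only [g, add_zero]
  rw [Real.rpow_neg ht.le]
  field_simp
  ring

/-- `C` is a constant for the maximal estimate of the kernel. Its use with `g = 1` says that
the integrals of the kernel in either variable are bounded by `C`. -/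
def TentConst (d : ℕ) (b : ℝ) (C : ℝ≥0) : Prop :=
  1 ≤ C ∧ ∀ w : Euc d × ℝ, 0 < w.2 → ∀ (g : Euc d → ℝ≥0∞) (u : Euc d), Measurable g →
    ‖u - w.1‖ < w.2 →
      ∫⁻ z, nker b z w * ballAvg g z.1 z.2 ∂hsMeasure d 1 ≤ C * maxFun g u

/-- The kernel `nker` integrates in the height against the factor `t s / (t + s)²`, and in space by
the maximal estimate of the Poisson type kernel. -/
lemma exists_tentConst (d : ℕ) {b : ℝ} (hb : 0 < b) : ∃ C, TentConst d b C := by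
  obtain ⟨C, hC1, hC⟩ := exists_lintegral_pois_mul_le d hb
  have h2 : (1 : ℝ) ≤ 2 ^ ((d : ℝ) + b) := Real.one_le_rpow (by norm_num) (by positivity)
  refine ⟨(2 ^ ((d : ℝ) + b) : ℝ).toNNReal * C, ?_, fun w hw g u hg hu => ?_⟩
  · exact one_le_mul_of_one_le_of_one_le (by simpa using h2) hC1
  obtain ⟨y, s⟩ := w
  simp only at hw hu
  rw [lintegral_hsMeasure 1 ((measurable_nker_left b (y, s)).fun_mul (measurable_ballAvg hg))]
  set D : ℝ≥0∞ := ENNReal.ofReal (2 ^ ((d : ℝ) + b)) * (C * maxFun g u) with hD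
  calc ∫⁻ t in Ioi (0 : ℝ), ENNReal.ofReal ((t ^ 1)⁻¹) *
        ∫⁻ x, nker b (x, t) (y, s) * ballAvg g x t
      ≤ ∫⁻ t in Ioi (0 : ℝ), ENNReal.ofReal (s ^ (1 : ℝ) / (s + t) ^ (1 + (1 : ℝ))) * D := by
        refine setLIntegral_mono' measurableSet_Ioi fun t ht => ?_
        have ht : 0 < t := ht
        have h1 : ∀ x, nker b (x, t) (y, s) * ballAvg g x t =
            ENNReal.ofReal (t * s / (t + s) ^ 2) *
              (ENNReal.ofReal (pois d b (t + s) (x - y)) * ballAvg g x t) := by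
          intro x
          rw [nker, ENNReal.ofReal_mul (by positivity), mul_assoc]
        simp_rw [h1]
        rw [lintegral_const_mul' _ _ ENNReal.ofReal_ne_top, ← mul_assoc,
          ← ENNReal.ofReal_mul (by positivity)]
        gcongr ENNReal.ofReal ?_ * ?_
        · rw [Real.rpow_one, show (1 : ℝ) + 1 = ((2 : ℕ) : ℝ) by norm_num, Real.rpow_natCast,
            add_comm s t]
          refine le_of_eq ?_
          field_simp
        · refine (lintegral_pois_mul_ballAvg_le hb ht (by linarith) y hg).trans ?_
          rw [hD]
          gcongr
          exact hC _ _ _ _ (by linarith) hg (by linarith)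
    _ ≤ ENNReal.ofReal (1 / 1) * D := by
        have hm : Measurable fun t : ℝ =>
            ENNReal.ofReal (s ^ (1 : ℝ) / (s + t) ^ (1 + (1 : ℝ))) :=
          Measurable.ennreal_ofReal (Measurable.div (by fun_prop)
            (Measurable.pow_const (by fun_prop) _))
        rw [lintegral_mul_const _ hm]
        gcongr
        exact lintegral_ratio_le one_pos hw
    _ = _ := by
        rw [hD, ENNReal.coe_mul]
        simp [ENNReal.ofReal, mul_assoc]

lemma TentConst.ballAvg_le {b : ℝ} {C : ℝ≥0} (hC : TentConst d b C) {w : Euc d × ℝ}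
    (hw : 0 < w.2) {g : Euc d → ℝ≥0∞} (hg : Measurable g) :
    ∫⁻ z, nker b z w * ballAvg g z.1 z.2 ∂hsMeasure d 1 ≤ C * ballAvg (maxFun g) w.1 w.2 := by
  calc ∫⁻ z, nker b z w * ballAvg g z.1 z.2 ∂hsMeasure d 1
      = ballAvg (fun _ => ∫⁻ z, nker b z w * ballAvg g z.1 z.2 ∂hsMeasure d 1) w.1 w.2 :=
        (ballAvg_const _ w.1 hw).symm
    _ ≤ C * ballAvg (maxFun g) w.1 w.2 := by
        unfold ballAvg
        rw [mul_left_comm, ← lintegral_const_mul' _ _ ENNReal.coe_ne_top]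
        refine mul_le_mul_right (setLIntegral_mono' measurableSet_ball fun u hu => ?_) _
        exact hC.2 w hw g u hg (by rwa [← dist_eq_norm])

lemma TentConst.mass_le {b : ℝ} {C : ℝ≥0} (hC : TentConst d b C) {w : Euc d × ℝ}
    (hw : 0 < w.2) : ∫⁻ z, nker b z w ∂hsMeasure d 1 ≤ C := by
  have h := hC.2 w hw (fun _ => 1) w.1 measurable_const (by simpa using hw)
  calc ∫⁻ z, nker b z w ∂hsMeasure d 1
      = ∫⁻ z, nker b z w * ballAvg (fun _ => 1) z.1 z.2 ∂hsMeasure d 1 := by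
        refine lintegral_congr_ae ?_
        filter_upwards [ae_hsMeasure_pos 1] with z hz
        rw [ballAvg_const _ _ hz, mul_one]
    _ ≤ C * maxFun (fun _ => 1) w.1 := h
    _ ≤ C * 1 := by gcongr; exact maxFun_const_le _ _
    _ = C := mul_one _

lemma TentConst.tentOp_rpow_le {b : ℝ} {C : ℝ≥0} (hC : TentConst d b C) {q : ℝ} (hq : 1 < q)
    {f : Euc d × ℝ → ℝ≥0∞} (hf : Measurable f) {z : Euc d × ℝ} (hz : 0 < z.2) :
    tentOp b f z ^ q ≤ (C : ℝ≥0∞) ^ (q - 1) * tentOp b (fun w => f w ^ q) z := by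
  refine (rpow_lintegral_mul_le _ hq (measurable_nker_right b z).aemeasurable
    hf.aemeasurable).trans ?_
  have : ∫⁻ w, nker b z w ∂hsMeasure d 1 ≤ C := by
    simp_rw [nker_comm b z]; exact hC.mass_le hz
  gcongr ?_ * ?_
  · exact ENNReal.rpow_le_rpow this (by linarith)
  · exact le_rfl

lemma coe_rpow_sub_one_mul (C : ℝ≥0) (hC : 1 ≤ C) (q : ℝ) :
    (C : ℝ≥0∞) ^ (q - 1) * C = (C : ℝ≥0∞) ^ q := by
  have h0 : (C : ℝ≥0∞) ≠ 0 := by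
    have := zero_lt_one.trans_le hC
    exact_mod_cast this.ne'
  nth_rewrite 2 [← ENNReal.rpow_one (C : ℝ≥0∞)]
  rw [← ENNReal.rpow_add _ _ h0 ENNReal.coe_ne_top, sub_add_cancel]

/-- Schur's test. -/
lemma TentConst.lintegral_tentOp_rpow_le {b : ℝ} {C : ℝ≥0} (hC : TentConst d b C) {q : ℝ}
    (hq : 1 < q) {f : Euc d × ℝ → ℝ≥0∞} (hf : Measurable f) :
    ∫⁻ z, tentOp b f z ^ q ∂hsMeasure d 1 ≤ (C : ℝ≥0∞) ^ q * ∫⁻ z, f z ^ q ∂hsMeasure d 1 := by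
  have hfq : Measurable fun w => f w ^ q := hf.pow_const q
  calc ∫⁻ z, tentOp b f z ^ q ∂hsMeasure d 1
      ≤ ∫⁻ z, (C : ℝ≥0∞) ^ (q - 1) * (tentOp b (fun w => f w ^ q) z * 1) ∂hsMeasure d 1 := by
        refine lintegral_mono_ae ?_
        filter_upwards [ae_hsMeasure_pos 1] with z hz
        rw [mul_one]
        exact hC.tentOp_rpow_le hq hf hz
    _ = (C : ℝ≥0∞) ^ (q - 1) * ∫⁻ w, f w ^ q * tentOp b (fun _ => 1) w ∂hsMeasure d 1 := by
        rw [lintegral_const_mul _ ((measurable_tentOp b hfq).mul_const 1),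
          lintegral_tentOp_mul b hfq measurable_const]
    _ ≤ (C : ℝ≥0∞) ^ (q - 1) * ∫⁻ w, f w ^ q * C ∂hsMeasure d 1 := by
        refine mul_le_mul_right ?_ _
        refine lintegral_mono_ae ?_
        filter_upwards [ae_hsMeasure_pos 1] with w hw
        gcongr
        simp only [tentOp, mul_one]
        simp_rw [nker_comm b w]
        exact hC.mass_le hw
    _ = _ := by
        rw [lintegral_mul_const _ hfq, mul_comm (∫⁻ w, f w ^ q ∂hsMeasure d 1), ← mul_assoc,
          coe_rpow_sub_one_mul C hC.1]

/-- The weighted estimate for the area function, with a maximal function on the weight. -/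
lemma TentConst.lintegral_areaPow_tentOp_le {b : ℝ} {C : ℝ≥0} (hC : TentConst d b C) {q : ℝ}
    (hq : 1 < q) {f : Euc d × ℝ → ℝ≥0∞} (hf : Measurable f) {h : Euc d → ℝ≥0∞}
    (hh : Measurable h) :
    ∫⁻ x, areaPow q (tentOp b f) x * h x ≤
      (C : ℝ≥0∞) ^ q * ∫⁻ x, areaPow q f x * maxFun h x := by
  have hfq : Measurable fun w => f w ^ q := hf.pow_const q
  rw [lintegral_areaPow_mul (measurable_tentOp b hf) hh,
    lintegral_areaPow_mul hf (measurable_maxFun h), mul_left_comm]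
  gcongr
  calc ∫⁻ z, tentOp b f z ^ q * ballAvg h z.1 z.2 ∂hsMeasure d 1
      ≤ ∫⁻ z, (C : ℝ≥0∞) ^ (q - 1) * (tentOp b (fun w => f w ^ q) z * ballAvg h z.1 z.2)
          ∂hsMeasure d 1 := by
        refine lintegral_mono_ae ?_
        filter_upwards [ae_hsMeasure_pos 1] with z hz
        rw [← mul_assoc]
        gcongr
        exact hC.tentOp_rpow_le hq hf hz
    _ = (C : ℝ≥0∞) ^ (q - 1) *
          ∫⁻ w, f w ^ q * tentOp b (fun z => ballAvg h z.1 z.2) w ∂hsMeasure d 1 := by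
        rw [lintegral_const_mul _ ((measurable_tentOp b hfq).fun_mul (measurable_ballAvg hh)),
          lintegral_tentOp_mul b hfq (measurable_ballAvg hh)]
    _ ≤ (C : ℝ≥0∞) ^ (q - 1) *
          ∫⁻ w, C * (f w ^ q * ballAvg (maxFun h) w.1 w.2) ∂hsMeasure d 1 := by
        refine mul_le_mul_right ?_ _
        refine lintegral_mono_ae ?_
        filter_upwards [ae_hsMeasure_pos 1] with w hw
        rw [mul_left_comm]
        gcongr
        simp only [tentOp]
        simp_rw [nker_comm b w]
        exact hC.ballAvg_le hw hh
    _ = _ := by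
        rw [lintegral_const_mul' _ _ ENNReal.coe_ne_top, ← mul_assoc, coe_rpow_sub_one_mul C hC.1]

/-! ### Tents and the Carleson functional -/

lemma measurableSet_tent (O : Set (Euc d)) : MeasurableSet (tent O) := by
  have : tent O = halfSpace d ∩ (⋃ x ∈ Oᶜ, cone x)ᶜ := by
    ext z; simp [tent, halfSpace]
  rw [this]
  refine measurableSet_halfSpace.inter (IsOpen.measurableSet ?_).compl
  exact isOpen_biUnion fun x _ => isOpen_lt (by fun_prop) (by fun_prop)

lemma tent_mono {O O' : Set (Euc d)} (h : O ⊆ O') : tent O ⊆ tent O' :=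
  fun _ hz => ⟨hz.1, fun x hx => hz.2 x fun hO => hx (h hO)⟩

lemma mem_tent_iff {O : Set (Euc d)} {z : Euc d × ℝ} :
    z ∈ tent O ↔ 0 < z.2 ∧ Metric.ball z.1 z.2 ⊆ O := by
  refine and_congr_right fun _ => ⟨fun h x hx => ?_, fun h x hx hz => hx (h (mem_cone_iff.1 hz))⟩
  by_contra hO
  exact h x hO (mem_cone_iff.2 hx)

lemma fst_mem_of_mem_tent {O : Set (Euc d)} {z : Euc d × ℝ} (hz : z ∈ tent O) : z.1 ∈ O :=
  (mem_tent_iff.1 hz).2 (Metric.mem_ball_self hz.1)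

lemma snd_le_of_mem_tent (hd : 0 < d) {a : Euc d} {r : ℝ} (hr : 0 < r) {z : Euc d × ℝ}
    (hz : z ∈ tent (Metric.ball a r)) : z.2 ≤ r := by
  have h := measure_mono (μ := volume) (mem_tent_iff.1 hz).2
  rw [volume_ball_eq _ hz.1, volume_ball_eq _ hr,
    ENNReal.mul_le_mul_iff_left unitVol_ne_zero unitVol_ne_top,
    ENNReal.ofReal_le_ofReal_iff (by positivity)] at h
  exact (pow_le_pow_iff_left₀ hz.1.le hr.le hd.ne').1 h

/-- The Carleson functional of a nonnegative function. -/
def carlFun (q : ℝ) (f : Euc d × ℝ → ℝ≥0∞) : Euc d → ℝ≥0∞ :=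
  ballSup fun a r => ((volume (Metric.ball a r))⁻¹ *
    ∫⁻ z in tent (Metric.ball a r), f z ^ q ∂hsMeasure d 1) ^ (1 / q)

lemma measurable_carlFun (q : ℝ) (f : Euc d × ℝ → ℝ≥0∞) : Measurable (carlFun q f) :=
  measurable_ballSup _

lemma lintegral_tent_le {q : ℝ} (hq : 0 < q) (f : Euc d × ℝ → ℝ≥0∞) {x a : Euc d} {r : ℝ}
    (hr : 0 < r) (hx : x ∈ Metric.ball a r) :
    ∫⁻ z in tent (Metric.ball a r), f z ^ q ∂hsMeasure d 1 ≤
      volume (Metric.ball a r) * carlFun q f x ^ q := by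
  have h : _ ≤ carlFun q f x := le_ballSup _ hr hx
  have h2 := ENNReal.rpow_le_rpow h hq.le
  rw [← ENNReal.rpow_mul, one_div_mul_cancel hq.ne', ENNReal.rpow_one] at h2
  calc ∫⁻ z in tent (Metric.ball a r), f z ^ q ∂hsMeasure d 1
      = volume (Metric.ball a r) * ((volume (Metric.ball a r))⁻¹ *
          ∫⁻ z in tent (Metric.ball a r), f z ^ q ∂hsMeasure d 1) := by
        rw [← mul_assoc, ENNReal.mul_inv_cancel (volume_ball_pos a hr) (volume_ball_ne_top a r),
          one_mul]
    _ ≤ _ := by gcongr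

lemma carlFun_le {q : ℝ} (hq : 0 < q) (f : Euc d × ℝ → ℝ≥0∞) {x : Euc d} {c : ℝ≥0∞}
    (h : ∀ a r, 0 < r → x ∈ Metric.ball a r →
      ∫⁻ z in tent (Metric.ball a r), f z ^ q ∂hsMeasure d 1 ≤
        volume (Metric.ball a r) * c ^ q) : carlFun q f x ≤ c := by
  refine ballSup_le fun a r hr hx => ?_
  calc ((volume (Metric.ball a r))⁻¹ *
        ∫⁻ z in tent (Metric.ball a r), f z ^ q ∂hsMeasure d 1) ^ (1 / q)
      ≤ ((volume (Metric.ball a r))⁻¹ * (volume (Metric.ball a r) * c ^ q)) ^ (1 / q) := by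
        gcongr; exact h a r hr hx
    _ = c := by
        rw [← mul_assoc, ENNReal.inv_mul_cancel (volume_ball_pos a hr) (volume_ball_ne_top a r),
          one_mul, ← ENNReal.rpow_mul, mul_one_div_cancel hq.ne', ENNReal.rpow_one]

/-- The contribution of a distant annular tent decays geometrically. -/
lemma lintegral_nker_annulus_le {b : ℝ} (hb : 0 < b) (hb1 : b ≤ 1 / 2) {q : ℝ} (hq : 1 < q)
    {f : Euc d × ℝ → ℝ≥0∞} (hf : Measurable f) {x₀ a : Euc d} {r : ℝ} (hr : 0 < r)
    (hx₀ : x₀ ∈ Metric.ball a r) {z : Euc d × ℝ} (hz : z ∈ tent (Metric.ball a r)) (k : ℕ) :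
    ∫⁻ w in tent (Metric.ball a (2 ^ (k + 3) * r)) \ tent (Metric.ball a (2 ^ (k + 2) * r)),
      nker b z w * f w ∂hsMeasure d 1 ≤
    ENNReal.ofReal ((z.2 / r) ^ b) * (ENNReal.ofReal ((2 ^ (-b)) ^ k) *
      (2 * 4 ^ d * unitVol d * carlFun q f x₀)) := by
  obtain ⟨x, t⟩ := z
  have ht : 0 < t := hz.1
  have hxa : ‖x - a‖ < r := by
    have := fst_mem_of_mem_tent hz
    rwa [Metric.mem_ball, dist_eq_norm] at this
  have hq0 : 0 < q := by linarith
  set S := tent (Metric.ball a (2 ^ (k + 3) * r)) with hS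
  have hSm : MeasurableSet S := measurableSet_tent _
  have hR : 0 < 2 ^ (k + 3) * r := by positivity
  set V := volume (Metric.ball a (2 ^ (k + 3) * r)) with hV
  let k₀ : Euc d × ℝ → ℝ≥0∞ := fun w =>
    ENNReal.ofReal (w.2 * (t ^ (1 - b) / (t + w.2) ^ (1 + (1 - b))))
  have hk₀ : Measurable k₀ := by
    refine Measurable.ennreal_ofReal (Measurable.mul (by fun_prop) (Measurable.div (by fun_prop)
      (Measurable.pow_const (by fun_prop) _)))
  have hpt : ∀ w ∈ S \ tent (Metric.ball a (2 ^ (k + 2) * r)), nker b (x, t) w * f w ≤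
      ENNReal.ofReal (t ^ b / (2 ^ (k + 1) * r) ^ ((d : ℝ) + b)) * (k₀ w * f w) := by
    rintro ⟨y, s⟩ ⟨hw1, hw2⟩
    have hs : 0 < s := hw1.1
    -- the shadow of the point leaves the ball `B(a, 2 ^ (k + 2) r)`
    have hfar : 2 ^ (k + 2) * r ≤ s + ‖y - a‖ := by
      by_contra hlt
      push Not at hlt
      refine hw2 (mem_tent_iff.2 ⟨hs, fun u hu => ?_⟩)
      rw [Metric.mem_ball] at hu ⊢
      have := dist_triangle u y a
      rw [dist_eq_norm y a] at this
      have hu : dist u y < s := hu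
      linarith
    have hlow : 2 ^ (k + 1) * r ≤ (t + s) + ‖x - y‖ := by
      have h1 : ‖y - a‖ ≤ ‖x - y‖ + ‖x - a‖ := by
        have := norm_sub_le_norm_sub_add_norm_sub y x a
        rwa [norm_sub_rev y x] at this
      have h2 : (1 : ℝ) ≤ 2 ^ k := one_le_pow₀ (by norm_num)
      have h3 : (2 : ℝ) ^ (k + 2) = 4 * 2 ^ k := by ring
      have h4 : (2 : ℝ) ^ (k + 1) = 2 * 2 ^ k := by ring
      rw [h3] at hfar
      rw [h4]
      nlinarith
    rw [← mul_assoc, ← ENNReal.ofReal_mul (by positivity), nker]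
    refine mul_le_mul_left (ENNReal.ofReal_le_ofReal ?_) _
    simp only [pois]
    calc t * s / (t + s) ^ 2 * ((t + s) ^ b / (t + s + ‖x - y‖) ^ ((d : ℝ) + b))
        ≤ t * s / (t + s) ^ 2 * ((t + s) ^ b / (2 ^ (k + 1) * r) ^ ((d : ℝ) + b)) := by
          gcongr
      _ = _ := by
          have e1 : (t + s) ^ (1 + (1 - b)) = (t + s) ^ 2 / (t + s) ^ b := by
            rw [← Real.rpow_natCast (t + s) 2, ← Real.rpow_sub (by positivity)]
            congr 1; push_cast; ring
          have e2 : t ^ (1 - b) = t / t ^ b := by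
            rw [Real.rpow_sub ht, Real.rpow_one]
          rw [e1, e2]
          have : 0 < t ^ b := by positivity
          have : 0 < (t + s) ^ b := by positivity
          field_simp
  have hk1 : ∀ w ∈ S, k₀ w ≤ 1 := by
    rintro ⟨y, s⟩ hw
    have hs : 0 < s := hw.1
    rw [ENNReal.ofReal_le_one, ← mul_div_assoc, div_le_one (by positivity),
      Real.rpow_add (by positivity), Real.rpow_one]
    have : t ^ (1 - b) ≤ (t + s) ^ (1 - b) :=
      Real.rpow_le_rpow ht.le (by linarith) (by linarith)
    have h0 : 0 < t ^ (1 - b) := by positivity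
    nlinarith
  have hmass : ∫⁻ w in S, k₀ w ∂hsMeasure d 1 ≤ 2 * V := by
    calc ∫⁻ w in S, k₀ w ∂hsMeasure d 1
        ≤ ∫⁻ w, (Metric.ball a (2 ^ (k + 3) * r)).indicator 1 w.1 * k₀ w ∂hsMeasure d 1 := by
          rw [← lintegral_indicator hSm]
          refine lintegral_mono fun w => ?_
          by_cases h : w ∈ S
          · simp only [h, indicator_of_mem, indicator_of_mem (fst_mem_of_mem_tent h)]
            simp
          · simp [h]
      _ = ∫⁻ s in Ioi (0 : ℝ), ENNReal.ofReal (t ^ (1 - b) / (t + s) ^ (1 + (1 - b))) * V := by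
          rw [lintegral_hsMeasure]
          · refine setLIntegral_congr_fun measurableSet_Ioi fun s hs => ?_
            have hs : 0 < s := hs
            simp only [k₀]
            rw [lintegral_mul_const' _ _ ENNReal.ofReal_ne_top,
              lintegral_indicator_one Metric.isOpen_ball.measurableSet, mul_comm V, ← mul_assoc,
              ← ENNReal.ofReal_mul (by positivity), ← mul_assoc, pow_one, inv_mul_cancel₀ hs.ne',
              one_mul]
          · exact ((measurable_one.indicator Metric.isOpen_ball.measurableSet).comp
              measurable_fst).mul hk₀
      _ ≤ ENNReal.ofReal (1 / (1 - b)) * V := by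
          rw [lintegral_mul_const' _ _ (volume_ball_ne_top _ _)]
          gcongr
          exact lintegral_ratio_le (by linarith) ht
      _ ≤ 2 * V := by
          gcongr
          rw [← ENNReal.ofReal_ofNat]
          refine ENNReal.ofReal_le_ofReal ?_
          rw [div_le_iff₀ (by linarith)]
          linarith
  have hx₀' : x₀ ∈ Metric.ball a (2 ^ (k + 3) * r) :=
    Metric.ball_subset_ball (le_mul_of_one_le_left hr.le (one_le_pow₀ (by norm_num))) hx₀
  have hint : ∫⁻ w in S, k₀ w * f w ∂hsMeasure d 1 ≤ 2 * V * carlFun q f x₀ := by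
    have h1 : (∫⁻ w in S, k₀ w * f w ∂hsMeasure d 1) ^ q ≤ (2 * V * carlFun q f x₀) ^ q := by
      calc (∫⁻ w in S, k₀ w * f w ∂hsMeasure d 1) ^ q
          ≤ (∫⁻ w in S, k₀ w ∂hsMeasure d 1) ^ (q - 1) *
              ∫⁻ w in S, k₀ w * f w ^ q ∂hsMeasure d 1 :=
            rpow_lintegral_mul_le _ hq hk₀.aemeasurable hf.aemeasurable
        _ ≤ (2 * V) ^ (q - 1) * (2 * V * carlFun q f x₀ ^ q) := by
            gcongr ?_ * ?_
            · exact ENNReal.rpow_le_rpow hmass (by linarith)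
            · calc ∫⁻ w in S, k₀ w * f w ^ q ∂hsMeasure d 1
                  ≤ ∫⁻ w in S, f w ^ q ∂hsMeasure d 1 :=
                    setLIntegral_mono' hSm fun w hw => mul_le_of_le_one_left' (hk1 w hw)
                _ ≤ V * carlFun q f x₀ ^ q := lintegral_tent_le hq0 f hR hx₀'
                _ ≤ 2 * V * carlFun q f x₀ ^ q := by
                    rw [mul_assoc]
                    exact le_mul_of_one_le_left' (by norm_num)
        _ = _ := by
            have hV0 : 2 * V ≠ 0 := mul_ne_zero (by norm_num) (volume_ball_pos a hR)
            have hVt : 2 * V ≠ ∞ := ENNReal.mul_ne_top (by norm_num) (volume_ball_ne_top _ _)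
            rw [ENNReal.mul_rpow_of_nonneg _ _ hq0.le, ← mul_assoc]
            congr 1
            nth_rewrite 2 [← ENNReal.rpow_one (2 * V)]
            rw [← ENNReal.rpow_add _ _ hV0 hVt, sub_add_cancel]
    exact (ENNReal.rpow_le_rpow_iff hq0).1 h1
  calc ∫⁻ w in S \ tent (Metric.ball a (2 ^ (k + 2) * r)), nker b (x, t) w * f w ∂hsMeasure d 1
      ≤ ∫⁻ w in S \ tent (Metric.ball a (2 ^ (k + 2) * r)),
          ENNReal.ofReal (t ^ b / (2 ^ (k + 1) * r) ^ ((d : ℝ) + b)) * (k₀ w * f w)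
            ∂hsMeasure d 1 :=
        setLIntegral_mono' (hSm.diff (measurableSet_tent _)) hpt
    _ ≤ ∫⁻ w in S, ENNReal.ofReal (t ^ b / (2 ^ (k + 1) * r) ^ ((d : ℝ) + b)) * (k₀ w * f w)
            ∂hsMeasure d 1 := lintegral_mono_set sdiff_subset
    _ ≤ ENNReal.ofReal (t ^ b / (2 ^ (k + 1) * r) ^ ((d : ℝ) + b)) *
          (2 * V * carlFun q f x₀) := by
        rw [lintegral_const_mul' _ _ ENNReal.ofReal_ne_top]
        gcongr
    _ ≤ ENNReal.ofReal ((t / r) ^ b) * (ENNReal.ofReal ((2 ^ (-b)) ^ k) *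
          (2 * 4 ^ d * unitVol d * carlFun q f x₀)) := by
        have e4 : (4 : ℝ≥0∞) ^ d = ENNReal.ofReal (4 ^ d) := by
          rw [ENNReal.ofReal_pow (by norm_num)]; norm_num
        have e : ENNReal.ofReal (t ^ b / (2 ^ (k + 1) * r) ^ ((d : ℝ) + b)) *
            ENNReal.ofReal ((2 ^ (k + 3) * r) ^ d) ≤
            ENNReal.ofReal ((t / r) ^ b) * ENNReal.ofReal ((2 ^ (-b)) ^ k) *
              ENNReal.ofReal (4 ^ d) := by
          rw [← ENNReal.ofReal_mul (by positivity), ← ENNReal.ofReal_mul (by positivity),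
            ← ENNReal.ofReal_mul (by positivity)]
          refine ENNReal.ofReal_le_ofReal ?_
          have e1 : (2 ^ (k + 3) * r) ^ d = 4 ^ d * (2 ^ (k + 1) * r) ^ d := by
            rw [← mul_pow]; congr 1; ring
          have e2 : (2 ^ (k + 1) * r) ^ ((d : ℝ) + b) =
              (2 ^ (k + 1) * r) ^ d * ((2 ^ b) ^ (k + 1) * r ^ b) := by
            rw [Real.rpow_add (by positivity), Real.rpow_natCast,
              Real.mul_rpow (by positivity) hr.le]
            congr 2
            rw [← Real.rpow_natCast, ← Real.rpow_natCast, ← Real.rpow_mul (by norm_num),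
              ← Real.rpow_mul (by norm_num), mul_comm b]
          rw [e1, e2, Real.div_rpow ht.le hr.le, Real.rpow_neg (by norm_num), inv_pow]
          have h1 : (1 : ℝ) ≤ 2 ^ b := Real.one_le_rpow (by norm_num) hb.le
          have h2 : ((2 : ℝ) ^ b) ^ k ≤ (2 ^ b) ^ (k + 1) := pow_le_pow_right₀ h1 (by omega)
          calc t ^ b / ((2 ^ (k + 1) * r) ^ d * ((2 ^ b) ^ (k + 1) * r ^ b)) *
                (4 ^ d * (2 ^ (k + 1) * r) ^ d)
              = t ^ b / r ^ b * ((2 ^ b) ^ (k + 1))⁻¹ * 4 ^ d := by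
                have : 0 < r ^ b := by positivity
                field_simp
            _ ≤ _ := by gcongr
        rw [hV, volume_ball_eq a hR, e4]
        calc _ = (ENNReal.ofReal (t ^ b / (2 ^ (k + 1) * r) ^ ((d : ℝ) + b)) *
            ENNReal.ofReal ((2 ^ (k + 3) * r) ^ d)) * (2 * unitVol d * carlFun q f x₀) := by ring
          _ ≤ _ := mul_le_mul_left e _
          _ = _ := by ring

/-- The gain `(t / r)^b` in the estimate of the distant annular tents makes the measure `dy dt / t`
integrable over a tent. -/
lemma lintegral_tent_ratio_le (hd : 0 < d) {b : ℝ} (hb : 0 < b) {q : ℝ} (hq : 1 < q) (a : Euc d)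
    {r : ℝ} (hr : 0 < r) :
    ∫⁻ z in tent (Metric.ball a r), ENNReal.ofReal ((z.2 / r) ^ b) ^ q ∂hsMeasure d 1 ≤
      ENNReal.ofReal (1 / b) * volume (Metric.ball a r) := by
  have hmeas : Measurable fun s : ℝ => ENNReal.ofReal ((s / r) ^ b) :=
    (Measurable.pow_const (by fun_prop) _).ennreal_ofReal
  calc ∫⁻ z in tent (Metric.ball a r), ENNReal.ofReal ((z.2 / r) ^ b) ^ q ∂hsMeasure d 1
      ≤ ∫⁻ z, (Metric.ball a r).indicator 1 z.1 * (Ioc 0 r).indicator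
          (fun s => ENNReal.ofReal ((s / r) ^ b)) z.2 ∂hsMeasure d 1 := by
        rw [← lintegral_indicator (measurableSet_tent _)]
        refine lintegral_mono fun z => ?_
        by_cases h : z ∈ tent (Metric.ball a r)
        · have h1 := snd_le_of_mem_tent hd hr h
          rw [indicator_of_mem h, indicator_of_mem (fst_mem_of_mem_tent h),
            indicator_of_mem (show z.2 ∈ Ioc 0 r from ⟨h.1, h1⟩), Pi.one_apply, one_mul]
          have h2 : ENNReal.ofReal ((z.2 / r) ^ b) ≤ 1 := by
            rw [ENNReal.ofReal_le_one]
            exact Real.rpow_le_one (div_nonneg h.1.le hr.le) ((div_le_one hr).2 h1) hb.le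
          calc ENNReal.ofReal ((z.2 / r) ^ b) ^ q ≤ ENNReal.ofReal ((z.2 / r) ^ b) ^ (1 : ℝ) :=
                ENNReal.rpow_le_rpow_of_exponent_ge h2 hq.le
            _ = _ := ENNReal.rpow_one _
        · simp [h]
    _ = ∫⁻ s in Ioi (0 : ℝ), (Ioc 0 r).indicator
          (fun s => ENNReal.ofReal (s ^ (b - 1) / r ^ b)) s * volume (Metric.ball a r) := by
        rw [lintegral_hsMeasure]
        · refine setLIntegral_congr_fun measurableSet_Ioi fun s hs => ?_
          have hs : 0 < s := hs
          simp only
          rw [lintegral_mul_const _ (measurable_one.indicator Metric.isOpen_ball.measurableSet),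
            lintegral_indicator_one Metric.isOpen_ball.measurableSet,
            mul_comm (volume (Metric.ball a r)), ← mul_assoc]
          congr 1
          by_cases h : s ∈ Ioc 0 r
          · rw [indicator_of_mem h, indicator_of_mem h, ← ENNReal.ofReal_mul (by positivity),
              pow_one, Real.div_rpow hs.le hr.le, Real.rpow_sub_one hs.ne']
            congr 1
            field_simp
          · rw [indicator_of_notMem h, indicator_of_notMem h, mul_zero]
        · exact ((measurable_one.indicator Metric.isOpen_ball.measurableSet).comp
            measurable_fst).mul ((hmeas.indicator measurableSet_Ioc).comp measurable_snd)
    _ ≤ _ := by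
        rw [lintegral_mul_const' _ _ (volume_ball_ne_top _ _)]
        gcongr
        rw [lintegral_indicator measurableSet_Ioc, Measure.restrict_restrict measurableSet_Ioc,
          inter_eq_left.2 (fun s hs => hs.1)]
        have hint : IntervalIntegrable (fun s : ℝ => s ^ (b - 1) / r ^ b) volume 0 r :=
          (intervalIntegral.intervalIntegrable_rpow' (by linarith)).div_const _
        rw [← ofReal_integral_eq_lintegral_ofReal
          ((intervalIntegrable_iff_integrableOn_Ioc_of_le hr.le).1 hint), ←
          intervalIntegral.integral_of_le hr.le, intervalIntegral.integral_div,
          integral_rpow (Or.inl (by linarith))]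
        · refine ENNReal.ofReal_le_ofReal (le_of_eq ?_)
          rw [sub_add_cancel, Real.zero_rpow hb.ne']
          have : 0 < r ^ b := by positivity
          field_simp
          ring
        · filter_upwards [ae_restrict_mem measurableSet_Ioc] with s hs
          have := hs.1
          positivity

/-- The positive operator is bounded pointwise for the Carleson functional. -/
lemma exists_carlFun_tentOp_le (hd : 0 < d) {b : ℝ} (hb : 0 < b) (hb1 : b ≤ 1 / 2) {C : ℝ≥0}
    (hC : TentConst d b C) :
    ∃ D : ℝ≥0, 1 ≤ D ∧ ∀ (q : ℝ) (f : Euc d × ℝ → ℝ≥0∞) (x : Euc d), 1 < q → Measurable f →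
      carlFun q (tentOp b f) x ≤ D * carlFun q f x := by
  let S : ℝ≥0∞ := ∑' k : ℕ, ENNReal.ofReal ((2 ^ (-b)) ^ k)
  have hS : S ≠ ∞ := by
    have hlt : (2 : ℝ) ^ (-b) < 1 := Real.rpow_lt_one_of_one_lt_of_neg (by norm_num) (by linarith)
    exact (summable_geometric_of_lt_one (by positivity) hlt).tsum_ofReal_ne_top
  let D₁ : ℝ≥0∞ := S * (2 * 4 ^ d * unitVol d)
  have hD₁ : D₁ ≠ ∞ := ENNReal.mul_ne_top hS (ENNReal.mul_ne_top (ENNReal.mul_ne_top (by simp)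
    (ENNReal.pow_ne_top (by simp))) unitVol_ne_top)
  have hb' : 1 ≤ ENNReal.ofReal (1 / b) := by
    rw [ENNReal.one_le_ofReal, le_div_iff₀ hb]; linarith
  let E : ℝ≥0∞ := C * 4 ^ d + D₁ * ENNReal.ofReal (1 / b)
  have hE : E ≠ ∞ := ENNReal.add_ne_top.2 ⟨ENNReal.mul_ne_top (by simp)
    (ENNReal.pow_ne_top (by simp)), ENNReal.mul_ne_top hD₁ ENNReal.ofReal_ne_top⟩
  have hE1 : 1 ≤ E := by
    refine le_trans ?_ le_self_add
    exact one_le_mul (by exact_mod_cast hC.1) (one_le_pow₀ (by norm_num))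
  refine ⟨2 * E.toNNReal, ?_, fun q f x hq hf => ?_⟩
  · have : (1 : ℝ≥0) ≤ E.toNNReal := by
      rw [← ENNReal.coe_le_coe, ENNReal.coe_toNNReal hE]; exact_mod_cast hE1
    exact one_le_mul_of_one_le_of_one_le (by norm_num) this
  have hq0 : 0 < q := by linarith
  rw [ENNReal.coe_mul, ENNReal.coe_toNNReal hE]
  refine carlFun_le hq0 _ fun a r hr hx => ?_
  set c := carlFun q f x with hc
  set V := volume (Metric.ball a r) with hV
  let S₂ := tent (Metric.ball a (2 ^ 2 * r))
  have hS₂ : MeasurableSet S₂ := measurableSet_tent _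
  -- decomposition into the local part and annular parts
  have hdec : ∀ z ∈ tent (Metric.ball a r), tentOp b f z ≤
      tentOp b (S₂.indicator f) z + ENNReal.ofReal ((z.2 / r) ^ b) * (D₁ * c) := by
    intro z hz
    let A : ℕ → Set (Euc d × ℝ) := fun k =>
      tent (Metric.ball a (2 ^ (k + 3) * r)) \ tent (Metric.ball a (2 ^ (k + 2) * r))
    have hA : ∀ k, MeasurableSet (A k) := fun k =>
      (measurableSet_tent _).diff (measurableSet_tent _)
    have hmono : ∀ m n : ℕ, m ≤ n →
        tent (Metric.ball a (2 ^ m * r)) ⊆ tent (Metric.ball a (2 ^ n * r)) := by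
      intro m n hmn
      refine tent_mono (Metric.ball_subset_ball ?_)
      gcongr
      norm_num
    have hcov : ∀ w : Euc d × ℝ, 0 < w.2 → f w ≤ S₂.indicator f w + ∑' k, (A k).indicator f w := by
      intro w hw
      have hex : ∃ n : ℕ, w ∈ tent (Metric.ball a (2 ^ n * r)) := by
        obtain ⟨n, hn⟩ := pow_unbounded_of_one_lt ((w.2 + ‖w.1 - a‖) / r)
          (by norm_num : (1 : ℝ) < 2)
        rw [div_lt_iff₀ hr] at hn
        refine ⟨n, mem_tent_iff.2 ⟨hw, fun u hu => ?_⟩⟩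
        rw [Metric.mem_ball] at hu ⊢
        have := dist_triangle u w.1 a
        rw [dist_eq_norm w.1 a] at this
        linarith
      classical
      by_cases h2 : w ∈ S₂
      · rw [indicator_of_mem h2]; exact le_self_add
      have hn := Nat.find_spec hex
      have hmin := fun m => Nat.find_min hex (m := m)
      set n := Nat.find hex
      have hn3 : 3 ≤ n := by
        by_contra hlt
        exact h2 (hmono n 2 (by omega) hn)
      have hmem : w ∈ A (n - 3) := by
        refine ⟨?_, ?_⟩
        · rw [show n - 3 + 3 = n by omega]; exact hn
        · exact hmin (n - 3 + 2) (by omega)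
      calc f w = (A (n - 3)).indicator f w := (indicator_of_mem hmem f).symm
        _ ≤ ∑' k, (A k).indicator f w := ENNReal.le_tsum (n - 3)
        _ ≤ _ := le_add_self
    have hAf : ∀ k, Measurable ((A k).indicator f) := fun k => hf.indicator (hA k)
    calc tentOp b f z
        ≤ ∫⁻ w, nker b z w * S₂.indicator f w + ∑' k, nker b z w * (A k).indicator f w
            ∂hsMeasure d 1 := by
          refine lintegral_mono_ae ?_
          filter_upwards [ae_hsMeasure_pos 1] with w hw
          rw [ENNReal.tsum_mul_left, ← mul_add]
          gcongr
          exact hcov w hw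
      _ = tentOp b (S₂.indicator f) z + ∑' k, ∫⁻ w in A k, nker b z w * f w ∂hsMeasure d 1 := by
          rw [lintegral_add_left ((measurable_nker_right b z).fun_mul (hf.indicator hS₂)),
            lintegral_tsum fun k => ((measurable_nker_right b z).fun_mul (hAf k)).aemeasurable]
          congr 1
          refine tsum_congr fun k => ?_
          rw [← lintegral_indicator (hA k)]
          refine lintegral_congr fun w => ?_
          by_cases h : w ∈ A k <;> simp [h]
      _ ≤ tentOp b (S₂.indicator f) z + ∑' k, ENNReal.ofReal ((z.2 / r) ^ b) *
            (ENNReal.ofReal ((2 ^ (-b)) ^ k) * (2 * 4 ^ d * unitVol d * c)) := by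
          gcongr with k
          exact lintegral_nker_annulus_le hb hb1 hq hf hr hx hz k
      _ = _ := by
          rw [ENNReal.tsum_mul_left, ENNReal.tsum_mul_right]
          simp only [D₁, S]
          ring
  have hnear : ∫⁻ z in tent (Metric.ball a r), tentOp b (S₂.indicator f) z ^ q ∂hsMeasure d 1 ≤
      V * (E * c) ^ q := by
    calc ∫⁻ z in tent (Metric.ball a r), tentOp b (S₂.indicator f) z ^ q ∂hsMeasure d 1
        ≤ ∫⁻ z, tentOp b (S₂.indicator f) z ^ q ∂hsMeasure d 1 := setLIntegral_le_lintegral _ _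
      _ ≤ (C : ℝ≥0∞) ^ q * ∫⁻ z, S₂.indicator f z ^ q ∂hsMeasure d 1 :=
          hC.lintegral_tentOp_rpow_le hq (hf.indicator hS₂)
      _ = (C : ℝ≥0∞) ^ q * ∫⁻ z in S₂, f z ^ q ∂hsMeasure d 1 := by
          rw [← lintegral_indicator hS₂]
          congr 1
          refine lintegral_congr fun z => ?_
          by_cases h : z ∈ S₂ <;> simp [h, hq0]
      _ ≤ (C : ℝ≥0∞) ^ q * (4 ^ d * V * c ^ q) := by
          gcongr
          have h4 : (0 : ℝ) < 2 ^ 2 := by norm_num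
          refine (lintegral_tent_le hq0 f (by positivity) (Metric.ball_subset_ball
            (le_mul_of_one_le_left hr.le (by norm_num)) hx)).trans (le_of_eq ?_)
          rw [volume_ball_mul a a hr h4, ENNReal.ofReal_pow (by norm_num)]
          norm_num [hc, hV]
      _ ≤ V * (C * 4 ^ d * c) ^ q := by
          rw [ENNReal.mul_rpow_of_nonneg _ _ hq0.le, ENNReal.mul_rpow_of_nonneg _ _ hq0.le]
          have h4 : (4 : ℝ≥0∞) ^ d ≤ ((4 : ℝ≥0∞) ^ d) ^ q := by
            calc (4 : ℝ≥0∞) ^ d = ((4 : ℝ≥0∞) ^ d) ^ (1 : ℝ) := (ENNReal.rpow_one _).symm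
              _ ≤ _ := ENNReal.rpow_le_rpow_of_exponent_le (one_le_pow₀ (by norm_num)) hq.le
          calc (C : ℝ≥0∞) ^ q * (4 ^ d * V * c ^ q) = V * ((C : ℝ≥0∞) ^ q * 4 ^ d * c ^ q) := by ring
            _ ≤ _ := by gcongr
      _ ≤ _ := by gcongr; exact le_self_add
  have hfar : ∫⁻ z in tent (Metric.ball a r), (ENNReal.ofReal ((z.2 / r) ^ b) * (D₁ * c)) ^ q
      ∂hsMeasure d 1 ≤ V * (E * c) ^ q := by
    simp_rw [ENNReal.mul_rpow_of_nonneg _ _ hq0.le]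
    rw [lintegral_mul_const _ (Measurable.pow_const (Measurable.pow_const (by fun_prop)
      _).ennreal_ofReal _)]
    calc _ ≤ (ENNReal.ofReal (1 / b) * V) * (D₁ ^ q * c ^ q) := by
          gcongr; exact lintegral_tent_ratio_le hd hb hq a hr
      _ ≤ V * ((D₁ ^ q * ENNReal.ofReal (1 / b) ^ q) * c ^ q) := by
          have h4 : ENNReal.ofReal (1 / b) ≤ ENNReal.ofReal (1 / b) ^ q := by
            calc ENNReal.ofReal (1 / b) = ENNReal.ofReal (1 / b) ^ (1 : ℝ) :=
                  (ENNReal.rpow_one _).symm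
              _ ≤ _ := ENNReal.rpow_le_rpow_of_exponent_le hb' hq.le
          calc _ = V * ((D₁ ^ q * ENNReal.ofReal (1 / b)) * c ^ q) := by ring
            _ ≤ _ := by gcongr
      _ ≤ _ := by
          rw [← ENNReal.mul_rpow_of_nonneg _ _ hq0.le]
          gcongr
          exact le_add_self
  calc ∫⁻ z in tent (Metric.ball a r), tentOp b f z ^ q ∂hsMeasure d 1
      ≤ ∫⁻ z in tent (Metric.ball a r), 2 ^ (q - 1) * (tentOp b (S₂.indicator f) z ^ q +
          (ENNReal.ofReal ((z.2 / r) ^ b) * (D₁ * c)) ^ q) ∂hsMeasure d 1 := by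
        refine setLIntegral_mono' (measurableSet_tent _) fun z hz => ?_
        exact (ENNReal.rpow_le_rpow (hdec z hz) hq0.le).trans
          (ENNReal.rpow_add_le_mul_rpow_add_rpow _ _ hq.le)
    _ = 2 ^ (q - 1) * (∫⁻ z in tent (Metric.ball a r), tentOp b (S₂.indicator f) z ^ q
          ∂hsMeasure d 1 + ∫⁻ z in tent (Metric.ball a r),
          (ENNReal.ofReal ((z.2 / r) ^ b) * (D₁ * c)) ^ q ∂hsMeasure d 1) := by
        have hm := (measurable_tentOp b (hf.indicator hS₂)).pow_const q
        rw [lintegral_const_mul' _ _ (ENNReal.rpow_ne_top_of_nonneg (by linarith) (by simp)),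
          lintegral_add_left hm]
    _ ≤ 2 ^ (q - 1) * (V * (E * c) ^ q + V * (E * c) ^ q) := by gcongr
    _ = V * ((2 ^ (q - 1) * 2) * (E * c) ^ q) := by ring
    _ = V * (2 * E * c) ^ q := by
        have h2 := coe_rpow_sub_one_mul 2 (by norm_num) q
        norm_num at h2
        rw [h2, mul_assoc, ENNReal.mul_rpow_of_nonneg 2 _ hq0.le]

end

end TentHardy

namespace TentHardy

noncomputable section

open scoped NNReal

variable {d : ℕ}

/-! ### Duality between the area function and the Carleson functional -/

/-- The set where the distribution function of `ν` is at most `c` is a half-line, possibly without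
its end point; by continuity from below its measure is at most `c`. -/
lemma measure_setOf_measure_Iic_le (ν : Measure ℝ) (c : ℝ≥0∞) :
    ν {τ | ν (Iic τ) ≤ c} ≤ c := by
  set D := {τ | ν (Iic τ) ≤ c} with hD
  have hlow : ∀ τ ∈ D, Iic τ ⊆ D := fun τ hτ σ hσ =>
    (measure_mono (Iic_subset_Iic.2 hσ)).trans hτ
  by_cases hmax : ∃ τ ∈ D, ∀ σ ∈ D, σ ≤ τ
  · obtain ⟨τ, hτ, hm⟩ := hmax
    exact (measure_mono fun σ hσ => hm σ hσ).trans hτ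
  · push Not at hmax
    have hcov : D ⊆ ⋃ q : {q : ℚ // (q : ℝ) ∈ D}, Iic ((q : ℚ) : ℝ) := by
      intro τ hτ
      obtain ⟨σ, hσ, hlt⟩ := hmax τ hτ
      obtain ⟨q, hq1, hq2⟩ := exists_rat_btwn hlt
      exact mem_iUnion.2 ⟨⟨q, hlow σ hσ hq2.le⟩, hq1.le⟩
    refine (measure_mono hcov).trans ?_
    rw [Directed.measure_iUnion]
    · exact iSup_le fun q => q.2
    · intro p q
      rcases le_total p q with h | h
      · exact ⟨q, Iic_subset_Iic.2 (by exact_mod_cast h), subset_rfl⟩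
      · exact ⟨p, subset_rfl, Iic_subset_Iic.2 (by exact_mod_cast h)⟩

/-- The area integral over the cone truncated at height `τ`. -/
def areaTrunc (q : ℝ) (h : Euc d × ℝ → ℝ≥0∞) (x : Euc d) (τ : ℝ) : ℝ≥0∞ :=
  ∫⁻ z in cone x, {z : Euc d × ℝ | z.2 ≤ τ}.indicator (fun z => h z ^ q) z ∂hsMeasure d (d + 1)

lemma measurable_areaTrunc {q : ℝ} {h : Euc d × ℝ → ℝ≥0∞} (hh : Measurable h) :
    Measurable fun p : Euc d × ℝ => areaTrunc q h p.1 p.2 := by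
  have : (fun p : Euc d × ℝ => areaTrunc q h p.1 p.2) = fun p => ∫⁻ z,
      {r : (Euc d × ℝ) × (Euc d × ℝ) | ‖r.2.1 - r.1.1‖ < r.2.2 ∧ r.2.2 ≤ r.1.2}.indicator
        (fun r => h r.2 ^ q) (p, z) ∂hsMeasure d (d + 1) := by
    funext p
    rw [areaTrunc, ← lintegral_indicator (measurableSet_cone p.1)]
    refine lintegral_congr fun z => ?_
    by_cases h1 : z ∈ cone p.1
    · rw [indicator_of_mem h1]
      by_cases h2 : z.2 ≤ p.2
      · rw [indicator_of_mem (by exact h2), indicator_of_mem (by exact ⟨h1, h2⟩)]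
      · rw [indicator_of_notMem (by exact h2), indicator_of_notMem (by exact fun h => h2 h.2)]
    · rw [indicator_of_notMem h1, indicator_of_notMem (by exact fun h => h1 h.1)]
  rw [this]
  refine Measurable.lintegral_prod_right (((hh.comp measurable_snd).pow_const q).indicator ?_)
  have h1 : MeasurableSet {r : (Euc d × ℝ) × (Euc d × ℝ) | ‖r.2.1 - r.1.1‖ < r.2.2} :=
    measurableSet_lt (by fun_prop) (by fun_prop)
  have h2 : MeasurableSet {r : (Euc d × ℝ) × (Euc d × ℝ) | r.2.2 ≤ r.1.2} :=
    measurableSet_le (by fun_prop) (by fun_prop)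
  exact h1.inter h2

lemma measurable_areaTrunc_comp {α : Type*} [MeasurableSpace α] {q : ℝ} {h : Euc d × ℝ → ℝ≥0∞}
    (hh : Measurable h) {f : α → Euc d} {g : α → ℝ} (hf : Measurable f) (hg : Measurable g) :
    Measurable fun a => areaTrunc q h (f a) (g a) := by
  have h1 := (measurable_areaTrunc (q := q) hh).comp (hf.prodMk hg)
  exact h1

/-- The stopping time estimate: the part of the cone on which the truncated area integral is
below a threshold contributes at most the threshold. -/
lemma lintegral_areaTrunc_le_threshold {q : ℝ} {h : Euc d × ℝ → ℝ≥0∞} (hh : Measurable h)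
    (x : Euc d) (c : ℝ≥0∞) :
    ∫⁻ z in cone x, {z : Euc d × ℝ | areaTrunc q h x z.2 ≤ c}.indicator (fun z => h z ^ q) z
      ∂hsMeasure d (d + 1) ≤ c := by
  let ν : Measure ℝ := (((hsMeasure d (d + 1)).restrict (cone x)).withDensity
    (fun z => h z ^ q)).map Prod.snd
  have hν : ∀ A : Set ℝ, MeasurableSet A → ν A = ∫⁻ z in cone x,
      {z : Euc d × ℝ | z.2 ∈ A}.indicator (fun z => h z ^ q) z ∂hsMeasure d (d + 1) := by
    intro A hA
    rw [Measure.map_apply measurable_snd hA, withDensity_apply _ (measurable_snd hA),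
      ← lintegral_indicator (measurable_snd hA)]
    rfl
  have h1 : ∀ τ, ν (Iic τ) = areaTrunc q h x τ := fun τ => hν _ measurableSet_Iic
  have hm : MeasurableSet {τ | areaTrunc q h x τ ≤ c} :=
    measurableSet_le (measurable_areaTrunc_comp hh measurable_const measurable_id) measurable_const
  have h2 := measure_setOf_measure_Iic_le ν c
  simp_rw [h1] at h2
  rw [hν _ hm] at h2
  exact h2

/-- On at least half of the shadow of a point, the truncated area integral is controlled by the
Carleson functional. -/
lemma one_le_two_mul_ballAvg_indicator {q : ℝ} (hq : 0 < q) {h : Euc d × ℝ → ℝ≥0∞}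
    (hh : Measurable h) (y : Euc d) {t : ℝ} (ht : 0 < t) :
    1 ≤ 2 * ballAvg ({x | areaTrunc q h x t ≤ 2 * unitVol d * 3 ^ d * carlFun q h x ^ q}.indicator 1)
      y t := by
  set B := Metric.ball y t with hB
  have hBm : MeasurableSet B := measurableSet_ball
  set V := volume B with hV
  have hV0 : V ≠ 0 := volume_ball_pos y ht
  have hVt : V ≠ ∞ := volume_ball_ne_top y t
  have hTm : Measurable fun x => areaTrunc q h x t :=
    measurable_areaTrunc_comp hh measurable_id measurable_const
  set G := {x | areaTrunc q h x t ≤ 2 * unitVol d * 3 ^ d * carlFun q h x ^ q} with hG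
  have hGm : MeasurableSet G :=
    measurableSet_le hTm (((measurable_carlFun q h).pow_const q).const_mul _)
  set m := ∫⁻ x in B, areaTrunc q h x t with hm
  -- a truncated cone with vertex in `B(y, t)` lies in the tent over `B(y, 3 t)`
  have hmle : ∀ x₀ ∈ B, m ≤ unitVol d * 3 ^ d * V * carlFun q h x₀ ^ q := by
    intro x₀ hx₀
    set T := tent (Metric.ball y (3 * t)) with hT
    have hTms : MeasurableSet T := measurableSet_tent _
    have hΦ : Measurable (Function.uncurry fun (_ : Euc d) (z : Euc d × ℝ) =>
        T.indicator (fun z => h z ^ q) z) :=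
      ((hh.pow_const q).indicator hTms).comp measurable_snd
    calc m ≤ ∫⁻ x in B, ∫⁻ z in cone x, T.indicator (fun z => h z ^ q) z ∂hsMeasure d (d + 1) := by
          refine setLIntegral_mono' hBm fun x hx => ?_
          refine setLIntegral_mono' (measurableSet_cone x) fun z hz => ?_
          by_cases h2 : z.2 ≤ t
          · rw [indicator_of_mem (by exact h2), indicator_of_mem]
            have hz' := mem_cone_iff.1 hz
            rw [Metric.mem_ball] at hz'
            refine mem_tent_iff.2 ⟨(dist_nonneg.trans_lt hz'), fun u hu => ?_⟩
            have hx : dist x y < t := hx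
            rw [Metric.mem_ball] at hu ⊢
            have h3 := dist_triangle u z.1 y
            have h4 := dist_triangle z.1 x y
            rw [dist_comm z.1 x] at h4
            linarith
          · rw [indicator_of_notMem (by exact h2)]; exact zero_le
      _ ≤ ∫⁻ x, ∫⁻ z in cone x, T.indicator (fun z => h z ^ q) z ∂hsMeasure d (d + 1) :=
          setLIntegral_le_lintegral _ _
      _ = unitVol d * ∫⁻ z in T, h z ^ q ∂hsMeasure d 1 := by
          rw [lintegral_cone hΦ, ← lintegral_indicator hTms]
          congr 1
          refine lintegral_congr_ae ?_
          filter_upwards [ae_hsMeasure_pos 1] with z hz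
          exact ballAvg_const _ _ hz
      _ ≤ unitVol d * (volume (Metric.ball y (3 * t)) * carlFun q h x₀ ^ q) := by
          gcongr
          exact lintegral_tent_le hq h (by positivity)
            (Metric.ball_subset_ball (by linarith) hx₀)
      _ = _ := by
          rw [volume_ball_mul y y ht (by norm_num), ENNReal.ofReal_pow (by norm_num), ← hV]
          norm_num
          ring
  -- Chebyshev's inequality
  have hbad : volume (B \ G) ≤ V / 2 := by
    have hsub : B \ G ⊆ {x | 2 * m / V < areaTrunc q h x t} ∩ B := by
      rintro x ⟨hx, hxG⟩
      refine ⟨?_, hx⟩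
      have hxG : 2 * unitVol d * 3 ^ d * carlFun q h x ^ q < areaTrunc q h x t := not_le.1 hxG
      refine lt_of_le_of_lt ?_ hxG
      rw [ENNReal.div_le_iff hV0 hVt]
      calc 2 * m ≤ 2 * (unitVol d * 3 ^ d * V * carlFun q h x ^ q) := by gcongr; exact hmle x hx
        _ = _ := by ring
    refine (measure_mono hsub).trans ?_
    have hlt : MeasurableSet {x | 2 * m / V < areaTrunc q h x t} :=
      measurableSet_lt measurable_const hTm
    by_cases hm0 : m = 0
    · have h0 : (fun x => areaTrunc q h x t) =ᵐ[volume.restrict B] 0 :=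
        (lintegral_eq_zero_iff hTm).1 hm0
      have : volume.restrict B {x | 2 * m / V < areaTrunc q h x t} = 0 := by
        rw [hm0]
        refine measure_mono_null (fun x hx => ?_) h0
        have hx : 2 * 0 / V < areaTrunc q h x t := hx
        simp only [mul_zero, ENNReal.zero_div] at hx
        exact hx.ne'
      rw [Measure.restrict_apply hlt] at this
      rw [this]; exact zero_le
    by_cases hmt : m = ∞
    · have : {x | 2 * m / V < areaTrunc q h x t} = ∅ := by
        ext x
        simp [hmt, ENNReal.mul_top, ENNReal.top_div_of_ne_top hVt]
      rw [this]; simp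
    · have h3 := mul_meas_ge_le_lintegral₀ (μ := volume.restrict B) hTm.aemeasurable (2 * m / V)
      have h4 : volume ({x | 2 * m / V < areaTrunc q h x t} ∩ B) ≤
          volume.restrict B {x | 2 * m / V ≤ areaTrunc q h x t} := by
        rw [← Measure.restrict_apply hlt]
        refine measure_mono ?_
        intro x hx
        exact le_of_lt (mem_ofPred_eq ▸ hx)
      have h5 : 2 * m / V ≠ 0 := (ENNReal.div_pos (mul_ne_zero (by simp) hm0) hVt).ne'
      have h6 : 2 * m / V ≠ ∞ := ENNReal.div_ne_top (ENNReal.mul_ne_top (by simp) hmt) hV0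
      refine h4.trans ?_
      have h7 := (ENNReal.le_div_iff_mul_le (Or.inl h5) (Or.inl h6)).2 (mul_comm (2 * m / V) _ ▸ h3)
      refine h7.trans (le_of_eq ?_)
      rw [← hm, ENNReal.div_eq_inv_mul, ENNReal.inv_div (Or.inl hVt) (Or.inl hV0),
        ENNReal.div_eq_inv_mul, ENNReal.mul_inv (Or.inl (by simp)) (Or.inl (by simp)),
        mul_comm _ m, ← mul_assoc, ← mul_assoc, mul_comm m, mul_assoc (2⁻¹),
        ENNReal.mul_inv_cancel hm0 hmt, mul_one, ENNReal.div_eq_inv_mul]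
  have hgood : V / 2 ≤ volume (G ∩ B) := by
    have h1 : V ≤ volume (G ∩ B) + volume (B \ G) := by
      refine (measure_mono (t := (G ∩ B) ∪ (B \ G)) fun x hx => ?_).trans (measure_union_le _ _)
      by_cases hxG : x ∈ G
      · exact Or.inl ⟨hxG, hx⟩
      · exact Or.inr ⟨hx, hxG⟩
    have h2 : V / 2 + V / 2 ≤ volume (G ∩ B) + V / 2 := by
      rw [ENNReal.add_halves]
      exact h1.trans (by gcongr)
    exact (ENNReal.add_le_add_iff_right (ENNReal.div_ne_top hVt (by simp))).1 h2
  rw [ballAvg, lintegral_indicator_one₀ hGm.nullMeasurableSet, Measure.restrict_apply hGm]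
  calc (1 : ℝ≥0∞) = 2 * (V⁻¹ * (V / 2)) := by
        rw [ENNReal.div_eq_inv_mul, mul_left_comm V⁻¹, ENNReal.inv_mul_cancel hV0 hVt, mul_one,
          ENNReal.mul_inv_cancel (by simp) (by simp)]
    _ ≤ _ := by gcongr

lemma rpow_one_div_rpow {a : ℝ≥0∞} {q : ℝ} (hq : 0 < q) : (a ^ q) ^ (1 / q) = a := by
  rw [← ENNReal.rpow_mul, mul_one_div_cancel hq.ne', ENNReal.rpow_one]

lemma rpow_rpow_one_div {a : ℝ≥0∞} {q : ℝ} (hq : 0 < q) : (a ^ (1 / q)) ^ q = a := by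
  rw [← ENNReal.rpow_mul, one_div_mul_cancel hq.ne', ENNReal.rpow_one]

lemma rpow_one_div_le_max (a : ℝ≥0∞) {q : ℝ} (hq : 1 ≤ q) : a ^ (1 / q) ≤ max 1 a := by
  calc a ^ (1 / q) ≤ max 1 a ^ (1 / q) := by gcongr; exact le_max_right _ _
    _ ≤ max 1 a ^ (1 : ℝ) := ENNReal.rpow_le_rpow_of_exponent_le (le_max_left _ _)
        ((div_le_one (by linarith)).2 hq)
    _ = _ := ENNReal.rpow_one _

/-- The duality inequality of Coifman, Meyer and Stein. -/
lemma exists_lintegral_mul_le_area_mul_carl (d : ℕ) :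
    ∃ D : ℝ≥0, ∀ (q q' : ℝ) (f h : Euc d × ℝ → ℝ≥0∞), q.HolderConjugate q' →
      Measurable f → Measurable h →
      ∫⁻ z, f z * h z ∂hsMeasure d 1 ≤
        D * ∫⁻ x, areaPow q f x ^ (1 / q) * carlFun q' h x := by
  let κ : ℝ≥0∞ := 2 * unitVol d * 3 ^ d
  have hκ : κ ≠ ∞ := ENNReal.mul_ne_top (ENNReal.mul_ne_top (by simp) unitVol_ne_top)
    (ENNReal.pow_ne_top (by simp))
  let D : ℝ≥0∞ := (unitVol d)⁻¹ * 2 * max 1 κ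
  have hD : D ≠ ∞ := ENNReal.mul_ne_top (ENNReal.mul_ne_top
    (ENNReal.inv_ne_top.2 unitVol_ne_zero) (by simp)) (by simp [hκ])
  refine ⟨D.toNNReal, fun q q' f h hqq hf hh => ?_⟩
  rw [ENNReal.coe_toNNReal hD]
  have hq0 : 0 < q := hqq.pos
  have hq'0 : 0 < q' := hqq.symm.pos
  -- the pairs `(x, (y, t))` such that `t` is below the stopping height of the cone at `x`
  let E : Set (Euc d × (Euc d × ℝ)) :=
    {p | areaTrunc q' h p.1 p.2.2 ≤ κ * carlFun q' h p.1 ^ q'}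
  have hE : MeasurableSet E := measurableSet_le
    (measurable_areaTrunc_comp hh measurable_fst (measurable_snd.comp measurable_snd))
    ((((measurable_carlFun q' h).pow_const q').const_mul κ).comp measurable_fst)
  have hEx : ∀ x, MeasurableSet {z | (x, z) ∈ E} := fun x =>
    (by fun_prop : Measurable fun z : Euc d × ℝ => (x, z)) hE
  have hfh : Measurable fun z => f z * h z := hf.fun_mul hh
  have hΦ : Measurable (Function.uncurry fun (x : Euc d) (z : Euc d × ℝ) =>
      E.indicator 1 (x, z) * (f z * h z)) :=
    (measurable_one.indicator hE).mul (hfh.comp measurable_snd)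
  calc ∫⁻ z, f z * h z ∂hsMeasure d 1
      ≤ ∫⁻ z, 2 * ballAvg (fun x => E.indicator 1 (x, z) * (f z * h z)) z.1 z.2
          ∂hsMeasure d 1 := by
        refine lintegral_mono_ae ?_
        filter_upwards [ae_hsMeasure_pos 1] with z hz
        have h1 := one_le_two_mul_ballAvg_indicator hq'0 hh z.1 hz
        have h2 : ballAvg (fun x => E.indicator 1 (x, z) * (f z * h z)) z.1 z.2 =
            ballAvg ({x | areaTrunc q' h x z.2 ≤ 2 * unitVol d * 3 ^ d *
              carlFun q' h x ^ q'}.indicator 1) z.1 z.2 * (f z * h z) := by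
          unfold ballAvg
          rw [lintegral_mul_const, mul_assoc]
          · rfl
          · exact (measurable_one.indicator hE).comp
              (by fun_prop : Measurable fun x : Euc d => (x, z))
        rw [h2, ← mul_assoc]
        exact le_mul_of_one_le_left' h1
    _ = (unitVol d)⁻¹ * 2 * ∫⁻ x, ∫⁻ z in cone x, E.indicator 1 (x, z) * (f z * h z)
          ∂hsMeasure d (d + 1) := by
        rw [lintegral_cone hΦ, lintegral_const_mul' _ _ (by simp), mul_comm _ (2 : ℝ≥0∞), mul_assoc,
          ← mul_assoc (unitVol d)⁻¹, ENNReal.inv_mul_cancel unitVol_ne_zero unitVol_ne_top, one_mul]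
    _ ≤ (unitVol d)⁻¹ * 2 * ∫⁻ x, max 1 κ * (areaPow q f x ^ (1 / q) * carlFun q' h x) := by
        gcongr with x
        let g : Euc d × ℝ → ℝ≥0∞ := fun z => {z | (x, z) ∈ E}.indicator h z
        have hg : Measurable g := hh.indicator (hEx x)
        have h1 := ENNReal.lintegral_mul_le_Lp_mul_Lq
          ((hsMeasure d (d + 1)).restrict (cone x)) hqq hf.aemeasurable hg.aemeasurable
        calc ∫⁻ z in cone x, E.indicator 1 (x, z) * (f z * h z) ∂hsMeasure d (d + 1)
            = ∫⁻ z in cone x, (f * g) z ∂hsMeasure d (d + 1) := by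
              refine lintegral_congr fun z => ?_
              by_cases hz : (x, z) ∈ E
              · simp [g, hz]
              · simp [g, hz]
          _ ≤ _ := h1
          _ ≤ areaPow q f x ^ (1 / q) * (κ * carlFun q' h x ^ q') ^ (1 / q') := by
              gcongr
              · exact le_rfl
              · refine le_trans (lintegral_mono fun z => ?_)
                  (lintegral_areaTrunc_le_threshold (q := q') hh x (κ * carlFun q' h x ^ q'))
                by_cases hz : (x, z) ∈ E
                · have hz' : z ∈ {z : Euc d × ℝ |
                    areaTrunc q' h x z.2 ≤ κ * carlFun q' h x ^ q'} := hz
                  simp only [g]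
                  rw [indicator_of_mem (by exact hz), indicator_of_mem hz']
                · simp [g, hz, hq'0]
          _ ≤ areaPow q f x ^ (1 / q) * (max 1 κ * carlFun q' h x) := by
              rw [ENNReal.mul_rpow_of_nonneg _ _ (by positivity), rpow_one_div_rpow hq'0]
              gcongr
              exact rpow_one_div_le_max κ hqq.symm.lt.le
          _ = _ := by ring
    _ = _ := by
        rw [lintegral_const_mul']
        · simp only [D, mul_assoc]
        · simp [hκ]

/-! ### Boundedness of the positive operator on tent spaces -/

/-- The tent space norm of a nonnegative function. -/
def areaNorm (p q : ℝ) (f : Euc d × ℝ → ℝ≥0∞) : ℝ≥0∞ := (∫⁻ x, areaPow q f x ^ (p / q)) ^ (1 / p)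

lemma unitVol_mul_lintegral_mul_le {q q' : ℝ} (hqq : q.HolderConjugate q')
    {f h : Euc d × ℝ → ℝ≥0∞} (hf : Measurable f) (hh : Measurable h) :
    unitVol d * ∫⁻ z, f z * h z ∂hsMeasure d 1 ≤
      ∫⁻ x, areaPow q f x ^ (1 / q) * areaPow q' h x ^ (1 / q') := by
  have hΦ : Measurable (Function.uncurry fun (_ : Euc d) (z : Euc d × ℝ) => f z * h z) :=
    (hf.comp measurable_snd).mul (hh.comp measurable_snd)
  calc unitVol d * ∫⁻ z, f z * h z ∂hsMeasure d 1
      = ∫⁻ x, ∫⁻ z in cone x, f z * h z ∂hsMeasure d (d + 1) := by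
        rw [lintegral_cone hΦ]
        congr 1
        refine lintegral_congr_ae ?_
        filter_upwards [ae_hsMeasure_pos 1] with z hz
        exact (ballAvg_const _ _ hz).symm
    _ ≤ _ := lintegral_mono fun x =>
        ENNReal.lintegral_mul_le_Lp_mul_Lq _ hqq hf.aemeasurable hh.aemeasurable

lemma lintegral_maxFun_rpow_one_div_le (hd : 0 < d) {s s' : ℝ} (hss : s.HolderConjugate s')
    {h : Euc d → ℝ≥0∞} (hm : Measurable h) :
    (∫⁻ x, maxFun h x ^ s) ^ (1 / s) ≤
      ENNReal.ofReal (2 * 5 ^ d * s') * (∫⁻ x, h x ^ s) ^ (1 / s) := by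
  have hs0 := hss.pos
  have hs'0 := hss.symm.pos
  refine (ENNReal.rpow_le_rpow (lintegral_maxFun_rpow_le hd hss.lt hm)
    (by positivity : 0 ≤ 1 / s)).trans ?_
  rw [ENNReal.mul_rpow_of_nonneg _ _ (by positivity)]
  gcongr
  rw [ENNReal.ofReal_rpow_of_nonneg (by have := hss.sub_one_pos; positivity) (by positivity)]
  refine ENNReal.ofReal_le_ofReal ?_
  have h1 : s / (s - 1) = s' := hss.conjugate_eq.symm
  have h5 : (1 : ℝ) ≤ 5 ^ d * s' := one_le_mul_of_one_le_of_one_le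
    (one_le_pow₀ (by norm_num)) hss.symm.lt.le
  rw [h1, mul_assoc, Real.mul_rpow (by positivity) (by positivity), ← Real.rpow_mul (by norm_num),
    mul_one_div_cancel hs0.ne', Real.rpow_one, mul_assoc]
  gcongr
  calc (5 ^ d * s') ^ (1 / s) ≤ (5 ^ d * s') ^ (1 : ℝ) :=
        Real.rpow_le_rpow_of_exponent_le h5 ((div_le_one hs0).2 hss.lt.le)
    _ = _ := Real.rpow_one _

/-- The range `p ≥ q`, with the growth `(p / q)^{1/q}` of the norm. -/
lemma TentConst.areaNorm_tentOp_le_of_le (hd : 0 < d) {b : ℝ} {C : ℝ≥0} (hC : TentConst d b C)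
    {p q : ℝ} (hq : 1 < q) (hpq : q ≤ p) {f : Euc d × ℝ → ℝ≥0∞} (hf : Measurable f) :
    areaNorm p q (tentOp b f) ≤
      C * ENNReal.ofReal (2 * 5 ^ d) * ENNReal.ofReal (p / q) ^ (1 / q) * areaNorm p q f := by
  have hq0 : 0 < q := by linarith
  have hp0 : 0 < p := by linarith
  have h25 : 1 ≤ ENNReal.ofReal (2 * 5 ^ d) := by
    rw [ENNReal.one_le_ofReal]
    have : (1 : ℝ) ≤ 5 ^ d := one_le_pow₀ (by norm_num)
    linarith
  -- the estimate for the power `q` of the norm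
  suffices key : (∫⁻ x, areaPow q (tentOp b f) x ^ (p / q)) ^ (1 / (p / q)) ≤
      (C : ℝ≥0∞) ^ q * (ENNReal.ofReal (2 * 5 ^ d) * ENNReal.ofReal (p / q)) *
        (∫⁻ x, areaPow q f x ^ (p / q)) ^ (1 / (p / q)) by
    have e : 1 / (p / q) * (1 / q) = 1 / p := by field_simp
    unfold areaNorm
    rw [← e, ENNReal.rpow_mul, ENNReal.rpow_mul]
    refine (ENNReal.rpow_le_rpow key (by positivity : 0 ≤ 1 / q)).trans ?_
    rw [ENNReal.mul_rpow_of_nonneg _ _ (by positivity),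
      ENNReal.mul_rpow_of_nonneg _ _ (by positivity),
      ENNReal.mul_rpow_of_nonneg _ _ (by positivity), rpow_one_div_rpow hq0, ← mul_assoc]
    gcongr
    exact (rpow_one_div_le_max _ hq.le).trans (max_le h25 le_rfl)
  rcases hpq.eq_or_lt with rfl | hlt
  · rw [div_self hq0.ne']
    simp only [ENNReal.rpow_one, div_one, ENNReal.ofReal_one, mul_one]
    have h1 := hC.lintegral_areaPow_tentOp_le hq hf (h := fun _ => 1) measurable_const
    simp only [mul_one] at h1
    refine h1.trans ?_
    rw [mul_assoc]
    gcongr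
    calc ∫⁻ x, areaPow q f x * maxFun (fun _ => 1) x ≤ ∫⁻ x, areaPow q f x := by
          refine lintegral_mono fun x => ?_
          exact mul_le_of_le_one_right' (maxFun_const_le 1 x)
      _ ≤ _ := le_mul_of_one_le_left' h25
  · have hr : 1 < p / q := (one_lt_div hq0).2 hlt
    have hrr := Real.HolderConjugate.conjExponent hr
    set r := p / q with hrdef
    set r' := r.conjExponent
    refine rpow_lintegral_le_of_forall_mul (measurable_areaPow (measurable_tentOp b hf)) hrr
      fun g hg => ?_
    calc ∫⁻ x, areaPow q (tentOp b f) x * g x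
        ≤ (C : ℝ≥0∞) ^ q * ∫⁻ x, areaPow q f x * maxFun g x :=
          hC.lintegral_areaPow_tentOp_le hq hf hg
      _ ≤ (C : ℝ≥0∞) ^ q * ((∫⁻ x, areaPow q f x ^ r) ^ (1 / r) *
            (∫⁻ x, maxFun g x ^ r') ^ (1 / r')) := by
          gcongr
          exact ENNReal.lintegral_mul_le_Lp_mul_Lq _ hrr (measurable_areaPow hf).aemeasurable
            (measurable_maxFun g).aemeasurable
      _ ≤ (C : ℝ≥0∞) ^ q * ((∫⁻ x, areaPow q f x ^ r) ^ (1 / r) *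
            (ENNReal.ofReal (2 * 5 ^ d * r) * (∫⁻ x, g x ^ r') ^ (1 / r'))) := by
          gcongr
          exact lintegral_maxFun_rpow_one_div_le hd hrr.symm hg
      _ = _ := by
          rw [ENNReal.ofReal_mul (by positivity)]; ring

lemma rpow_le_of_le_mul_rpow {N X : ℝ≥0∞} (hN : N ≠ ∞) {p p' : ℝ} (hpp : p.HolderConjugate p')
    (h : N ≤ X * N ^ (1 / p')) : N ^ (1 / p) ≤ X := by
  have hp0 := hpp.pos
  have hp'0 := hpp.symm.pos
  by_cases hN0 : N = 0
  · rw [hN0, ENNReal.zero_rpow_of_pos (by positivity)]; exact zero_le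
  have h2 : N ^ (1 / p) * N ^ (1 / p') = N := by
    rw [← ENNReal.rpow_add _ _ hN0 hN, one_div, one_div, hpp.inv_add_inv_eq_one, ENNReal.rpow_one]
  have h4 := h2.le.trans h
  rw [ENNReal.mul_le_mul_iff_left] at h4
  · exact h4
  · exact (ENNReal.rpow_pos (pos_iff_ne_zero.2 hN0) hN).ne'
  · exact ENNReal.rpow_ne_top_of_nonneg (by positivity) hN

lemma mul_rpow_le_rpow_add (a : ℝ≥0∞) {θ : ℝ} (hθ : θ < 0) : a * a ^ θ ≤ a ^ (1 + θ) := by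
  by_cases h0 : a = 0
  · simp [h0]
  by_cases hi : a = ∞
  · simp [hi, hθ]
  rw [ENNReal.rpow_add _ _ h0 hi, ENNReal.rpow_one]

/-- The test function used in the range `p < q`: the power `F^{q-1}`, weighted by the averages of
`a^θ` over shadows, where `a` is the area integral of `F`. -/
def dualTest (q θ : ℝ) (F : Euc d × ℝ → ℝ≥0∞) (z : Euc d × ℝ) : ℝ≥0∞ :=
  F z ^ (q - 1) * ballAvg (fun x => areaPow q F x ^ θ) z.1 z.2

lemma measurable_dualTest {q θ : ℝ} {F : Euc d × ℝ → ℝ≥0∞} (hF : Measurable F) :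
    Measurable (dualTest q θ F) :=
  (hF.pow_const _).mul (measurable_ballAvg ((measurable_areaPow hF).pow_const θ))

lemma dualTest_rpow_le {q q' θ : ℝ} (hqq : q.HolderConjugate q') {F : Euc d × ℝ → ℝ≥0∞}
    (hF : Measurable F) {z : Euc d × ℝ} (hz : 0 < z.2) :
    dualTest q θ F z ^ q' ≤
      F z ^ q * ballAvg (fun x => areaPow q F x ^ (θ * q')) z.1 z.2 := by
  rw [dualTest, ENNReal.mul_rpow_of_nonneg _ _ hqq.symm.pos.le, ← ENNReal.rpow_mul,
    hqq.sub_one_mul_conj]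
  gcongr
  simp_rw [ENNReal.rpow_mul]
  exact ballAvg_rpow_le hqq.symm.lt ((measurable_areaPow hF).pow_const θ) _ hz

/-- The `p`-th power of the tent space norm of `F` is at most a pairing of `F` with `dualTest`.
Finiteness matters if `p < q`: where the area integral `a` is infinite, `a * a ^ (p / q - 1)` is `0`. -/
lemma lintegral_areaPow_rpow_le {p q : ℝ} (hp : 0 < p) (hq : 1 < q)
    {F : Euc d × ℝ → ℝ≥0∞} (hF : Measurable F) (hfin : ∫⁻ x, areaPow q F x ^ (p / q) ≠ ∞) :
    ∫⁻ x, areaPow q F x ^ (p / q) ≤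
      unitVol d * ∫⁻ z, F z * dualTest q (p / q - 1) F z ∂hsMeasure d 1 := by
  have hq0 : 0 < q := by linarith
  have ham := measurable_areaPow (q := q) hF
  calc ∫⁻ x, areaPow q F x ^ (p / q)
      ≤ ∫⁻ x, areaPow q F x * areaPow q F x ^ (p / q - 1) := by
        refine lintegral_mono_ae ?_
        filter_upwards [ae_lt_top (ham.pow_const _) hfin] with x hx
        by_cases h0 : areaPow q F x = 0
        · rw [h0, ENNReal.zero_rpow_of_pos (by positivity)]; exact zero_le
        have hi : areaPow q F x ≠ ∞ := by
          rintro hi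
          rw [hi, ENNReal.top_rpow_of_pos (by positivity)] at hx
          exact lt_irrefl _ hx
        nth_rewrite 2 [← ENNReal.rpow_one (areaPow q F x)]
        rw [← ENNReal.rpow_add _ _ h0 hi, add_sub_cancel]
    _ = unitVol d * ∫⁻ z, F z ^ q * ballAvg (fun x => areaPow q F x ^ (p / q - 1)) z.1 z.2
          ∂hsMeasure d 1 := lintegral_areaPow_mul hF (ham.pow_const _)
    _ = _ := by
        congr 1
        refine lintegral_congr fun z => ?_
        rw [dualTest, ← mul_assoc]
        congr 1
        nth_rewrite 2 [← ENNReal.rpow_one (F z)]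
        rw [← ENNReal.rpow_add_of_nonneg _ _ (by norm_num) (by linarith), add_sub_cancel]

/-- The test function in the dual tent space. -/
lemma lintegral_areaPow_dualTest_mul_le {q q' θ : ℝ} (hqq : q.HolderConjugate q') (hθ : θ < 0)
    {F : Euc d × ℝ → ℝ≥0∞} (hF : Measurable F) {H : Euc d → ℝ≥0∞} (hH : Measurable H) :
    ∫⁻ x, areaPow q' (dualTest q θ F) x * H x ≤
      ∫⁻ x, areaPow q F x ^ (1 + θ * q') * maxFun H x := by
  have ham := measurable_areaPow (q := q) hF
  have hq'0 := hqq.symm.pos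
  calc ∫⁻ x, areaPow q' (dualTest q θ F) x * H x
      = unitVol d * ∫⁻ z, dualTest q θ F z ^ q' * ballAvg H z.1 z.2 ∂hsMeasure d 1 :=
        lintegral_areaPow_mul (measurable_dualTest hF) hH
    _ ≤ unitVol d * ∫⁻ z, F z ^ q *
          ballAvg (fun x => areaPow q F x ^ (θ * q') * maxFun H x) z.1 z.2 ∂hsMeasure d 1 := by
        refine mul_le_mul_right (lintegral_mono_ae ?_) _
        filter_upwards [ae_hsMeasure_pos 1] with z hz
        refine (mul_le_mul_left (dualTest_rpow_le hqq hF hz) _).trans ?_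
        rw [mul_assoc]
        gcongr
        unfold ballAvg
        rw [mul_assoc, ← lintegral_mul_const _ (ham.pow_const _)]
        refine mul_le_mul_right (setLIntegral_mono' measurableSet_ball fun x hx => ?_) _
        gcongr
        exact ballAvg_le_maxFun H hz hx
    _ = ∫⁻ x, areaPow q F x * (areaPow q F x ^ (θ * q') * maxFun H x) :=
        (lintegral_areaPow_mul hF ((ham.pow_const _).mul (measurable_maxFun H))).symm
    _ ≤ _ := by
        refine lintegral_mono fun x => ?_
        rw [← mul_assoc]
        exact mul_le_mul_left (mul_rpow_le_rpow_add _ (mul_neg_of_neg_of_pos hθ hq'0)) _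

/-- The Carleson functional of the test function. -/
lemma carlFun_dualTest_le {q q' θ : ℝ} (hqq : q.HolderConjugate q') (hθ : θ < 0)
    {F : Euc d × ℝ → ℝ≥0∞} (hF : Measurable F) (x : Euc d) :
    carlFun q' (dualTest q θ F) x ≤
      ((unitVol d)⁻¹ * maxFun (fun x => areaPow q F x ^ (1 + θ * q')) x) ^ (1 / q') := by
  have ham := measurable_areaPow (q := q) hF
  have hq'0 := hqq.symm.pos
  refine carlFun_le hq'0 _ fun a r hr hx => ?_
  rw [rpow_rpow_one_div hq'0]
  set B := Metric.ball a r with hB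
  calc ∫⁻ z in tent B, dualTest q θ F z ^ q' ∂hsMeasure d 1
      ≤ ∫⁻ z, F z ^ q * ballAvg (B.indicator fun x => areaPow q F x ^ (θ * q')) z.1 z.2
          ∂hsMeasure d 1 := by
        rw [← lintegral_indicator (measurableSet_tent _)]
        refine lintegral_mono fun z => ?_
        by_cases hz : z ∈ tent B
        · rw [indicator_of_mem hz]
          refine (dualTest_rpow_le hqq hF hz.1).trans ?_
          gcongr
          unfold ballAvg
          refine mul_le_mul_right (setLIntegral_mono' measurableSet_ball fun u hu => ?_) _
          rw [indicator_of_mem ((mem_tent_iff.1 hz).2 hu)]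
        · rw [indicator_of_notMem hz]; exact zero_le
    _ = (unitVol d)⁻¹ * ∫⁻ x, areaPow q F x * B.indicator (fun x => areaPow q F x ^ (θ * q')) x := by
        rw [lintegral_areaPow_mul hF ((ham.pow_const _).indicator measurableSet_ball), ← mul_assoc,
          ENNReal.inv_mul_cancel unitVol_ne_zero unitVol_ne_top, one_mul]
    _ ≤ (unitVol d)⁻¹ * ∫⁻ x in B, areaPow q F x ^ (1 + θ * q') := by
        rw [← lintegral_indicator measurableSet_ball]
        refine mul_le_mul_right (lintegral_mono fun x => ?_) _
        by_cases hx : x ∈ B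
        · rw [indicator_of_mem hx, indicator_of_mem hx]
          exact mul_rpow_le_rpow_add _ (mul_neg_of_neg_of_pos hθ hq'0)
        · simp [hx]
    _ ≤ _ := by
        rw [lintegral_ball_eq _ _ hr, mul_left_comm]
        gcongr
        exact ballAvg_le_maxFun _ hr hx

end

end TentHardy

namespace TentHardy

noncomputable section

open scoped NNReal

variable {d : ℕ}

lemma lintegral_mul_tentOp_ge {p q : ℝ} (hp : 0 < p) (hq : 1 < q) (b : ℝ)
    {f F : Euc d × ℝ → ℝ≥0∞} (hf : Measurable f) (hF : Measurable F)
    (hle : ∀ z, F z ≤ tentOp b f z) (hfin : ∫⁻ x, areaPow q F x ^ (p / q) ≠ ∞) :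
    ∫⁻ x, areaPow q F x ^ (p / q) ≤
      unitVol d * ∫⁻ z, f z * tentOp b (dualTest q (p / q - 1) F) z ∂hsMeasure d 1 := by
  rw [← lintegral_tentOp_mul b hf (measurable_dualTest hF)]
  refine (lintegral_areaPow_rpow_le hp hq hF hfin).trans ?_
  gcongr
  exact hle _

lemma one_add_mul_conj {p q p' q' : ℝ} (hp : p.HolderConjugate p') (hq : q.HolderConjugate q') :
    (1 + (p / q - 1) * q') * (p' / q') = p / q := by
  have h1 := hq.pos
  have h2 := hq.symm.pos
  have h3 := hp.sub_one_mul_conj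
  have h4 := hq.sub_one_mul_conj
  field_simp
  linear_combination q' * h3 - p' * h4

/-- The range `p < q` when the conjugate exponents are comparable: duality with the range
`p' ≥ q'`. -/
lemma TentConst.areaNorm_le_of_comparable (hd : 0 < d) {b : ℝ} {C : ℝ≥0} (hC : TentConst d b C)
    {p q p' q' : ℝ} (hp : p.HolderConjugate p') (hq : q.HolderConjugate q') (hpq : p < q)
    (hr2 : p' / q' ≤ 2) {f F : Euc d × ℝ → ℝ≥0∞} (hf : Measurable f) (hF : Measurable F)
    (hle : ∀ z, F z ≤ tentOp b f z) (hfin : ∫⁻ x, areaPow q F x ^ (p / q) ≠ ∞) :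
    areaNorm p q F ≤
      C * ENNReal.ofReal (2 * 5 ^ d) * 2 * ENNReal.ofReal (4 * 5 ^ d) * areaNorm p q f := by
  have hp0 := hp.pos
  have hp'0 := hp.symm.pos
  have hq0 := hq.pos
  have hq'0 := hq.symm.pos
  have hpq' : q' < p' := by
    have h1 := hp.inv_add_inv_eq_one
    have h2 := hq.inv_add_inv_eq_one
    have h3 : q⁻¹ < p⁻¹ := (inv_lt_inv₀ hq0 hp0).2 hpq
    exact (inv_lt_inv₀ hp'0 hq'0).1 (by linarith)
  set θ := p / q - 1 with hθdef
  have hθ : θ < 0 := by rw [hθdef, sub_neg]; exact (div_lt_one hq0).2 hpq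
  set N := ∫⁻ x, areaPow q F x ^ (p / q) with hN
  set g := dualTest q θ F with hg
  have hgm : Measurable g := measurable_dualTest hF
  have ham := measurable_areaPow (q := q) hF
  have hr : 1 < p' / q' := (one_lt_div hq'0).2 hpq'
  have hrr := Real.HolderConjugate.conjExponent hr
  have hσ : (1 + θ * q') * (p' / q') = p / q := one_add_mul_conj hp hq
  set r := p' / q' with hrdef
  set r' := r.conjExponent
  -- the norm of the test function in the dual tent space, by duality and the maximal theorem
  have hgnorm : areaNorm p' q' g ≤ ENNReal.ofReal (4 * 5 ^ d) * N ^ (1 / p') := by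
    have h1 : (∫⁻ x, areaPow q' g x ^ r) ^ (1 / r) ≤ N ^ (1 / r) * ENNReal.ofReal (4 * 5 ^ d) := by
      refine rpow_lintegral_le_of_forall_mul (measurable_areaPow hgm) hrr fun H hH => ?_
      calc ∫⁻ x, areaPow q' g x * H x
          ≤ ∫⁻ x, areaPow q F x ^ (1 + θ * q') * maxFun H x :=
            lintegral_areaPow_dualTest_mul_le hq hθ hF hH
        _ ≤ (∫⁻ x, (areaPow q F x ^ (1 + θ * q')) ^ r) ^ (1 / r) *
              (∫⁻ x, maxFun H x ^ r') ^ (1 / r') :=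
            ENNReal.lintegral_mul_le_Lp_mul_Lq _ hrr (ham.pow_const _).aemeasurable
              (measurable_maxFun H).aemeasurable
        _ ≤ N ^ (1 / r) * (ENNReal.ofReal (4 * 5 ^ d) * (∫⁻ x, H x ^ r') ^ (1 / r')) := by
            simp_rw [← ENNReal.rpow_mul, hσ]
            gcongr
            refine (lintegral_maxFun_rpow_one_div_le hd hrr.symm hH).trans ?_
            gcongr ENNReal.ofReal ?_ * _
            have : (0 : ℝ) < 5 ^ d := by positivity
            nlinarith
        _ = _ := by ring
    have e : 1 / r * (1 / q') = 1 / p' := by rw [hrdef]; field_simp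
    have h45 : 1 ≤ ENNReal.ofReal (4 * 5 ^ d) := by
      rw [ENNReal.one_le_ofReal]
      have : (1 : ℝ) ≤ 5 ^ d := one_le_pow₀ (by norm_num)
      linarith
    unfold areaNorm
    rw [← e, ENNReal.rpow_mul, ENNReal.rpow_mul N]
    refine (ENNReal.rpow_le_rpow h1 (by positivity : 0 ≤ 1 / q')).trans ?_
    rw [ENNReal.mul_rpow_of_nonneg _ _ (by positivity), mul_comm]
    gcongr
    exact (rpow_one_div_le_max _ hq.symm.lt.le).trans (max_le h45 le_rfl)
  refine rpow_le_of_le_mul_rpow hfin hp ?_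
  calc N ≤ unitVol d * ∫⁻ z, f z * tentOp b g z ∂hsMeasure d 1 :=
        lintegral_mul_tentOp_ge hp0 hq.lt b hf hF hle hfin
    _ ≤ ∫⁻ x, areaPow q f x ^ (1 / q) * areaPow q' (tentOp b g) x ^ (1 / q') :=
        unitVol_mul_lintegral_mul_le hq hf (measurable_tentOp b hgm)
    _ ≤ areaNorm p q f * areaNorm p' q' (tentOp b g) := by
        refine (ENNReal.lintegral_mul_le_Lp_mul_Lq _ hp
          ((measurable_areaPow hf).pow_const _).aemeasurable
          ((measurable_areaPow (measurable_tentOp b hgm)).pow_const _).aemeasurable).trans ?_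
        simp_rw [← ENNReal.rpow_mul, one_div_mul_eq_div]
        exact le_rfl
    _ ≤ areaNorm p q f * (C * ENNReal.ofReal (2 * 5 ^ d) * 2 *
          (ENNReal.ofReal (4 * 5 ^ d) * N ^ (1 / p'))) := by
        gcongr
        refine (hC.areaNorm_tentOp_le_of_le hd hq.symm.lt hpq'.le hgm).trans ?_
        gcongr
        refine (rpow_one_div_le_max _ hq.symm.lt.le).trans (max_le (by norm_num) ?_)
        exact ENNReal.ofReal_le_of_le_toReal (by simpa using hr2)
    _ = _ := by ring

/-- The range `p < q` when the conjugate exponents are far apart, including `p = 1`: duality with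
the Carleson functional. -/
lemma areaNorm_le_of_carleson (hd : 0 < d) {b : ℝ} {D₁ D₂ : ℝ≥0}
    (hD₁ : ∀ (q q' : ℝ) (f h : Euc d × ℝ → ℝ≥0∞), q.HolderConjugate q' →
      Measurable f → Measurable h →
      ∫⁻ z, f z * h z ∂hsMeasure d 1 ≤
        D₁ * ∫⁻ x, areaPow q f x ^ (1 / q) * carlFun q' h x)
    (hD₂ : ∀ (q : ℝ) (f : Euc d × ℝ → ℝ≥0∞) (x : Euc d), 1 < q → Measurable f →
      carlFun q (tentOp b f) x ≤ D₂ * carlFun q f x)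
    {p q q' : ℝ} (hp : 1 ≤ p) (hq : q.HolderConjugate q') (hpq : p < q)
    (hr2 : ∀ p', p.HolderConjugate p' → 2 ≤ p' / q')
    {f F : Euc d × ℝ → ℝ≥0∞} (hf : Measurable f) (hF : Measurable F)
    (hle : ∀ z, F z ≤ tentOp b f z) (hfin : ∫⁻ x, areaPow q F x ^ (p / q) ≠ ∞) :
    areaNorm p q F ≤ unitVol d * D₁ * D₂ * max 1 (unitVol d)⁻¹ * ENNReal.ofReal (4 * 5 ^ d) *
      areaNorm p q f := by
  have hp0 : 0 < p := by linarith
  have hq0 := hq.pos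
  have hq'0 := hq.symm.pos
  set θ := p / q - 1 with hθdef
  have hθ : θ < 0 := by rw [hθdef, sub_neg]; exact (div_lt_one hq0).2 hpq
  set N := ∫⁻ x, areaPow q F x ^ (p / q) with hN
  set g := dualTest q θ F with hg
  have hgm : Measurable g := measurable_dualTest hF
  have ham := measurable_areaPow (q := q) hF
  set m := maxFun (fun x => areaPow q F x ^ (1 + θ * q')) with hm
  have hmm : Measurable m := measurable_maxFun _
  have h45 : 1 ≤ ENNReal.ofReal (4 * 5 ^ d) := by
    rw [ENNReal.one_le_ofReal]
    have : (1 : ℝ) ≤ 5 ^ d := one_le_pow₀ (by norm_num)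
    linarith
  -- the Carleson functional of the test function is dominated by a maximal function
  have hmain : N ≤ unitVol d * D₁ * D₂ * max 1 (unitVol d)⁻¹ *
      ∫⁻ x, areaPow q f x ^ (1 / q) * m x ^ (1 / q') := by
    calc N ≤ unitVol d * ∫⁻ z, f z * tentOp b g z ∂hsMeasure d 1 :=
          lintegral_mul_tentOp_ge hp0 hq.lt b hf hF hle hfin
      _ ≤ unitVol d * (D₁ * ∫⁻ x, areaPow q f x ^ (1 / q) * carlFun q' (tentOp b g) x) := by
          gcongr
          exact hD₁ q q' f _ hq hf (measurable_tentOp b hgm)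
      _ ≤ unitVol d * (D₁ * ∫⁻ x, D₂ * max 1 (unitVol d)⁻¹ *
            (areaPow q f x ^ (1 / q) * m x ^ (1 / q'))) := by
          refine mul_le_mul_right (mul_le_mul_right (lintegral_mono fun x => ?_) _) _
          calc areaPow q f x ^ (1 / q) * carlFun q' (tentOp b g) x
              ≤ areaPow q f x ^ (1 / q) *
                  (D₂ * (max 1 (unitVol d)⁻¹ * m x ^ (1 / q'))) := by
                gcongr
                refine (hD₂ q' g x hq.symm.lt hgm).trans ?_
                gcongr
                refine (carlFun_dualTest_le hq hθ hF x).trans ?_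
                rw [ENNReal.mul_rpow_of_nonneg _ _ (by positivity)]
                gcongr
                exact rpow_one_div_le_max _ hq.symm.lt.le
            _ = _ := by ring
      _ = _ := by
          rw [lintegral_const_mul' _ _ (ENNReal.mul_ne_top (by simp)
            (by simp [unitVol_ne_zero]))]
          ring
  rcases hp.eq_or_lt with rfl | hp1
  -- for `p = 1` the exponent `1 + θ q'` is zero, and the maximal function is bounded by `1`
  · have hσ : 1 + θ * q' = 0 := by
      have h4 := hq.sub_one_mul_conj
      rw [hθdef]
      field_simp
      linarith
    have hm1 : ∀ x, m x ≤ 1 := by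
      intro x
      simp only [hm, hσ, ENNReal.rpow_zero]
      exact maxFun_const_le 1 x
    unfold areaNorm
    rw [div_one, ENNReal.rpow_one, ENNReal.rpow_one]
    refine hmain.trans ?_
    rw [mul_assoc _ (ENNReal.ofReal _)]
    gcongr
    calc ∫⁻ x, areaPow q f x ^ (1 / q) * m x ^ (1 / q') ≤ ∫⁻ x, areaPow q f x ^ (1 / q) := by
          refine lintegral_mono fun x => mul_le_of_le_one_right' ?_
          exact ENNReal.rpow_le_one (hm1 x) (by positivity)
      _ ≤ _ := le_mul_of_one_le_left' h45
  · have hpp := Real.HolderConjugate.conjExponent hp1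
    set p' := p.conjExponent
    have hr2 := hr2 p' hpp
    have hp'0 := hpp.symm.pos
    have hσ : (1 + θ * q') * (p' / q') = p / q := one_add_mul_conj hpp hq
    have hr : 1 < p' / q' := by linarith
    have hrr := Real.HolderConjugate.conjExponent hr
    have e : 1 / (p' / q') * (1 / q') = 1 / p' := by field_simp
    set r := p' / q' with hrdef
    set r' := r.conjExponent with hr'
    have hr'2 : r' ≤ 2 := by
      rw [hr', Real.conjExponent, div_le_iff₀ (by linarith)]; linarith
    have hmn : (∫⁻ x, (m x ^ (1 / q')) ^ p') ^ (1 / p') ≤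
        ENNReal.ofReal (4 * 5 ^ d) * N ^ (1 / p') := by
      simp_rw [← ENNReal.rpow_mul, one_div_mul_eq_div]
      rw [← hrdef, ← e, ENNReal.rpow_mul, ENNReal.rpow_mul N]
      refine (ENNReal.rpow_le_rpow (lintegral_maxFun_rpow_one_div_le hd hrr (ham.pow_const _))
        (by positivity : 0 ≤ 1 / q')).trans ?_
      rw [ENNReal.mul_rpow_of_nonneg _ _ (by positivity)]
      simp_rw [← ENNReal.rpow_mul (areaPow q F _), hσ]
      gcongr
      refine (rpow_one_div_le_max _ hq.symm.lt.le).trans (max_le h45 ?_)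
      refine ENNReal.ofReal_le_ofReal ?_
      have : (0 : ℝ) < 5 ^ d := by positivity
      nlinarith
    refine rpow_le_of_le_mul_rpow hfin hpp ?_
    calc N ≤ _ := hmain
      _ ≤ unitVol d * D₁ * D₂ * max 1 (unitVol d)⁻¹ *
            (areaNorm p q f * (ENNReal.ofReal (4 * 5 ^ d) * N ^ (1 / p'))) := by
          gcongr
          refine (ENNReal.lintegral_mul_le_Lp_mul_Lq _ hpp
            ((measurable_areaPow hf).pow_const _).aemeasurable
            (hmm.pow_const _).aemeasurable).trans ?_
          gcongr
          simp_rw [← ENNReal.rpow_mul, one_div_mul_eq_div]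
          exact le_rfl
      _ = _ := by ring

lemma hsMeasure_prod_lt_top (k : ℕ) {B : Set (Euc d)} (hBm : MeasurableSet B)
    (hB : volume B ≠ ∞) {s t : ℝ} (hs : 0 < s) : hsMeasure d k (B ×ˢ Icc s t) < ∞ := by
  have hm : MeasurableSet (B ×ˢ Icc s t) := hBm.prod measurableSet_Icc
  calc hsMeasure d k (B ×ˢ Icc s t)
      = ∫⁻ z in B ×ˢ Icc s t, ENNReal.ofReal ((z.2 ^ k)⁻¹) ∂volume.restrict (halfSpace d) :=
        withDensity_apply _ hm
    _ ≤ ∫⁻ _ in B ×ˢ Icc s t, ENNReal.ofReal ((s ^ k)⁻¹) ∂volume.restrict (halfSpace d) := by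
        refine setLIntegral_mono' hm fun z hz => ENNReal.ofReal_le_ofReal ?_
        have hz : s ≤ z.2 := hz.2.1
        exact inv_anti₀ (by positivity) (by gcongr)
    _ ≤ ENNReal.ofReal ((s ^ k)⁻¹) * volume (B ×ˢ Icc s t) := by
        rw [setLIntegral_const]
        gcongr
        exact Measure.restrict_le_self
    _ < ∞ := by
        rw [Measure.volume_eq_prod, Measure.prod_prod]
        exact ENNReal.mul_lt_top ENNReal.ofReal_lt_top
          (ENNReal.mul_lt_top hB.lt_top measure_Icc_lt_top)

/-- On functions supported in a box of the half-space the area norm is controlled by an `L^q`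
norm. -/
lemma lintegral_areaPow_rpow_le_of_box {p q : ℝ} (hp : 0 < p) (hq : 0 < q)
    {F : Euc d × ℝ → ℝ≥0∞} {R s t : ℝ}
    (hsupp : ∀ z, z ∉ Metric.ball (0 : Euc d) R ×ˢ Icc s t → F z = 0) :
    ∫⁻ x, areaPow q F x ^ (p / q) ≤ (∫⁻ z, F z ^ q ∂hsMeasure d (d + 1)) ^ (p / q) *
      volume (Metric.ball (0 : Euc d) (R + t)) := by
  have hzero : ∀ x, x ∉ Metric.ball (0 : Euc d) (R + t) → areaPow q F x = 0 := by
    intro x hx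
    refine le_antisymm ?_ zero_le
    rw [areaPow]
    calc ∫⁻ z in cone x, F z ^ q ∂hsMeasure d (d + 1)
        ≤ ∫⁻ z in cone x, 0 ∂hsMeasure d (d + 1) := by
          refine setLIntegral_mono' (measurableSet_cone x) fun z hz => ?_
          rw [hsupp z, ENNReal.zero_rpow_of_pos hq]
          rintro ⟨h1, h2⟩
          refine hx ?_
          have h3 := mem_cone_iff.1 hz
          rw [Metric.mem_ball] at h1 h3 ⊢
          have := dist_triangle x z.1 0
          linarith [h2.2]
      _ = 0 := by simp
  rw [← setLIntegral_const, ← lintegral_indicator measurableSet_ball]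
  refine lintegral_mono fun x => ?_
  by_cases hx : x ∈ Metric.ball (0 : Euc d) (R + t)
  · rw [indicator_of_mem hx]
    exact ENNReal.rpow_le_rpow (setLIntegral_le_lintegral _ _) (by positivity)
  · rw [indicator_of_notMem hx, hzero x hx, ENNReal.zero_rpow_of_pos (by positivity)]

lemma lintegral_areaPow_ne_top {p q : ℝ} (hp : 0 < p) (hq : 0 < q) {F : Euc d × ℝ → ℝ≥0∞}
    {R s t : ℝ}
    (hsupp : ∀ z, z ∉ Metric.ball (0 : Euc d) R ×ˢ Icc s t → F z = 0)
    (hint : ∫⁻ z, F z ^ q ∂hsMeasure d (d + 1) ≠ ∞) :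
    ∫⁻ x, areaPow q F x ^ (p / q) ≠ ∞ :=
  ne_top_of_le_ne_top (ENNReal.mul_ne_top
    (ENNReal.rpow_ne_top_of_nonneg (by positivity) hint) (volume_ball_ne_top _ _))
    (lintegral_areaPow_rpow_le_of_box hp hq hsupp)

/-- It is enough to bound the area norm of the functions below `G` whose norm is finite. -/
lemma areaNorm_le_of_forall_le {p q : ℝ} (hp : 0 < p) (hq : 0 < q) {G : Euc d × ℝ → ℝ≥0∞}
    (hG : Measurable G) {X : ℝ≥0∞}
    (h : ∀ F : Euc d × ℝ → ℝ≥0∞, Measurable F → (∀ z, F z ≤ G z) →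
      ∫⁻ x, areaPow q F x ^ (p / q) ≠ ∞ → areaNorm p q F ≤ X) : areaNorm p q G ≤ X := by
  -- truncation to boxes that exhaust the half-space, and monotone convergence
  let S : ℕ → Set (Euc d × ℝ) := fun n => Metric.ball (0 : Euc d) n ×ˢ Icc ((n : ℝ) + 1)⁻¹ n
  have hSm : ∀ n, MeasurableSet (S n) := fun n => measurableSet_ball.prod measurableSet_Icc
  have hSmono : Monotone S := by
    intro m n hmn
    have hc : (m : ℝ) ≤ n := by exact_mod_cast hmn
    exact prod_mono (Metric.ball_subset_ball hc) (Icc_subset_Icc (by gcongr) hc)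
  let F : ℕ → Euc d × ℝ → ℝ≥0∞ := fun n => (S n).indicator fun z => min (G z) n
  have hF : ∀ n, Measurable (F n) := fun n => (hG.min measurable_const).indicator (hSm n)
  have hFG : ∀ n z, F n z ≤ G z := fun n z =>
    (indicator_le_self' (fun _ _ => zero_le) z).trans (min_le_left _ _)
  have hFmono : Monotone F := by
    intro m n hmn z
    have hc : (m : ℝ≥0∞) ≤ n := by exact_mod_cast hmn
    simp only [F]
    by_cases hz : z ∈ S m
    · rw [indicator_of_mem hz, indicator_of_mem (hSmono hmn hz)]
      exact min_le_min le_rfl hc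
    · rw [indicator_of_notMem hz]; exact zero_le
  have hFfin : ∀ n, ∫⁻ x, areaPow q (F n) x ^ (p / q) ≠ ∞ := by
    intro n
    refine lintegral_areaPow_ne_top hp hq (R := n) (s := ((n : ℝ) + 1)⁻¹) (t := n)
      (fun z hz => indicator_of_notMem hz _) ?_
    refine ne_top_of_le_ne_top (b := (n : ℝ≥0∞) ^ q * hsMeasure d (d + 1) (S n))
      (ENNReal.mul_ne_top (ENNReal.rpow_ne_top_of_nonneg hq.le (by simp))
        (hsMeasure_prod_lt_top _ measurableSet_ball (volume_ball_ne_top _ _) (by positivity)).ne) ?_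
    rw [← setLIntegral_const, ← lintegral_indicator (hSm n)]
    refine lintegral_mono fun z => ?_
    simp only [F]
    by_cases hz : z ∈ S n
    · rw [indicator_of_mem hz, indicator_of_mem hz]
      exact ENNReal.rpow_le_rpow (min_le_right _ _) hq.le
    · rw [indicator_of_notMem hz, indicator_of_notMem hz, ENNReal.zero_rpow_of_pos hq]
  have hsup : ∀ z : Euc d × ℝ, 0 < z.2 → ⨆ n, F n z = G z := by
    intro z hz
    refine le_antisymm (iSup_le fun n => hFG n z) (le_of_forall_lt fun c hc => ?_)
    obtain ⟨n, hn⟩ := exists_nat_gt (max ‖z.1‖ (max z.2 z.2⁻¹))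
    obtain ⟨m, hm⟩ := ENNReal.exists_nat_gt (ne_top_of_lt hc)
    refine lt_of_lt_of_le ?_ (le_iSup (fun n => F n z) (max n m))
    have hz' : z ∈ S n := by
      obtain ⟨h1, h2⟩ := max_lt_iff.1 hn
      obtain ⟨h2, h3⟩ := max_lt_iff.1 h2
      refine ⟨by simpa using h1, ?_, h2.le⟩
      rw [inv_le_comm₀ (by positivity) hz]
      linarith
    simp only [F, indicator_of_mem (hSmono (le_max_left n m) hz')]
    exact lt_min hc (hm.trans_le (by exact_mod_cast le_max_right n m))
  have hpow : ∀ r : ℝ, 0 < r → ∀ a : ℕ → ℝ≥0∞, (⨆ n, a n) ^ r = ⨆ n, a n ^ r := by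
    intro r hr a
    exact (ENNReal.monotone_rpow_of_nonneg hr.le).map_iSup_of_continuousAt
      ENNReal.continuous_rpow_const.continuousAt (by simp [hr])
  have harea : ∀ x, areaPow q G x = ⨆ n, areaPow q (F n) x := by
    intro x
    simp only [areaPow]
    rw [← lintegral_iSup (fun n => (hF n).pow_const q)
      (fun m n hmn z => ENNReal.rpow_le_rpow (hFmono hmn z) hq.le)]
    refine lintegral_congr_ae ?_
    filter_upwards [ae_restrict_of_ae (ae_hsMeasure_pos (d + 1))] with z hz
    rw [← hsup z hz, hpow q hq]
  have hareamono : ∀ m n, m ≤ n → ∀ x, areaPow q (F m) x ≤ areaPow q (F n) x := fun m n hmn x =>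
    lintegral_mono fun z => ENNReal.rpow_le_rpow (hFmono hmn z) hq.le
  have hfinal : areaNorm p q G = ⨆ n, areaNorm p q (F n) := by
    unfold areaNorm
    rw [← hpow _ (by positivity)]
    congr 1
    rw [← lintegral_iSup (fun n => (measurable_areaPow (hF n)).pow_const _)
      (fun m n hmn x => ENNReal.rpow_le_rpow (hareamono m n hmn x) (by positivity))]
    refine lintegral_congr fun x => ?_
    rw [harea, hpow _ (by positivity)]
  rw [hfinal]
  exact iSup_le fun n => h (F n) (hF n) (hFG n) (hFfin n)

/-- The positive operator is bounded on all tent spaces, with the optimal growth of the norm. -/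
theorem exists_areaNorm_tentOp_le (hd : 0 < d) {b : ℝ} (hb : 0 < b) (hb1 : b ≤ 1 / 2) :
    ∃ D : ℝ≥0, 1 ≤ D ∧ ∀ (p q : ℝ) (f : Euc d × ℝ → ℝ≥0∞), 1 ≤ p → 1 < q → Measurable f →
      areaNorm p q (tentOp b f) ≤ D * ENNReal.ofReal p ^ (1 / q) * areaNorm p q f := by
  obtain ⟨C, hC⟩ := exists_tentConst d hb
  obtain ⟨D₁, hD₁⟩ := exists_lintegral_mul_le_area_mul_carl d
  obtain ⟨D₂, -, hD₂⟩ := exists_carlFun_tentOp_le hd hb hb1 hC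
  let K₁ : ℝ≥0∞ := C * ENNReal.ofReal (2 * 5 ^ d)
  let K₂ : ℝ≥0∞ := C * ENNReal.ofReal (2 * 5 ^ d) * 2 * ENNReal.ofReal (4 * 5 ^ d)
  let K₃ : ℝ≥0∞ := unitVol d * D₁ * D₂ * max 1 (unitVol d)⁻¹ * ENNReal.ofReal (4 * 5 ^ d)
  have hK₁ : K₁ ≠ ∞ := ENNReal.mul_ne_top (by simp) ENNReal.ofReal_ne_top
  have hK₂ : K₂ ≠ ∞ := ENNReal.mul_ne_top (ENNReal.mul_ne_top hK₁ (by simp)) ENNReal.ofReal_ne_top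
  have hK₃ : K₃ ≠ ∞ := ENNReal.mul_ne_top (ENNReal.mul_ne_top (ENNReal.mul_ne_top
    (ENNReal.mul_ne_top unitVol_ne_top (by simp)) (by simp)) (by simp [unitVol_ne_zero]))
    ENNReal.ofReal_ne_top
  have hK : K₁ + K₂ + K₃ ≠ ∞ := by simp [hK₁, hK₂, hK₃]
  refine ⟨max 1 (K₁ + K₂ + K₃).toNNReal, le_max_left _ _, fun p q f hp hq hf => ?_⟩
  have hKD : K₁ + K₂ + K₃ ≤ (max 1 (K₁ + K₂ + K₃).toNNReal : ℝ≥0) := by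
    conv_lhs => rw [← ENNReal.coe_toNNReal hK]
    exact_mod_cast le_max_right _ _
  have hp0 : 0 < p := by linarith
  have hq0 : 0 < q := by linarith
  by_cases hpq : q ≤ p
  · refine (hC.areaNorm_tentOp_le_of_le hd hq hpq hf).trans ?_
    gcongr ?_ * ENNReal.ofReal ?_ ^ _ * _
    · exact le_trans (le_trans le_self_add le_self_add) hKD
    · exact div_le_self hp0.le hq.le
  push Not at hpq
  have hqq := Real.HolderConjugate.conjExponent hq
  set q' := q.conjExponent
  have hp1 : 1 ≤ ENNReal.ofReal p ^ (1 / q) :=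
    ENNReal.one_le_rpow (by simpa using hp) (by positivity)
  refine areaNorm_le_of_forall_le hp0 hq0 (measurable_tentOp b hf) fun F hF hle hfin => ?_
  have hweak : areaNorm p q F ≤ (K₁ + K₂ + K₃) * areaNorm p q f := by
    -- the dichotomy keeps the maximal theorem away from the exponent `1`: it is applied to
    -- `p' / q'` or to its conjugate, whichever is at least `2`
    by_cases hr : ∀ p', p.HolderConjugate p' → 2 ≤ p' / q'
    · refine (areaNorm_le_of_carleson hd hD₁ hD₂ hp hqq hpq hr hf hF hle hfin).trans ?_
      gcongr
      exact le_add_self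
    · push Not at hr
      obtain ⟨p', hpp, hr⟩ := hr
      refine (hC.areaNorm_le_of_comparable hd hpp hqq hpq hr.le hf hF hle hfin).trans ?_
      gcongr
      exact le_add_self.trans le_self_add
  refine hweak.trans ?_
  gcongr
  calc K₁ + K₂ + K₃ ≤ _ := hKD
    _ = (max 1 (K₁ + K₂ + K₃).toNNReal : ℝ≥0) * 1 := (mul_one _).symm
    _ ≤ _ := by gcongr

end

end TentHardy

namespace TentHardy

noncomputable section

/-! ### Differentiability of a bounded semigroup with sectorial generator -/

section Semigroup

variable {E : Type*} [NormedAddCommGroup E] [NormedSpace ℂ E]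

/-- A strongly continuous semigroup on `[0, ∞)`, uniformly bounded by `C₀`. -/
structure IsBddSemigroup (T : ℝ → E →L[ℂ] E) (C₀ : ℝ) : Prop where
  zero : T 0 = 1
  add : ∀ s t, 0 ≤ s → 0 ≤ t → T (s + t) = T s * T t
  cont : ∀ f, Tendsto (fun t => T t f) (𝓝[>] 0) (𝓝 f)
  bound : ∀ t, 0 ≤ t → ‖T t‖ ≤ C₀

/-- The operators `R` are bounded left inverses of `λ - A`, `Re λ > 0`, where `A` is the generator
of `T`, and satisfy the bound of a sectorial operator. -/
def HasLeftResolvent (T : ℝ → E →L[ℂ] E) (M : ℝ) : Prop :=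
  ∀ l : ℂ, 0 < l.re → ∃ R : E →L[ℂ] E, ‖l • R‖ ≤ M ∧
    ∀ u g, Tendsto (fun h : ℝ => ((h : ℂ)⁻¹) • (T h u - u)) (𝓝[>] 0) (𝓝 (-g)) →
      R (l • u + g) = u

variable {T : ℝ → E →L[ℂ] E} {C₀ M : ℝ}

lemma IsBddSemigroup.nonneg (hT : IsBddSemigroup T C₀) : 0 ≤ C₀ :=
  (norm_nonneg _).trans (hT.bound 0 le_rfl)

lemma IsBddSemigroup.norm_apply_le (hT : IsBddSemigroup T C₀) {t : ℝ} (ht : 0 ≤ t) (f : E) :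
    ‖T t f‖ ≤ C₀ * ‖f‖ := (T t).le_of_opNorm_le (hT.bound t ht) f

lemma IsBddSemigroup.norm_sub_le (hT : IsBddSemigroup T C₀) (f : E) {s t : ℝ} (hs : 0 ≤ s)
    (ht : 0 ≤ t) : ‖T t f - T s f‖ ≤ C₀ * ‖T |t - s| f - f‖ := by
  wlog h : s ≤ t generalizing s t
  · have := this ht hs (le_of_not_ge h)
    rwa [norm_sub_rev, abs_sub_comm] at this
  have e : T t = T s * T |t - s| := by
    rw [← hT.add s _ hs (abs_nonneg _), abs_of_nonneg (sub_nonneg.2 h)]; congr 1; ring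
  rw [e, mul_apply_eq_comp, ← map_sub]
  exact hT.norm_apply_le hs _

lemma IsBddSemigroup.continuous (hT : IsBddSemigroup T C₀) (f : E) :
    Continuous fun t : ℝ => T (max t 0) f := by
  have h0 : Tendsto (fun t => T t f) (𝓝[≥] 0) (𝓝 f) := by
    have : (𝓝[≥] (0 : ℝ)) = 𝓝[>] 0 ⊔ pure 0 := by
      rw [← Ioi_insert, nhdsWithin_insert, sup_comm]
    rw [this, tendsto_sup]
    refine ⟨hT.cont f, ?_⟩
    rw [tendsto_pure_left]
    intro s hs
    simpa [hT.zero] using mem_of_mem_nhds hs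
  rw [continuous_iff_continuousAt]
  intro s
  have h1 : Tendsto (fun t : ℝ => |max t 0 - max s 0|) (𝓝 s) (𝓝[≥] 0) := by
    refine tendsto_nhdsWithin_iff.2 ⟨?_, Eventually.of_forall fun t => mem_Ici.2 (abs_nonneg _)⟩
    have : Continuous fun t : ℝ => |max t 0 - max s 0| := by fun_prop
    simpa using this.tendsto s
  have h2 := ((h0.comp h1).sub_const f).norm.const_mul C₀
  simp only [sub_self, norm_zero, mul_zero] at h2
  rw [ContinuousAt, tendsto_iff_norm_sub_tendsto_zero]
  exact squeeze_zero (fun _ => norm_nonneg _)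
    (fun t => hT.norm_sub_le f (le_max_right _ _) (le_max_right _ _)) h2

/-- The weighted orbit `t ↦ t^k e^{-λt} T(t) f`, extended to `t < 0` so as to be continuous. -/
def wOrbit (T : ℝ → E →L[ℂ] E) (k : ℕ) (l : ℂ) (f : E) (t : ℝ) : E :=
  ((t : ℂ) ^ k * Complex.exp (-l * t)) • T (max t 0) f

/-- The Laplace transform of `t ↦ t^k T(t) f` at `λ`. -/
def lap (T : ℝ → E →L[ℂ] E) (k : ℕ) (l : ℂ) (f : E) : E := ∫ t in Ioi (0 : ℝ), wOrbit T k l f t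

lemma IsBddSemigroup.continuous_wOrbit (hT : IsBddSemigroup T C₀) (k : ℕ) (l : ℂ) (f : E) :
    Continuous (wOrbit T k l f) := by
  have := hT.continuous f
  unfold wOrbit
  exact Continuous.smul (by fun_prop) this

lemma IsBddSemigroup.norm_wOrbit_le (hT : IsBddSemigroup T C₀) (k : ℕ) (l : ℂ) (f : E) {t : ℝ}
    (ht : 0 ≤ t) : ‖wOrbit T k l f t‖ ≤ t ^ k * Real.exp (-l.re * t) * (C₀ * ‖f‖) := by
  unfold wOrbit
  rw [norm_smul, norm_mul, Complex.norm_exp, norm_pow, Complex.norm_real, Real.norm_of_nonneg ht]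
  simp only [Complex.mul_re, Complex.neg_re, Complex.ofReal_re, Complex.neg_im, Complex.ofReal_im,
    mul_zero, sub_zero]
  gcongr
  exact hT.norm_apply_le (le_max_right _ _) _

lemma integrableOn_pow_mul_exp_neg (k : ℕ) {a : ℝ} (ha : 0 < a) :
    IntegrableOn (fun t : ℝ => t ^ k * Real.exp (-a * t)) (Ioi 0) := by
  have := integrableOn_rpow_mul_exp_neg_mul_rpow (p := 1) (s := k) (b := a)
    (by have := Nat.cast_nonneg (α := ℝ) k; linarith) one_pos ha
  simpa using this

lemma IsBddSemigroup.integrableOn_wOrbit (hT : IsBddSemigroup T C₀) (k : ℕ) {l : ℂ}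
    (hl : 0 < l.re) (f : E) : IntegrableOn (wOrbit T k l f) (Ioi 0) := by
  refine ((integrableOn_pow_mul_exp_neg k hl).mul_const (C₀ * ‖f‖)).mono'
    (hT.continuous_wOrbit k l f).aestronglyMeasurable ?_
  filter_upwards [ae_restrict_mem measurableSet_Ioi] with t ht
  exact hT.norm_wOrbit_le k l f (mem_Ioi.1 ht).le

lemma wOrbit_add (hT : IsBddSemigroup T C₀) {l : ℂ} {f : E} {s t : ℝ} (hs : 0 ≤ s) (ht : 0 ≤ t) 
    (k : ℕ) : T s (wOrbit T k l f t) =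
      Complex.exp (l * s) • (((t + s : ℝ) - s : ℂ) ^ k • wOrbit T 0 l f (t + s)) := by
  unfold wOrbit
  rw [map_smul, max_eq_left ht, max_eq_left (add_nonneg ht hs), add_comm t s, hT.add s t hs ht,
    mul_apply_eq_comp, smul_smul, smul_smul]
  congr 1
  push_cast
  rw [pow_zero, one_mul, mul_right_comm, ← Complex.exp_add, mul_comm]
  congr 2 <;> ring

/-- The semigroup acts on a Laplace transform by shifting the region of integration. -/
lemma apply_lap [CompleteSpace E] (hT : IsBddSemigroup T C₀) (k : ℕ) {l : ℂ} (hl : 0 < l.re) (f : E) {h : ℝ}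
    (hh : 0 ≤ h) : T h (lap T k l f) =
      Complex.exp (l * h) • ∫ s in Ioi h, ((s - h : ℂ) ^ k) • wOrbit T 0 l f s := by
  unfold lap
  rw [← ContinuousLinearMap.integral_comp_comm _ (hT.integrableOn_wOrbit k hl f),
    ← integral_smul]
  have := (measurePreserving_add_right volume h).setIntegral_preimage_emb
    (measurableEmbedding_addRight h)
    (fun s : ℝ => Complex.exp (l * h) • ((s - h : ℂ) ^ k) • wOrbit T 0 l f s) (Ioi h)
  rw [← this, preimage_add_const_Ioi, sub_self]
  refine setIntegral_congr_fun measurableSet_Ioi fun t ht => ?_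
  exact wOrbit_add hT hh (mem_Ioi.1 ht).le k

lemma pow_smul_wOrbit (k : ℕ) (l : ℂ) (f : E) (s : ℝ) :
    (s : ℂ) ^ k • wOrbit T 0 l f s = wOrbit T k l f s := by
  simp [wOrbit, smul_smul]

/-- The tail `∫_h^∞ t^k e^{-λt} T(t) f dt`, extended to negative `h`. -/
def lapTail (T : ℝ → E →L[ℂ] E) (k : ℕ) (l : ℂ) (f : E) (h : ℝ) : E :=
  lap T k l f - ∫ t in (0 : ℝ)..h, wOrbit T k l f t

lemma lapTail_eq (hT : IsBddSemigroup T C₀) (k : ℕ) {l : ℂ} (hl : 0 < l.re) (f : E) {h : ℝ}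
    (hh : 0 ≤ h) : lapTail T k l f h = ∫ s in Ioi h, wOrbit T k l f s := by
  unfold lapTail lap
  rw [← intervalIntegral.integral_Ioi_sub_Ioi (hT.integrableOn_wOrbit k hl f) hh]
  abel

lemma lapTail_zero (k : ℕ) (l : ℂ) (f : E) : lapTail T k l f 0 = lap T k l f := by
  simp [lapTail]

lemma hasDerivAt_lapTail [CompleteSpace E] (hT : IsBddSemigroup T C₀) (k : ℕ) (l : ℂ) (f : E) :
    HasDerivAt (lapTail T k l f) (-wOrbit T k l f 0) 0 := by
  have := ((hT.continuous_wOrbit k l f).integral_hasStrictDerivAt 0 0).hasDerivAt.const_sub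
    (lap T k l f)
  exact this

lemma wOrbit_zero_zero (hT : IsBddSemigroup T C₀) (l : ℂ) (f : E) : wOrbit T 0 l f 0 = f := by
  simp [wOrbit, hT.zero]

lemma wOrbit_zero_of_ne {k : ℕ} (hk : k ≠ 0) (l : ℂ) (f : E) : wOrbit T k l f 0 = 0 := by
  simp [wOrbit, hk]

lemma tendsto_of_hasDerivAt {F : ℝ → E} {g : E} (u : E) (hF : HasDerivAt F g 0) (h0 : F 0 = u)
    (hTF : ∀ h, 0 < h → T h u = F h) :
    Tendsto (fun h : ℝ => ((h : ℂ)⁻¹) • (T h u - u)) (𝓝[>] 0) (𝓝 g) := by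
  have h1 := hF.tendsto_slope_zero_right
  refine h1.congr' ?_
  filter_upwards [self_mem_nhdsWithin] with h hh
  rw [hTF h hh, zero_add, h0, ← Complex.ofReal_inv]
  rfl

variable {l : ℂ} {R : E →L[ℂ] E} {f : E}

lemma integrableOn_smul_wOrbit (hT : IsBddSemigroup T C₀) (k : ℕ) (hl : 0 < l.re) (c : ℂ) (f : E)
    {h : ℝ} (hh : 0 ≤ h) : IntegrableOn (fun s => c • wOrbit T k l f s) (Ioi h) :=
  ((hT.integrableOn_wOrbit k hl f).mono_set (Ioi_subset_Ioi hh)).smul c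

lemma hasDerivAt_exp_mul (l : ℂ) : HasDerivAt (fun h : ℝ => Complex.exp (l * h)) l 0 := by
  have h1 : HasDerivAt (fun z : ℂ => Complex.exp (l * z)) (Complex.exp (l * ((0 : ℝ) : ℂ)) * l)
      ((0 : ℝ) : ℂ) := by
    simpa using ((hasDerivAt_id ((0 : ℝ) : ℂ)).const_mul l).cexp
  simpa using h1.comp_ofReal

/-- The Laplace transform of the orbit of `f` is the resolvent applied to `f`. -/
lemma resolvent_eq_lap [CompleteSpace E] (hT : IsBddSemigroup T C₀) (hl : 0 < l.re)
    (hR : ∀ u g, Tendsto (fun h : ℝ => ((h : ℂ)⁻¹) • (T h u - u)) (𝓝[>] 0) (𝓝 (-g)) →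
      R (l • u + g) = u) (f : E) : R f = lap T 0 l f := by
  have key := hR (lap T 0 l f) (f - l • lap T 0 l f) ?_
  · rwa [add_sub_cancel] at key
  have hd := (hasDerivAt_exp_mul l).smul (hasDerivAt_lapTail hT 0 l f)
  refine tendsto_of_hasDerivAt _ (F := fun h : ℝ => Complex.exp (l * h) • lapTail T 0 l f h)
    ?_ ?_ ?_
  · refine hd.congr_deriv ?_
    rw [lapTail_zero, wOrbit_zero_zero hT]
    simp [sub_eq_add_neg, add_comm]
  · simp [lapTail_zero]
  · intro h hh
    rw [apply_lap hT 0 hl f hh.le, lapTail_eq hT 0 hl f hh.le]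
    simp

/-- One more application of the resolvent. The generator acts on `lap T 1` because
`T(h) ∫_0^∞ t e^{-λt} T(t) f dt = e^{λh} ∫_h^∞ (t - h) e^{-λt} T(t) f dt` can be differentiated at
`h = 0`. -/
lemma resolvent_lap_zero [CompleteSpace E] (hT : IsBddSemigroup T C₀) (hl : 0 < l.re)
    (hR : ∀ u g, Tendsto (fun h : ℝ => ((h : ℂ)⁻¹) • (T h u - u)) (𝓝[>] 0) (𝓝 (-g)) →
      R (l • u + g) = u) (f : E) : R (lap T 0 l f) = lap T 1 l f := by
  have key := hR (lap T 1 l f) (lap T 0 l f - l • lap T 1 l f) ?_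
  · rwa [add_sub_cancel] at key
  have hd := (hasDerivAt_exp_mul l).smul ((hasDerivAt_lapTail hT 1 l f).sub
    ((Complex.ofRealCLM.hasDerivAt (x := (0 : ℝ))).smul (hasDerivAt_lapTail hT 0 l f)))
  refine tendsto_of_hasDerivAt _ (F := fun h : ℝ => Complex.exp (l * h) •
    (lapTail T 1 l f h - (h : ℂ) • lapTail T 0 l f h)) ?_ ?_ ?_
  · refine hd.congr_deriv ?_
    simp [lapTail_zero, wOrbit_zero_of_ne, sub_eq_add_neg, add_comm]
  · simp [lapTail_zero]
  · intro h hh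
    rw [apply_lap hT 1 hl f hh.le, lapTail_eq hT 0 hl f hh.le, lapTail_eq hT 1 hl f hh.le,
      ← integral_smul (h : ℂ),
      ← integral_sub ((hT.integrableOn_wOrbit 1 hl f).mono_set (Ioi_subset_Ioi hh.le))
        (integrableOn_smul_wOrbit hT 0 hl _ f hh.le)]
    simp only [← pow_smul_wOrbit 1, pow_one, sub_smul]

/-- The third application of the resolvent, in the same way with the weight `(t - h)²`. -/
lemma resolvent_lap_one [CompleteSpace E] (hT : IsBddSemigroup T C₀) (hl : 0 < l.re)
    (hR : ∀ u g, Tendsto (fun h : ℝ => ((h : ℂ)⁻¹) • (T h u - u)) (𝓝[>] 0) (𝓝 (-g)) →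
      R (l • u + g) = u) (f : E) : R ((2 : ℂ) • lap T 1 l f) = lap T 2 l f := by
  have key := hR (lap T 2 l f) ((2 : ℂ) • lap T 1 l f - l • lap T 2 l f) ?_
  · rwa [add_sub_cancel] at key
  have h1 := Complex.ofRealCLM.hasDerivAt (x := (0 : ℝ))
  have hd := (hasDerivAt_exp_mul l).smul (((hasDerivAt_lapTail hT 2 l f).sub
    ((h1.const_mul 2).smul (hasDerivAt_lapTail hT 1 l f))).add
      ((h1.pow 2).smul (hasDerivAt_lapTail hT 0 l f)))
  refine tendsto_of_hasDerivAt _ (F := fun h : ℝ => Complex.exp (l * h) •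
    (lapTail T 2 l f h - (2 * h : ℂ) • lapTail T 1 l f h + (h : ℂ) ^ 2 • lapTail T 0 l f h))
    ?_ ?_ ?_
  · refine hd.congr_deriv ?_
    simp [lapTail_zero, wOrbit_zero_of_ne, sub_eq_add_neg, add_comm]
  · simp [lapTail_zero]
  · intro h hh
    have i2 : IntegrableOn (wOrbit T 2 l f) (Ioi h) := by
      simpa using integrableOn_smul_wOrbit hT 2 hl 1 f hh.le
    have i1 := integrableOn_smul_wOrbit hT 1 hl (2 * h : ℂ) f hh.le
    rw [apply_lap hT 2 hl f hh.le, lapTail_eq hT 0 hl f hh.le, lapTail_eq hT 1 hl f hh.le,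
      lapTail_eq hT 2 hl f hh.le, ← integral_smul (2 * h : ℂ), ← integral_smul ((h : ℂ) ^ 2),
      ← integral_sub i2 i1]
    congr 1
    refine Eq.trans ?_ (integral_add (i2.sub i1) (integrableOn_smul_wOrbit hT 0 hl _ f hh.le))
    refine integral_congr_ae (Eventually.of_forall fun s => ?_)
    simp only [← pow_smul_wOrbit 1, ← pow_smul_wOrbit 2, pow_one, smul_smul, ← sub_smul,
      ← add_smul]
    congr 1
    ring

/-- The Laplace transform of `t ↦ t² T(t) f` is `2 R(λ)³ f`, hence decays like `|λ|⁻³`. -/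
lemma norm_lap_two_le [CompleteSpace E] (hT : IsBddSemigroup T C₀) (hR : HasLeftResolvent T M) {l : ℂ}
    (hl : 0 < l.re) (f : E) : ‖lap T 2 l f‖ ≤ 2 * M ^ 3 * ‖f‖ / ‖l‖ ^ 3 := by
  obtain ⟨R, hRM, hR⟩ := hR l hl
  have hl0 : 0 < ‖l‖ := norm_pos_iff.2 fun h => by simp [h] at hl
  have hM : ‖R‖ ≤ M / ‖l‖ := by
    rw [le_div_iff₀ hl0, mul_comm, ← norm_smul]; exact hRM
  have hM0 : 0 ≤ M / ‖l‖ := (norm_nonneg _).trans hM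
  have hb : ∀ g, ‖R g‖ ≤ M / ‖l‖ * ‖g‖ := fun g => R.le_of_opNorm_le hM g
  rw [← resolvent_lap_one hT hl hR f, ← resolvent_lap_zero hT hl hR f,
    ← resolvent_eq_lap hT hl hR f]
  calc ‖R ((2 : ℂ) • R (R f))‖ ≤ M / ‖l‖ * (2 * (M / ‖l‖ * (M / ‖l‖ * ‖f‖))) := by
        refine (hb _).trans ?_
        rw [norm_smul, Complex.norm_ofNat]
        gcongr
        refine (hb _).trans ?_
        gcongr
        exact hb f
    _ = 2 * M ^ 3 * ‖f‖ / ‖l‖ ^ 3 := by field_simp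

open scoped FourierTransform

/-- The function `t ↦ t² e^{-at} T(t) f` for `t ≥ 0`, extended by `0`. -/
def dampOrbit (T : ℝ → E →L[ℂ] E) (a : ℝ) (f : E) : ℝ → E :=
  (Ioi (0 : ℝ)).indicator (wOrbit T 2 a f)

lemma continuous_dampOrbit (hT : IsBddSemigroup T C₀) (a : ℝ) (f : E) :
    Continuous (dampOrbit T a f) := by
  refine (hT.continuous_wOrbit 2 a f).indicator fun x hx => ?_
  rw [frontier_Ioi] at hx
  rw [mem_singleton_iff.1 hx]
  exact wOrbit_zero_of_ne two_ne_zero _ _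

lemma integrable_dampOrbit (hT : IsBddSemigroup T C₀) {a : ℝ} (ha : 0 < a) (f : E) :
    Integrable (dampOrbit T a f) :=
  (hT.integrableOn_wOrbit 2 (by simpa using ha) f).integrable_indicator measurableSet_Ioi

lemma fourier_dampOrbit (a : ℝ) (f : E) (x : ℝ) :
    𝓕 (dampOrbit T a f) x = lap T 2 (a + 2 * Real.pi * x * Complex.I) f := by
  rw [Real.fourier_real_eq_integral_exp_smul, lap, ← integral_indicator measurableSet_Ioi]
  congr 1
  ext t
  by_cases ht : t ∈ Ioi (0 : ℝ)
  · simp only [dampOrbit, indicator_of_mem ht, wOrbit, smul_smul]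
    congr 1
    rw [mul_left_comm, ← Complex.exp_add]
    congr 2
    push_cast
    ring
  · simp [dampOrbit, indicator_of_notMem ht]

lemma normSq_add_mul_I (a x : ℝ) :
    ‖(a + 2 * Real.pi * x * Complex.I : ℂ)‖ ^ 2 = a ^ 2 + (2 * Real.pi * x) ^ 2 := by
  rw [← Complex.normSq_eq_norm_sq, Complex.normSq_apply]
  simp
  ring

lemma integrable_inv_sq_add {a : ℝ} (ha : 0 < a) :
    Integrable fun x : ℝ => (a ^ 2 + (2 * Real.pi * x) ^ 2)⁻¹ := by
  have h := (integrable_inv_one_add_sq.comp_mul_left'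
    (R := 2 * Real.pi / a) (by positivity)).const_mul ((a ^ 2)⁻¹)
  refine h.congr (Eventually.of_forall fun x => ?_)
  simp only
  rw [← mul_inv]
  congr 1
  field_simp

lemma integral_inv_sq_add {a : ℝ} (ha : 0 < a) :
    ∫ x : ℝ, (a ^ 2 + (2 * Real.pi * x) ^ 2)⁻¹ = 1 / (2 * a) := by
  have h := Measure.integral_comp_mul_left (fun x : ℝ => (1 + x ^ 2)⁻¹) (2 * Real.pi / a)
  rw [integral_univ_inv_one_add_sq, abs_of_pos (by positivity)] at h
  have e : ∀ x : ℝ, (a ^ 2 + (2 * Real.pi * x) ^ 2)⁻¹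
      = (a ^ 2)⁻¹ * (1 + (2 * Real.pi / a * x) ^ 2)⁻¹ := by
    intro x
    rw [← mul_inv]
    congr 1
    field_simp
  simp_rw [e]
  rw [integral_const_mul, h, smul_eq_mul]
  field_simp

/-- The Fourier transform and its first moment are integrable, with a bound that is linear in `f`. -/
lemma norm_fourier_dampOrbit_le [CompleteSpace E] (hT : IsBddSemigroup T C₀)
    (hR : HasLeftResolvent T M) {a : ℝ} (ha : 0 < a) (f : E) (x : ℝ) :
    (a + 2 * Real.pi * |x|) * ‖𝓕 (dampOrbit T a f) x‖ ≤
      4 * |M| ^ 3 * ‖f‖ * (a ^ 2 + (2 * Real.pi * x) ^ 2)⁻¹ := by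
  rw [fourier_dampOrbit]
  set l : ℂ := a + 2 * Real.pi * x * Complex.I with hl
  have hre : l.re = a := by simp [hl]
  have him : l.im = 2 * Real.pi * x := by simp [hl]
  have h1 : a + 2 * Real.pi * |x| ≤ 2 * ‖l‖ := by
    have e1 := Complex.abs_re_le_norm l
    have e2 := Complex.abs_im_le_norm l
    rw [hre, abs_of_pos ha] at e1
    rw [him, abs_mul, abs_of_pos (by positivity : 0 < 2 * Real.pi)] at e2
    linarith
  have hl0 : 0 < ‖l‖ := by
    have := Complex.abs_re_le_norm l
    rw [hre, abs_of_pos ha] at this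
    linarith
  rw [← normSq_add_mul_I, ← hl]
  calc (a + 2 * Real.pi * |x|) * ‖lap T 2 l f‖
      ≤ 2 * ‖l‖ * (2 * |M| ^ 3 * ‖f‖ / ‖l‖ ^ 3) := by
        refine mul_le_mul h1 ((norm_lap_two_le hT hR (by rw [hre]; exact ha) f).trans ?_)
          (norm_nonneg _) (by positivity)
        gcongr 2 * ?_ * _ / _
        exact (le_abs_self _).trans (abs_pow M 3).le
    _ = _ := by field_simp; ring

/-- The constant in the estimate for the derivative of the semigroup. -/
def derivConst (C₀ M : ℝ) : ℝ := 2 * C₀ + 2 * Real.exp 1 * |M| ^ 3 + C₀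

/-- Fourier inversion represents `t² e^{-at} T(t) f` by an absolutely convergent integral that can
be differentiated. -/
lemma exists_hasDerivAt_dampOrbit [CompleteSpace E] (hT : IsBddSemigroup T C₀)
    (hR : HasLeftResolvent T M) {a : ℝ} (ha : 0 < a) (f : E) (t : ℝ) :
    ∃ g, HasDerivAt (dampOrbit T a f) g t ∧ ‖g‖ ≤ 2 * |M| ^ 3 * ‖f‖ / a := by
  set u := dampOrbit T a f with hu
  have hui := integrable_dampOrbit hT ha f
  have hcont : Continuous (𝓕 u) :=
    VectorFourier.fourierIntegral_continuous Real.continuous_fourierChar (by fun_prop) hui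
  have hint := (integrable_inv_sq_add ha).const_mul (4 * |M| ^ 3 * ‖f‖)
  have hpi := Real.pi_pos
  have hF1 : Integrable (𝓕 u) := by
    refine (hint.const_mul a⁻¹).mono' hcont.aestronglyMeasurable (Eventually.of_forall fun x => ?_)
    refine le_trans ?_ (mul_le_mul_of_nonneg_left (norm_fourier_dampOrbit_le hT hR ha f x)
      (by positivity))
    rw [← mul_assoc]
    refine le_mul_of_one_le_left (norm_nonneg _) ?_
    rw [mul_add, inv_mul_cancel₀ ha.ne']
    have : 0 ≤ a⁻¹ * (2 * Real.pi * |x|) := by positivity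
    linarith
  have hb2 : ∀ x : ℝ, 2 * Real.pi * |x| * ‖𝓕 u x‖ ≤
      4 * |M| ^ 3 * ‖f‖ * (a ^ 2 + (2 * Real.pi * x) ^ 2)⁻¹ := fun x =>
    le_trans (mul_le_mul_of_nonneg_right (by linarith) (norm_nonneg _))
      (norm_fourier_dampOrbit_le hT hR ha f x)
  have hF2 : Integrable fun x : ℝ => x • 𝓕 u x := by
    refine (hint.const_mul (2 * Real.pi)⁻¹).mono'
      (continuous_id.smul hcont).aestronglyMeasurable (Eventually.of_forall fun x => ?_)
    rw [norm_smul, Real.norm_eq_abs, ← div_eq_inv_mul, le_div_iff₀ (by positivity)]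
    linarith [hb2 x]
  have hinv : u = 𝓕 (𝓕 u) ∘ Neg.neg := by
    have hcu : Continuous u := continuous_dampOrbit hT a f
    ext s
    exact (congrFun (hcu.fourierInv_fourier_eq hui hF1) s).symm.trans
      (Real.fourierInv_eq_fourier_neg _ _)
  have hd := (Real.hasDerivAt_fourier hF1 hF2 (-t)).scomp t (hasDerivAt_neg t)
  rw [← hinv] at hd
  refine ⟨_, hd, ?_⟩
  · rw [neg_smul, one_smul, norm_neg]
    refine (VectorFourier.norm_fourierIntegral_le_integral_norm _ _ _ _ _).trans ?_
    calc _ ≤ ∫ x : ℝ, 4 * |M| ^ 3 * ‖f‖ * (a ^ 2 + (2 * Real.pi * x) ^ 2)⁻¹ := by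
          refine integral_mono_of_nonneg (Eventually.of_forall fun x => norm_nonneg _) hint
            (Eventually.of_forall fun x => ?_)
          simp only
          rw [norm_smul]
          refine le_trans (le_of_eq ?_) (hb2 x)
          congr 1
          simp [abs_of_pos hpi]
      _ = _ := by rw [integral_const_mul, integral_inv_sq_add ha]; field_simp; ring

lemma eq_smul_dampOrbit {a s : ℝ} (hs : 0 < s) (f : E) :
    T s f = (s⁻¹ ^ 2 * Real.exp (a * s)) • dampOrbit T a f s := by
  have hs' : (s : ℂ) ≠ 0 := Complex.ofReal_ne_zero.2 hs.ne'
  rw [dampOrbit, indicator_of_mem (mem_Ioi.2 hs), wOrbit, max_eq_left hs.le,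
    ← Complex.coe_smul, smul_smul]
  have : ((s⁻¹ ^ 2 * Real.exp (a * s) : ℝ) : ℂ) * ((s : ℂ) ^ 2 * Complex.exp (-a * s)) = 1 := by
    push_cast
    rw [mul_mul_mul_comm, ← Complex.exp_add]
    have : (a * s + -a * s : ℂ) = 0 := by ring
    rw [this, Complex.exp_zero]
    field_simp
  rw [this, one_smul]

/-- The choice `a = 1 / t` of the damping keeps `e^{at}` bounded. -/
lemma exists_hasDerivAt_semigroup_apply [CompleteSpace E] (hT : IsBddSemigroup T C₀)
    (hR : HasLeftResolvent T M) {t : ℝ} (ht : 0 < t) (f : E) :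
    ∃ g, HasDerivAt (fun s => T s f) g t ∧ ‖g‖ ≤ derivConst C₀ M / t * ‖f‖ := by
  obtain ⟨g, hg, hgn⟩ := exists_hasDerivAt_dampOrbit hT hR (inv_pos.2 ht) f t
  have h1 : HasDerivAt (fun s : ℝ => s⁻¹ ^ 2 * Real.exp (t⁻¹ * s))
      ((2 * t⁻¹ ^ 1 * (-(t ^ 2)⁻¹)) * Real.exp (t⁻¹ * t) +
        t⁻¹ ^ 2 * (Real.exp (t⁻¹ * t) * (t⁻¹ * 1))) t := by
    have e1 := (hasDerivAt_inv ht.ne').pow 2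
    have e2 := ((hasDerivAt_id t).const_mul t⁻¹).exp
    exact e1.mul e2
  have h2 := h1.smul hg
  have h3 := h2.congr_of_eventuallyEq (f₁ := fun s => T s f) ?_
  · refine ⟨_, h3, ?_⟩
    have e0 := eq_smul_dampOrbit (T := T) (a := t⁻¹) ht f
    have e1 : (2 * t⁻¹ ^ 1 * (-(t ^ 2)⁻¹)) * Real.exp (t⁻¹ * t) +
        t⁻¹ ^ 2 * (Real.exp (t⁻¹ * t) * (t⁻¹ * 1)) =
        (-2 * t⁻¹ + t⁻¹) * (t⁻¹ ^ 2 * Real.exp (t⁻¹ * t)) := by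
      field_simp
    have hn := hT.norm_apply_le ht.le f
    have h0 := hT.nonneg
    rw [e1, mul_smul (-2 * t⁻¹ + t⁻¹), ← e0, inv_mul_cancel₀ ht.ne']
    calc _ ≤ t⁻¹ ^ 2 * Real.exp 1 * (2 * |M| ^ 3 * ‖f‖ / t⁻¹) + (3 * t⁻¹) * (C₀ * ‖f‖) := by
          refine (norm_add_le _ _).trans (add_le_add ?_ ?_)
          · rw [norm_smul, Real.norm_of_nonneg (by positivity)]
            gcongr
          · rw [norm_smul, Real.norm_eq_abs]
            refine mul_le_mul ?_ hn (norm_nonneg _) (by positivity)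
            rw [abs_le]
            have : 0 < t⁻¹ := inv_pos.2 ht
            constructor <;> linarith
      _ = _ := by unfold derivConst; field_simp; ring
  · filter_upwards [lt_mem_nhds ht] with s hs
    exact eq_smul_dampOrbit hs f

/-- The semigroup is differentiable for `t > 0`, with `‖T'(t)‖ ≤ C / t`. -/
lemma exists_hasDerivAt_semigroup [CompleteSpace E] (hT : IsBddSemigroup T C₀)
    (hR : HasLeftResolvent T M) {t : ℝ} (ht : 0 < t) :
    ∃ A : E →L[ℂ] E, (∀ f, HasDerivAt (fun s => T s f) (A f) t) ∧
      ‖A‖ ≤ derivConst C₀ M / t := by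
  choose g hg hgn using fun f => exists_hasDerivAt_semigroup_apply hT hR ht f
  have h0 := hT.nonneg
  refine ⟨LinearMap.mkContinuous ⟨⟨g, fun x y => ?_⟩, fun c x => ?_⟩ (derivConst C₀ M / t) hgn,
    fun f => hg f, LinearMap.mkContinuous_norm_le _ (by unfold derivConst; positivity) _⟩
  · refine (hg (x + y)).unique ?_
    simpa using! (hg x).add (hg y)
  · refine (hg (c • x)).unique ?_
    simpa using! (hg x).const_smul c

end Semigroup
end
end TentHardy

namespace TentHardy

noncomputable section

/-! ### Higher derivatives and an interpolation inequality -/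

/-- Taylor's formula with remainder for a chain of derivatives `H 0, H 1, …, H n`. -/
lemma norm_taylor_sub_le (n : ℕ) {t ℓ B : ℝ} (hB : 0 ≤ B) :
    ∀ H : ℕ → ℝ → ℂ, (∀ k < n, ∀ s ∈ Icc t (t + ℓ), HasDerivAt (H k) (H (k + 1) s) s) →
      (∀ s ∈ Icc t (t + ℓ), ‖H n s‖ ≤ B) → ∀ r ∈ Icc 0 ℓ,
      ‖H 0 (t + r) - ∑ k ∈ Finset.range n, ((r : ℂ) ^ k / (k.factorial : ℂ)) * H k t‖ ≤
        B * r ^ n := by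
  induction n with
  | zero =>
    intro H _ hb r hr
    simpa using hb (t + r) ⟨by linarith [hr.1], by linarith [hr.2]⟩
  | succ n ih =>
    intro H hd hb r hr
    have ih' := ih (fun k => H (k + 1)) (fun k hk => hd (k + 1) (by omega)) hb
    set g : ℝ → ℂ := fun x => H 0 (t + x) -
      ∑ k ∈ Finset.range (n + 1), ((x : ℂ) ^ k / (k.factorial : ℂ)) * H k t with hg
    have hder : ∀ x ∈ Icc (0 : ℝ) r, HasDerivWithinAt g (H 1 (t + x) -
        ∑ k ∈ Finset.range n, ((x : ℂ) ^ k / (k.factorial : ℂ)) * H (k + 1) t) (Icc 0 r) x := by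
      intro x hx
      have e1 : HasDerivAt (fun x => H 0 (t + x)) (H 1 (t + x)) x := by
        have := hd 0 (by omega) (t + x) ⟨by linarith [hx.1], by linarith [hx.2, hr.2]⟩
        simpa using this.comp_const_add t x
      have e2 : ∀ k : ℕ, HasDerivAt (fun x : ℝ => ((x : ℂ) ^ (k + 1) / ((k + 1).factorial : ℂ)) *
          H (k + 1) t) (((x : ℂ) ^ k / (k.factorial : ℂ)) * H (k + 1) t) x := by
        intro k
        have h1 := (((hasDerivAt_id (x : ℂ)).pow (k + 1)).comp_ofReal.div_const
          ((k + 1).factorial : ℂ)).mul_const (H (k + 1) t)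
        refine h1.congr_deriv ?_
        have : ((k : ℂ) + 1) ≠ 0 := Nat.cast_add_one_ne_zero k
        have h2 : (k.factorial : ℂ) ≠ 0 := by exact_mod_cast k.factorial_ne_zero
        simp only [Nat.factorial_succ, id, Nat.add_sub_cancel, mul_one]
        push_cast
        field_simp
      have e3 := e1.sub (HasDerivAt.fun_sum (u := Finset.range n) fun k _ => e2 k)
      have e4 := (e3.sub_const (H 0 t)).hasDerivWithinAt (s := Icc 0 r)
      refine e4.congr_of_eventuallyEq (Eventually.of_forall fun y => ?_) ?_ <;>
      · simp only [hg, Finset.sum_range_succ', Pi.sub_apply]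
        simp
        ring
    have hle := (convex_Icc (0 : ℝ) r).norm_image_sub_le_of_norm_hasDerivWithin_le
      (C := B * r ^ n) hder (fun x hx => ?_) (left_mem_Icc.2 hr.1) (right_mem_Icc.2 hr.1)
    · have h0 : g 0 = 0 := by
        simp [hg, Finset.sum_range_succ']
      rw [h0, sub_zero, sub_zero, Real.norm_of_nonneg hr.1] at hle
      calc _ ≤ B * r ^ n * r := hle
        _ = _ := by ring
    · refine (ih' x ⟨hx.1, hx.2.trans hr.2⟩).trans ?_
      have := hx.1
      have := hx.2
      gcongr

/-- A quadrature formula at `n` nodes of `[0, 1]` that picks out the linear coefficient of the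
polynomials of degree less than `n`. -/
lemma exists_weights (n : ℕ) : ∃ w x : Fin n → ℝ, (∀ j, x j ∈ Icc (0 : ℝ) 1) ∧
    ∀ k < n, ∑ j, w j * x j ^ k = if k = 1 then 1 else 0 := by
  classical
  let x : Fin n → ℝ := fun j => (j : ℝ) / n
  have hx : Function.Injective x := by
    intro i j hij
    have hn : (n : ℝ) ≠ 0 := by
      have := i.pos
      positivity
    have h1 : (i : ℝ) = j := by
      have := congrArg (· * (n : ℝ)) hij
      simpa [x, hn] using this
    exact Fin.ext (by exact_mod_cast h1)
  let V := Matrix.vandermonde x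
  have hV : IsUnit V.det := isUnit_iff_ne_zero.2 (Matrix.det_vandermonde_ne_zero_iff.2 hx)
  let e : Fin n → ℝ := fun k => if (k : ℕ) = 1 then 1 else 0
  refine ⟨Matrix.vecMul e V⁻¹, x, fun j => ⟨by positivity, ?_⟩, fun k hk => ?_⟩
  · have := j.pos
    rw [div_le_one (by positivity)]
    exact_mod_cast j.2.le
  · have h : Matrix.vecMul (Matrix.vecMul e V⁻¹) V = e := by
      rw [Matrix.vecMul_vecMul, Matrix.nonsing_inv_mul V hV, Matrix.vecMul_one]
    have h2 := congrFun h ⟨k, hk⟩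
    simpa [Matrix.vecMul, dotProduct, V, Matrix.vandermonde_apply, e] using h2

/-- The first derivative is controlled by the function and its `n`-th derivative. -/
lemma exists_norm_deriv_le {n : ℕ} (hn : 2 ≤ n) : ∃ W : ℝ, 0 ≤ W ∧
    ∀ (H : ℕ → ℝ → ℂ) (t ℓ δ B : ℝ), 0 ≤ ℓ → 0 ≤ B →
      (∀ k < n, ∀ s ∈ Icc t (t + ℓ), HasDerivAt (H k) (H (k + 1) s) s) →
      (∀ s ∈ Icc t (t + ℓ), ‖H 0 s‖ ≤ δ) → (∀ s ∈ Icc t (t + ℓ), ‖H n s‖ ≤ B) →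
      ℓ * ‖H 1 t‖ ≤ W * (δ + B * ℓ ^ n) := by
  obtain ⟨w, x, hx, hw⟩ := exists_weights n
  refine ⟨∑ j, |w j|, Finset.sum_nonneg fun _ _ => abs_nonneg _, ?_⟩
  intro H t ℓ δ B hℓ hB hd h0 hb
  have hmem : ∀ j, x j * ℓ ∈ Icc 0 ℓ := fun j =>
    ⟨mul_nonneg (hx j).1 hℓ, mul_le_of_le_one_left hℓ (hx j).2⟩
  have key : (ℓ : ℂ) * H 1 t = ∑ j, (w j : ℂ) *
      ∑ k ∈ Finset.range n, (((x j * ℓ : ℝ) : ℂ) ^ k / (k.factorial : ℂ)) * H k t := by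
    simp_rw [Finset.mul_sum]
    rw [Finset.sum_comm]
    have e : ∀ k ∈ Finset.range n, ∑ j, (w j : ℂ) *
        ((((x j * ℓ : ℝ) : ℂ) ^ k / (k.factorial : ℂ)) * H k t) =
        if k = 1 then (ℓ : ℂ) * H 1 t else 0 := by
      intro k hk
      have h1 : ∑ j, (w j : ℂ) * (x j : ℂ) ^ k = if k = 1 then 1 else 0 := by
        have := congrArg (fun r : ℝ => (r : ℂ)) (hw k (Finset.mem_range.1 hk))
        push_cast at this
        rw [this]
        split_ifs <;> simp
      have h2 : ∑ j, (w j : ℂ) * ((((x j * ℓ : ℝ) : ℂ) ^ k / (k.factorial : ℂ)) * H k t) =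
          (∑ j, (w j : ℂ) * (x j : ℂ) ^ k) * ((ℓ : ℂ) ^ k / (k.factorial : ℂ) * H k t) := by
        rw [Finset.sum_mul]
        refine Finset.sum_congr rfl fun j _ => ?_
        push_cast
        ring
      rw [h2, h1]
      split_ifs with hk1
      · subst hk1; simp
      · simp
    rw [Finset.sum_congr rfl e, Finset.sum_ite_eq' (Finset.range n) 1,
      if_pos (Finset.mem_range.2 hn)]
  have hnorm : ℓ * ‖H 1 t‖ = ‖(ℓ : ℂ) * H 1 t‖ := by
    rw [norm_mul, Complex.norm_real, Real.norm_of_nonneg hℓ]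
  rw [hnorm, key, Finset.sum_mul]
  refine (norm_sum_le _ _).trans (Finset.sum_le_sum fun j _ => ?_)
  rw [norm_mul, Complex.norm_real, Real.norm_eq_abs]
  refine mul_le_mul_of_nonneg_left ?_ (abs_nonneg _)
  have h1 := norm_taylor_sub_le n hB H hd hb _ (hmem j)
  have h2 := h0 (t + x j * ℓ) ⟨by linarith [(hmem j).1], by linarith [(hmem j).2]⟩
  have h3 : B * (x j * ℓ) ^ n ≤ B * ℓ ^ n := by
    have := (hmem j).1
    have := (hmem j).2
    gcongr
  have h4 := norm_le_norm_add_norm_sub (H 0 (t + x j * ℓ))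
    (∑ k ∈ Finset.range n, (((x j * ℓ : ℝ) : ℂ) ^ k / (k.factorial : ℂ)) * H k t)
  linarith

section Semigroup

variable {E : Type*} [NormedAddCommGroup E] [NormedSpace ℂ E]
  {T : ℝ → E →L[ℂ] E} {C₀ M : ℝ}

lemma norm_pow_apply_le {A : E →L[ℂ] E} {a : ℝ} (hA : ‖A‖ ≤ a) (k : ℕ) (f : E) :
    ‖(A ^ k) f‖ ≤ a ^ k * ‖f‖ := by
  induction k with
  | zero => simp
  | succ k ih =>
    rw [pow_succ' A k, mul_apply_eq_comp, pow_succ' a k, mul_assoc]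
    exact (A.le_of_opNorm_le hA _).trans
      (mul_le_mul_of_nonneg_left ih ((norm_nonneg _).trans hA))

variable [CompleteSpace E]

/-- A bounded functional along an orbit has derivatives of all orders, and the derivative of
order `k` is at most a constant times `r⁻ᵏ` beyond time `k r`. -/
lemma exists_deriv_chain (hT : IsBddSemigroup T C₀) (hR : HasLeftResolvent T M) {r : ℝ}
    (hr : 0 < r) (ℓ : E →L[ℂ] ℂ) (f : E) : ∃ H : ℕ → ℝ → ℂ, (∀ s, H 0 s = ℓ (T s f)) ∧
      (∀ (k : ℕ) (s : ℝ), ((k : ℝ) + 1) * r < s → HasDerivAt (H k) (H (k + 1) s) s) ∧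
      ∀ (k : ℕ) (s : ℝ), (k : ℝ) * r ≤ s →
        ‖H k s‖ ≤ ‖ℓ‖ * ((derivConst C₀ M / r) ^ k * (C₀ * ‖f‖)) := by
  obtain ⟨A, hA, hAn⟩ := exists_hasDerivAt_semigroup hT hR hr
  refine ⟨fun k s => ℓ ((A ^ k) (T (s - k * r) f)), fun s => by simp, fun k s hs => ?_,
    fun k s hs => ?_⟩
  · set σ := s - k * r with hσ
    have hσr : r < σ := by rw [hσ]; linarith
    have h1 : HasDerivAt (fun τ => T τ f) (A (T (σ - r) f)) σ := by
      have h2 := hA (T (σ - r) f)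
      have h3 : HasDerivAt (fun τ => T (τ - (σ - r)) (T (σ - r) f)) (A (T (σ - r) f)) σ := by
        have e : r = σ - (σ - r) := by ring
        rw [e] at h2
        simpa using! h2.comp_sub_const σ (σ - r)
      refine h3.congr_of_eventuallyEq ?_
      filter_upwards [lt_mem_nhds (show σ - r < σ by linarith)] with τ hτ
      rw [← mul_apply_eq_comp, ← hT.add _ _ (by linarith) (by linarith)]
      congr 2
      ring
    have h4 : HasDerivAt (fun s => T (s - k * r) f) (A (T (σ - r) f)) s :=
      h1.comp_sub_const s (k * r)
    have h5 := ((ℓ.comp (A ^ k)).restrictScalars ℝ).hasFDerivAt.comp_hasDerivAt s h4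
    refine h5.congr_deriv ?_
    have e : s - ((k + 1 : ℕ) : ℝ) * r = σ - r := by
      rw [hσ]
      push_cast
      ring
    simp only [e]
    rw [pow_succ A k]
    rfl
  · have hs' : 0 ≤ s - k * r := by linarith
    refine (ℓ.le_opNorm _).trans (mul_le_mul_of_nonneg_left ?_ (norm_nonneg _))
    refine (norm_pow_apply_le hAn k _).trans ?_
    have := (norm_nonneg _).trans hAn
    gcongr
    exact hT.norm_apply_le hs' f

end Semigroup
end
end TentHardy

namespace TentHardy

noncomputable section

open scoped NNReal

variable {d : ℕ}

/-! ### The kernel of the semigroup -/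

/-- A strongly continuous semigroup `T` on `L²` that satisfies the resolvent estimate and is given
by kernels `K t` with the size, regularity and conservation properties. -/
structure IsHeatFlow (β γ c M : ℝ) (K : ℝ → Euc d → Euc d → ℂ) (T : ℝ → L2 d →L[ℂ] L2 d) :
    Prop where
  beta_pos : 0 < β
  gamma_pos : 0 < γ
  c_pos : 0 < c
  kernel : ∀ t, 0 < t → IsIntegralKernel (T t) (K t)
  assumptions : KernelAssumptions β γ c K
  zero : T 0 = 1
  add : ∀ s t, 0 ≤ s → 0 ≤ t → T (s + t) = T s * T t
  cont : ∀ f, Tendsto (fun t => T t f) (𝓝[>] 0) (𝓝 f)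
  resolvent : HasLeftResolvent T M

/-- The constant `C` bounds the mass of the kernels `pois d b r`. -/
def PoisMass (d : ℕ) (b : ℝ) (C : ℝ≥0) : Prop :=
  ∀ (r : ℝ) (y : Euc d), 0 < r → ∫⁻ v, ENNReal.ofReal (pois d b r (v - y)) ≤ C

lemma exists_poisMass (d : ℕ) {b : ℝ} (hb : 0 < b) : ∃ C : ℝ≥0, PoisMass d b C := by
  obtain ⟨C, _, hC⟩ := exists_lintegral_pois_mul_le d hb
  exact ⟨C, fun r y hr => lintegral_pois_le hC hr y⟩

variable {β γ c M : ℝ} {K : ℝ → Euc d → Euc d → ℂ} {T : ℝ → L2 d →L[ℂ] L2 d} {C : ℝ≥0}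

namespace IsHeatFlow

lemma measurable_kernel (h : IsHeatFlow β γ c M K T) {t : ℝ} (ht : 0 < t) :
    Measurable (Function.uncurry (K t)) := (h.kernel t ht).1

lemma measurable_right (h : IsHeatFlow β γ c M K T) {t : ℝ} (ht : 0 < t) (x : Euc d) :
    Measurable (K t x) := (h.measurable_kernel ht).comp measurable_prodMk_left

lemma measurable_left (h : IsHeatFlow β γ c M K T) {t : ℝ} (ht : 0 < t) (y : Euc d) :
    Measurable fun x => K t x y :=
  (h.measurable_kernel ht).comp (measurable_id.prodMk measurable_const)

lemma norm_le (h : IsHeatFlow β γ c M K T) {t : ℝ} (ht : 0 < t) (x y : Euc d) :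
    ‖K t x y‖ ≤ c * pois d β t (x - y) := by
  have := h.assumptions.size t ht x y
  rwa [mul_div_assoc] at this

lemma norm_le_const (h : IsHeatFlow β γ c M K T) {t : ℝ} (ht : 0 < t) (x y : Euc d) :
    ‖K t x y‖ ≤ c * pois d β t 0 := by
  refine (h.norm_le ht x y).trans ?_
  have := h.c_pos
  have := h.beta_pos
  unfold pois
  gcongr
  simp

lemma enorm_le (h : IsHeatFlow β γ c M K T) {t : ℝ} (ht : 0 < t) (x y : Euc d) :
    ‖K t x y‖ₑ ≤ ENNReal.ofReal c * ENNReal.ofReal (pois d β t (x - y)) := by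
  rw [← ENNReal.ofReal_mul h.c_pos.le, ← ofReal_norm]
  exact ENNReal.ofReal_le_ofReal (h.norm_le ht x y)

lemma lintegral_left_le (h : IsHeatFlow β γ c M K T) (hC : PoisMass d β C) {t : ℝ} (ht : 0 < t)
    (y : Euc d) : ∫⁻ x, ‖K t x y‖ₑ ≤ ENNReal.ofReal c * C := by
  refine (lintegral_mono fun x => h.enorm_le ht x y).trans ?_
  rw [lintegral_const_mul' _ _ ENNReal.ofReal_ne_top]
  gcongr
  exact hC t y ht

lemma lintegral_right_le (h : IsHeatFlow β γ c M K T) (hC : PoisMass d β C) {t : ℝ} (ht : 0 < t)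
    (x : Euc d) : ∫⁻ y, ‖K t x y‖ₑ ≤ ENNReal.ofReal c * C := by
  refine (lintegral_mono fun y => h.enorm_le ht x y).trans ?_
  rw [lintegral_const_mul' _ _ ENNReal.ofReal_ne_top]
  gcongr
  simp only [pois_neg β t x]
  exact hC t x ht

lemma integrable_left (h : IsHeatFlow β γ c M K T) (hC : PoisMass d β C) {t : ℝ} (ht : 0 < t)
    (y : Euc d) : Integrable fun x => K t x y :=
  ⟨(h.measurable_left ht y).aestronglyMeasurable, (h.lintegral_left_le hC ht y).trans_lt
    (ENNReal.mul_lt_top ENNReal.ofReal_lt_top ENNReal.coe_lt_top)⟩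

lemma integrable_right (h : IsHeatFlow β γ c M K T) (hC : PoisMass d β C) {t : ℝ} (ht : 0 < t)
    (x : Euc d) : Integrable (K t x) :=
  ⟨(h.measurable_right ht x).aestronglyMeasurable, (h.lintegral_right_le hC ht x).trans_lt
    (ENNReal.mul_lt_top ENNReal.ofReal_lt_top ENNReal.coe_lt_top)⟩

/-- Schur's test for the semigroup on `L²`. -/
lemma lintegral_apply_sq_le (h : IsHeatFlow β γ c M K T) (hC : PoisMass d β C) {t : ℝ}
    (ht : 0 < t) (f : L2 d) :
    ∫⁻ x, ‖T t f x‖ₑ ^ (2 : ℝ) ≤ (ENNReal.ofReal c * C) ^ (2 : ℝ) * ∫⁻ x, ‖f x‖ₑ ^ (2 : ℝ) := by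
  set A := ENNReal.ofReal c * (C : ℝ≥0∞) with hA
  have hf : AEMeasurable (fun y => ‖f y‖ₑ) := (Lp.aestronglyMeasurable f).enorm
  have hfm : AEMeasurable (fun p : Euc d × Euc d => ‖f p.2‖ₑ ^ (2 : ℝ)) (volume.prod volume) :=
    (hf.pow_const _).comp_quasiMeasurePreserving Measure.quasiMeasurePreserving_snd
  calc ∫⁻ x, ‖T t f x‖ₑ ^ (2 : ℝ)
      ≤ ∫⁻ x, A * ∫⁻ y, ‖K t x y‖ₑ * ‖f y‖ₑ ^ (2 : ℝ) := by
        refine lintegral_mono_ae ?_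
        filter_upwards [(h.kernel t ht).2 f] with x hx
        rw [hx]
        have h1 : ‖∫ y, K t x y * f y‖ₑ ≤ ∫⁻ y, ‖K t x y‖ₑ * ‖f y‖ₑ := by
          refine (enorm_integral_le_lintegral_enorm _).trans_eq ?_
          simp_rw [enorm_mul]
        refine (ENNReal.rpow_le_rpow h1 (by norm_num)).trans ?_
        refine (rpow_lintegral_mul_le volume (by norm_num : (1 : ℝ) < 2)
          (h.measurable_right ht x).enorm.aemeasurable hf).trans ?_
        gcongr
        refine (ENNReal.rpow_le_rpow (h.lintegral_right_le hC ht x) (by norm_num)).trans_eq ?_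
        norm_num [hA]
    _ = A * ∫⁻ y, (∫⁻ x, ‖K t x y‖ₑ) * ‖f y‖ₑ ^ (2 : ℝ) := by
        rw [lintegral_const_mul' _ _ (ENNReal.mul_ne_top ENNReal.ofReal_ne_top
          ENNReal.coe_ne_top), lintegral_lintegral_swap]
        · congr 1
          refine lintegral_congr fun y => ?_
          rw [lintegral_mul_const _ (h.measurable_left ht y).enorm]
        · exact (h.measurable_kernel ht).enorm.aemeasurable.mul hfm
    _ ≤ A * ∫⁻ y, A * ‖f y‖ₑ ^ (2 : ℝ) := by
        gcongr with y
        exact h.lintegral_left_le hC ht y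
    _ = _ := by
        rw [lintegral_const_mul' _ _ (ENNReal.mul_ne_top ENNReal.ofReal_ne_top
          ENNReal.coe_ne_top), ← mul_assoc]
        congr 1
        rw [ENNReal.rpow_two, sq]

/-- Schur's test. -/
lemma norm_semigroup_le (h : IsHeatFlow β γ c M K T) (hC : PoisMass d β C) {t : ℝ} (ht : 0 < t) :
    ‖T t‖ ≤ c * C := by
  have hc := h.c_pos
  refine ContinuousLinearMap.opNorm_le_bound _ (by positivity) fun f => ?_
  rw [Lp.norm_def, Lp.norm_def]
  have key : eLpNorm (T t f) 2 volume ≤ (ENNReal.ofReal c * C) * eLpNorm f 2 volume := by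
    rw [eLpNorm_eq_lintegral_rpow_enorm_toReal two_ne_zero ENNReal.ofNat_ne_top,
      eLpNorm_eq_lintegral_rpow_enorm_toReal two_ne_zero ENNReal.ofNat_ne_top]
    simp only [ENNReal.toReal_ofNat]
    refine (ENNReal.rpow_le_rpow (h.lintegral_apply_sq_le hC ht f) (by norm_num)).trans_eq ?_
    rw [ENNReal.mul_rpow_of_nonneg _ _ (by norm_num), ← ENNReal.rpow_mul]
    norm_num
  have hfin : (ENNReal.ofReal c * C) * eLpNorm f 2 volume ≠ ∞ :=
    ENNReal.mul_ne_top (ENNReal.mul_ne_top ENNReal.ofReal_ne_top ENNReal.coe_ne_top)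
      (Lp.eLpNorm_ne_top f)
  refine (ENNReal.toReal_mono hfin key).trans_eq ?_
  rw [ENNReal.toReal_mul, ENNReal.toReal_mul, ENNReal.toReal_ofReal hc.le, ENNReal.coe_toReal]

lemma isBddSemigroup (h : IsHeatFlow β γ c M K T) (hC : PoisMass d β C) :
    IsBddSemigroup T (1 + c * C) where
  zero := h.zero
  add := h.add
  cont := h.cont
  bound t ht := by
    have hc := h.c_pos
    have h0 : 0 ≤ c * (C : ℝ) := by positivity
    rcases ht.eq_or_lt with rfl | ht
    · rw [h.zero]
      exact ContinuousLinearMap.norm_id_le.trans (by linarith)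
    · exact (h.norm_semigroup_le hC ht).trans (by linarith)

lemma tendsto_norm_rpow (h : IsHeatFlow β γ c M K T) (a : ℝ) (x : Euc d) :
    Tendsto (fun x' : Euc d => a * ‖x' - x‖ ^ γ) (𝓝 x) (𝓝 0) := by
  have h1 : Continuous fun x' : Euc d => a * ‖x' - x‖ ^ γ :=
    continuous_const.mul ((continuous_id.sub continuous_const).norm.rpow_const
      fun _ => Or.inr h.gamma_pos.le)
  have h2 := h1.tendsto x
  simpa [Real.zero_rpow h.gamma_pos.ne'] using h2

lemma eventually_small {t : ℝ} (ht : 0 < t) (x : Euc d) :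
    ∀ᶠ x' : Euc d in 𝓝 x, 2 * ‖x' - x‖ < t := by
  have h1 : Continuous fun x' : Euc d => 2 * ‖x' - x‖ := by fun_prop
  have h2 := h1.tendsto x
  simp only [sub_self, norm_zero, mul_zero] at h2
  exact h2.eventually_lt_const ht

lemma continuous_left (h : IsHeatFlow β γ c M K T) {t : ℝ} (ht : 0 < t) (y : Euc d) :
    Continuous fun x => K t x y := by
  rw [continuous_iff_continuousAt]
  intro x
  rw [ContinuousAt, tendsto_iff_norm_sub_tendsto_zero]
  refine squeeze_zero' (Eventually.of_forall fun _ => norm_nonneg _) ?_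
    (h.tendsto_norm_rpow (c * t ^ β / (t + ‖x - y‖) ^ ((d : ℝ) + β + γ)) x)
  filter_upwards [eventually_small ht x] with x' hx'
  have := h.assumptions.regular t ht x y (x' - x) (by linarith [norm_nonneg (x - y)])
  rw [add_sub_cancel] at this
  refine (le_add_of_nonneg_right (norm_nonneg _)).trans (this.trans_eq ?_)
  ring

lemma continuous_right (h : IsHeatFlow β γ c M K T) {t : ℝ} (ht : 0 < t) (x : Euc d) :
    Continuous (K t x) := by
  rw [continuous_iff_continuousAt]
  intro y
  rw [ContinuousAt, tendsto_iff_norm_sub_tendsto_zero]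
  refine squeeze_zero' (Eventually.of_forall fun _ => norm_nonneg _) ?_
    (h.tendsto_norm_rpow (c * t ^ β / (t + ‖x - y‖) ^ ((d : ℝ) + β + γ)) y)
  filter_upwards [eventually_small ht y] with y' hy'
  have := h.assumptions.regular t ht x y (y' - y) (by linarith [norm_nonneg (x - y)])
  rw [add_sub_cancel] at this
  refine (le_add_of_nonneg_left (norm_nonneg _)).trans (this.trans_eq ?_)
  ring

lemma continuous_integral_left (h : IsHeatFlow β γ c M K T) {t : ℝ} (ht : 0 < t) {g : Euc d → ℂ}
    (hg : Integrable g) : Continuous fun x => ∫ u, K t x u * g u := by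
  refine continuous_of_dominated (bound := fun u => c * pois d β t 0 * ‖g u‖)
    (fun x => (h.measurable_right ht x).aestronglyMeasurable.mul hg.aestronglyMeasurable)
    (fun x => Eventually.of_forall fun u => ?_) (hg.norm.const_mul _)
    (Eventually.of_forall fun u => (h.continuous_left ht u).mul continuous_const)
  rw [norm_mul]
  exact mul_le_mul_of_nonneg_right (h.norm_le_const ht x u) (norm_nonneg _)

lemma continuous_integral_right (h : IsHeatFlow β γ c M K T) {t : ℝ} (ht : 0 < t) {g : Euc d → ℂ}
    (hg : Integrable g) : Continuous fun y => ∫ u, g u * K t u y := by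
  refine continuous_of_dominated (bound := fun u => ‖g u‖ * (c * pois d β t 0))
    (fun y => hg.aestronglyMeasurable.mul (h.measurable_left ht y).aestronglyMeasurable)
    (fun y => Eventually.of_forall fun u => ?_) (hg.norm.mul_const _)
    (Eventually.of_forall fun u => continuous_const.mul (h.continuous_right ht u))
  rw [norm_mul]
  exact mul_le_mul_of_nonneg_left (h.norm_le_const ht u y) (norm_nonneg _)

lemma integrable_mul (h : IsHeatFlow β γ c M K T) (hC : PoisMass d β C) {t s : ℝ} (ht : 0 < t)
    (hs : 0 < s) (x : Euc d) :
    Integrable (fun p : Euc d × Euc d => K t x p.1 * K s p.1 p.2) (volume.prod volume) := by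
  have hm : Measurable fun p : Euc d × Euc d => K t x p.1 * K s p.1 p.2 :=
    ((h.measurable_right ht x).comp measurable_fst).mul (h.measurable_kernel hs)
  refine ⟨hm.aestronglyMeasurable, ?_⟩
  have hc : ENNReal.ofReal c * (C : ℝ≥0∞) < ∞ :=
    ENNReal.mul_lt_top ENNReal.ofReal_lt_top ENNReal.coe_lt_top
  refine lt_of_le_of_lt ?_ (ENNReal.mul_lt_top hc hc)
  rw [lintegral_prod _ hm.enorm.aemeasurable]
  simp only [enorm_mul]
  calc ∫⁻ u, ∫⁻ y, ‖K t x u‖ₑ * ‖K s u y‖ₑ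
      ≤ ∫⁻ u, ‖K t x u‖ₑ * (ENNReal.ofReal c * C) := by
        refine lintegral_mono fun u => ?_
        rw [lintegral_const_mul _ (h.measurable_right hs u).enorm]
        gcongr
        exact h.lintegral_right_le hC hs u
    _ ≤ _ := by
        rw [lintegral_mul_const _ (h.measurable_right ht x).enorm]
        gcongr
        exact h.lintegral_right_le hC ht x

/-- The semigroup law for the kernels, at every point: the almost everywhere identity of the
operators improves by continuity. -/
lemma chapman_kolmogorov (h : IsHeatFlow β γ c M K T) (hC : PoisMass d β C) {t s : ℝ} (ht : 0 < t)
    (hs : 0 < s) (x y : Euc d) : K (t + s) x y = ∫ u, K t x u * K s u y := by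
  have hts : 0 < t + s := by positivity
  have hB : ∀ (B : Set (Euc d)), MeasurableSet B → volume B < ∞ → ∀ x,
      ∫ y in B, K (t + s) x y = ∫ y in B, ∫ u, K t x u * K s u y := by
    intro B hBm hBf
    have hswap : ∀ x, ∫ y in B, ∫ u, K t x u * K s u y = ∫ u, K t x u * ∫ y in B, K s u y := by
      intro x
      have hi : Integrable (fun p : Euc d × Euc d => K t x p.1 * K s p.1 p.2)
          (volume.prod (volume.restrict B)) := by
        have := (h.integrable_mul hC ht hs x).restrict (s := univ ×ˢ B)
        rwa [← Measure.prod_restrict, Measure.restrict_univ] at this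
      rw [← integral_integral_swap hi]
      exact integral_congr_ae (Eventually.of_forall fun u => integral_const_mul _ _)
    set f : L2 d := indicatorConstLp 2 hBm hBf.ne (1 : ℂ) with hf
    have hfe : ∀ {r : ℝ}, 0 < r → T r f =ᵐ[volume] fun x => ∫ y in B, K r x y := by
      intro r hr
      filter_upwards [(h.kernel r hr).2 f] with x hx
      rw [hx, ← integral_indicator hBm]
      refine integral_congr_ae ?_
      filter_upwards [indicatorConstLp_coeFn (p := 2) (hs := hBm) (hμs := hBf.ne) (c := (1 : ℂ))]
        with y hy
      rw [hf, hy]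
      by_cases hyB : y ∈ B <;> simp [hyB]
    have hg : Integrable fun u => ∫ y in B, K s u y := by
      have hi : Integrable (fun p : Euc d × Euc d => K s p.1 p.2)
          (volume.prod (volume.restrict B)) := by
        refine ⟨(h.measurable_kernel hs).aestronglyMeasurable, ?_⟩
        have hm : Measurable fun p : Euc d × Euc d => ‖K s p.1 p.2‖ₑ :=
          (h.measurable_kernel hs).enorm
        rw [HasFiniteIntegral, lintegral_prod_symm' _ hm]
        refine (lintegral_mono fun y => h.lintegral_left_le hC hs y).trans_lt ?_
        rw [lintegral_const, Measure.restrict_apply_univ]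
        exact ENNReal.mul_lt_top (ENNReal.mul_lt_top ENNReal.ofReal_lt_top ENNReal.coe_lt_top) hBf
      exact hi.integral_prod_left
    have hae : (fun x => ∫ y in B, K (t + s) x y) =ᵐ[volume]
        fun x => ∫ u, K t x u * ∫ y in B, K s u y := by
      have h1 := h.add t s ht.le hs.le
      filter_upwards [hfe hts, (h.kernel t ht).2 (T s f)] with x hx1 hx2
      rw [← hx1, h1, mul_apply_eq_comp, hx2]
      refine integral_congr_ae ?_
      filter_upwards [hfe hs] with u hu
      rw [hu]
    have hind : Integrable (B.indicator (1 : Euc d → ℂ)) :=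
      (integrable_indicator_iff hBm).2 (integrableOn_const (by exact hBf.ne))
    have hcl : Continuous fun x => ∫ y in B, K (t + s) x y := by
      have := h.continuous_integral_left hts hind
      refine this.congr fun x => ?_
      rw [← integral_indicator hBm]
      congr 1
      ext y
      by_cases hyB : y ∈ B <;> simp [hyB]
    have := (hcl.ae_eq_iff_eq volume (h.continuous_integral_left ht hg)).1 hae
    intro x
    rw [hswap x]
    exact congrFun this x
  have hae : K (t + s) x =ᵐ[volume] fun y => ∫ u, K t x u * K s u y :=
    Integrable.ae_eq_of_forall_setIntegral_eq _ _ (h.integrable_right hC hts x)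
      (h.integrable_mul hC ht hs x).integral_prod_right fun B hBm hBf => hB B hBm hBf x
  have := ((h.continuous_right hts x).ae_eq_iff_eq volume
    (h.continuous_integral_right hs (h.integrable_right hC ht x))).1 hae
  exact congrFun this y

end IsHeatFlow
end
end TentHardy

namespace TentHardy

noncomputable section

open scoped NNReal ComplexConjugate

variable {d : ℕ}

/-! ### The time derivative of the kernel -/

lemma eLpNorm_two_le {f : Euc d → ℂ} {B : ℝ} {A : ℝ≥0∞} (hf : ∀ x, ‖f x‖ ≤ B)
    (hA : ∫⁻ x, ‖f x‖ₑ ≤ A) : eLpNorm f 2 volume ≤ (ENNReal.ofReal B * A) ^ (1 / 2 : ℝ) := by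
  rw [eLpNorm_eq_lintegral_rpow_enorm_toReal two_ne_zero ENNReal.ofNat_ne_top]
  simp only [ENNReal.toReal_ofNat]
  refine ENNReal.rpow_le_rpow ?_ (by norm_num)
  calc ∫⁻ x, ‖f x‖ₑ ^ (2 : ℝ) ≤ ∫⁻ x, ENNReal.ofReal B * ‖f x‖ₑ := by
        refine lintegral_mono fun x => ?_
        rw [ENNReal.rpow_two, sq]
        gcongr
        rw [← ofReal_norm]
        exact ENNReal.ofReal_le_ofReal (hf x)
    _ ≤ _ := by
        rw [lintegral_const_mul' _ _ ENNReal.ofReal_ne_top]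
        gcongr

variable {β γ c M : ℝ} {K : ℝ → Euc d → Euc d → ℂ} {T : ℝ → L2 d →L[ℂ] L2 d} {C : ℝ≥0}

lemma pois_zero_mul {b r : ℝ} (hr : 0 < r) : pois d b r 0 * r ^ d = 1 := by
  unfold pois
  rw [norm_zero, add_zero, Real.rpow_add hr, Real.rpow_natCast]
  have := Real.rpow_pos_of_pos hr b
  field_simp

namespace IsHeatFlow

lemma exists_toL2 (h : IsHeatFlow β γ c M K T) {t : ℝ} (ht : 0 < t) {f : Euc d → ℂ}
    (hfm : Measurable f) (hf : ∀ x, ‖f x‖ ≤ c * pois d β t 0)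
    (hA : ∫⁻ x, ‖f x‖ₑ ≤ ENNReal.ofReal c * C) :
    ∃ g : L2 d, g =ᵐ[volume] f ∧ ‖g‖ ≤ (c * pois d β t 0 * (c * C)) ^ (1 / 2 : ℝ) := by
  have hp := pois_nonneg (b := β) ht (0 : Euc d)
  have hc := h.c_pos
  have hn := eLpNorm_two_le hf hA
  have hfin : (ENNReal.ofReal (c * pois d β t 0) * (ENNReal.ofReal c * C)) ^ (1 / 2 : ℝ) ≠ ∞ :=
    ENNReal.rpow_ne_top_of_nonneg (by norm_num) (ENNReal.mul_ne_top ENNReal.ofReal_ne_top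
      (ENNReal.mul_ne_top ENNReal.ofReal_ne_top ENNReal.coe_ne_top))
  have hm : MemLp f 2 volume := ⟨hfm.aestronglyMeasurable, hn.trans_lt hfin.lt_top⟩
  refine ⟨hm.toLp f, hm.coeFn_toLp, ?_⟩
  rw [Lp.norm_toLp]
  refine (ENNReal.toReal_mono hfin hn).trans_eq ?_
  rw [← ENNReal.toReal_rpow, ENNReal.toReal_mul, ENNReal.toReal_mul, ENNReal.toReal_ofReal hc.le,
    ENNReal.toReal_ofReal (by positivity), ENNReal.coe_toReal]

/-- The kernel is a matrix coefficient of the semigroup. -/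
lemma exists_kernel_eq_inner (h : IsHeatFlow β γ c M K T) (hC : PoisMass d β C) {t : ℝ}
    (ht : 0 < t) (x y : Euc d) : ∃ (ℓ : L2 d →L[ℂ] ℂ) (φ : L2 d),
      ‖ℓ‖ * ‖φ‖ ≤ c * pois d β t 0 * (c * C) ∧ ∀ s, 0 < s → ℓ (T s φ) = K (t + (s + t)) x y := by
  have hp := pois_nonneg (b := β) ht (0 : Euc d)
  have hc := h.c_pos
  obtain ⟨φ, hφ, hφn⟩ := h.exists_toL2 (C := C) ht (h.measurable_left ht y)
    (fun u => h.norm_le_const ht u y) (h.lintegral_left_le hC ht y)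
  obtain ⟨ψ, hψ, hψn⟩ := h.exists_toL2 (C := C) ht (f := fun u => conj (K t x u))
    (Complex.continuous_conj.measurable.comp (h.measurable_right ht x))
    (fun u => by rw [RCLike.norm_conj]; exact h.norm_le_const ht x u)
    (by simpa [← ofReal_norm] using h.lintegral_right_le hC ht x)
  refine ⟨innerSL ℂ ψ, φ, ?_, fun s hs => ?_⟩
  · rw [innerSL_apply_norm]
    refine (mul_le_mul hψn hφn (norm_nonneg _) (by positivity)).trans_eq ?_
    rw [← Real.rpow_add' (by positivity) (by norm_num)]
    norm_num
  · rw [h.chapman_kolmogorov hC ht (by positivity : 0 < s + t), innerSL_apply_apply, L2.inner_def]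
    refine integral_congr_ae ?_
    filter_upwards [hψ, (h.kernel s hs).2 φ] with u hu1 hu2
    rw [hu1, hu2, h.chapman_kolmogorov hC hs ht]
    have : ∫ v, K s u v * φ v = ∫ v, K s u v * K t v y := by
      refine integral_congr_ae ?_
      filter_upwards [hφ] with v hv
      rw [hv]
    rw [this]
    simp [mul_comm]

end IsHeatFlow

/-- The constant in the bound of the `n`-th time derivative of the kernel. -/
def timeConst (d : ℕ) (c M : ℝ) (C : ℝ≥0) (n : ℕ) : ℝ :=
  c * 4 ^ d * (c * C) * (1 + c * C) * (derivConst (1 + c * C) M * (4 * (n + 1))) ^ n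

namespace IsHeatFlow

/-- Time derivatives of the kernel. -/
lemma exists_kernel_chain (h : IsHeatFlow β γ c M K T) (hC : PoisMass d β C) (n : ℕ) {t : ℝ}
    (ht : 0 < t) (x y : Euc d) : ∃ H : ℕ → ℝ → ℂ, (∀ s, t / 2 < s → H 0 s = K s x y) ∧
      (∀ k < n + 1, ∀ s, t ≤ s → HasDerivAt (H k) (H (k + 1) s) s) ∧
      ∀ s, t ≤ s → ‖H n s‖ ≤ timeConst d c M C n * pois d β t 0 * (t ^ n)⁻¹ := by
  have hc := h.c_pos
  obtain ⟨ℓ, φ, hℓφ, hK⟩ := h.exists_kernel_eq_inner hC (by positivity : 0 < t / 4) x y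
  have hr : 0 < t / (4 * (n + 1)) := by positivity
  have hB := h.isBddSemigroup hC
  obtain ⟨H, hH0, hHd, hHb⟩ := exists_deriv_chain hB h.resolvent hr ℓ φ
  refine ⟨fun k s => H k (s - t / 2), fun s hs => ?_, fun k hk s hs => ?_, fun s hs => ?_⟩
  · simp only
    rw [hH0, hK _ (by linarith)]
    congr 1
    ring
  · have h1 : ((k : ℝ) + 1) * (t / (4 * (n + 1))) < s - t / 2 := by
      have : ((k : ℝ) + 1) * (t / (4 * (n + 1))) ≤ t / 4 := by
        rw [mul_div_assoc', div_le_div_iff₀ (by positivity) (by norm_num)]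
        have : (k : ℝ) + 1 ≤ n + 1 := by exact_mod_cast hk
        nlinarith
      linarith
    exact (hHd k _ h1).comp_sub_const s (t / 2)
  · have h1 : (n : ℝ) * (t / (4 * (n + 1))) ≤ s - t / 2 := by
      have : (n : ℝ) * (t / (4 * (n + 1))) ≤ t / 4 := by
        rw [mul_div_assoc', div_le_div_iff₀ (by positivity) (by norm_num)]
        nlinarith
      linarith
    refine (hHb n _ h1).trans ?_
    have hD : 0 ≤ derivConst (1 + c * C) M := by unfold derivConst; positivity
    have e1 : pois d β (t / 4) 0 = 4 ^ d * pois d β t 0 := by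
      have e2 := pois_zero_mul (d := d) (b := β) ht
      have e3 := pois_zero_mul (d := d) (b := β) (by positivity : 0 < t / 4)
      rw [div_pow] at e3
      have : t ^ d ≠ 0 := by positivity
      rw [eq_div_of_mul_eq this e2]
      field_simp at e3 ⊢
      exact e3
    calc ‖ℓ‖ * ((derivConst (1 + c * C) M / (t / (4 * (n + 1)))) ^ n * ((1 + c * C) * ‖φ‖))
        = (‖ℓ‖ * ‖φ‖) * ((derivConst (1 + c * C) M / (t / (4 * (n + 1)))) ^ n * (1 + c * C)) := by
          ring
      _ ≤ (c * pois d β (t / 4) 0 * (c * C)) *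
          ((derivConst (1 + c * C) M / (t / (4 * (n + 1)))) ^ n * (1 + c * C)) := by gcongr
      _ = _ := by
          rw [e1, timeConst, div_div_eq_mul_div, div_pow]
          field_simp

lemma differentiableAt (h : IsHeatFlow β γ c M K T) (hC : PoisMass d β C) {t : ℝ}
    (ht : 0 < t) (x y : Euc d) : DifferentiableAt ℝ (fun s => K s x y) t := by
  obtain ⟨H, hH0, hHd, _⟩ := h.exists_kernel_chain hC 0 ht x y
  refine ((hHd 0 (by norm_num) t le_rfl).congr_of_eventuallyEq ?_).differentiableAt
  filter_upwards [lt_mem_nhds (show t / 2 < t by linarith)] with s hs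
  rw [hH0 s hs]

end IsHeatFlow

/-- Interpolation between the decay of the kernel and the bounds of its time derivatives shows
that the first derivative decays with any exponent `b < β`. -/
lemma exists_norm_kerQ_le (d : ℕ) {β b c M : ℝ} (hb : 0 < b) (hbβ : b < β) (hc : 0 < c) :
    ∃ A : ℝ, 0 ≤ A ∧ ∀ (γ : ℝ) (K : ℝ → Euc d → Euc d → ℂ) (T : ℝ → L2 d →L[ℂ] L2 d),
      IsHeatFlow β γ c M K T → ∀ t, 0 < t → ∀ x y,
        ‖kerQ K t x y‖ ≤ A * pois d b t (x - y) := by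
  have hβ : 0 < β := hb.trans hbβ
  obtain ⟨C, hC⟩ := exists_poisMass d hβ
  set a := β - b with ha_def
  have ha : 0 < a := sub_pos.2 hbβ
  obtain ⟨m, hm⟩ := exists_nat_ge (((d : ℝ) + b) / a)
  obtain ⟨W, hW0, hW⟩ := exists_norm_deriv_le (n := m + 2) (by omega)
  have hD : 0 ≤ derivConst (1 + c * C) M := by unfold derivConst; positivity
  have hTc : 0 ≤ timeConst d c M C (m + 2) := by unfold timeConst; positivity
  refine ⟨W * (c * 2 ^ β + timeConst d c M C (m + 2)), by positivity, ?_⟩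
  intro γ K T h t ht x y
  obtain ⟨H, hH0, hHd, hHb⟩ := h.exists_kernel_chain hC (m + 2) ht x y
  set r := ‖x - y‖ with hr_def
  have hr : 0 ≤ r := norm_nonneg _
  set ψ := t / (t + r) with hψ_def
  have hψ : 0 < ψ := by positivity
  have hψ1 : ψ ≤ 1 := by rw [hψ_def, div_le_one (by positivity)]; linarith
  -- `η` balances the two terms of the interpolation inequality on the interval `[t, t + η t]`,
  -- and the number of derivatives is chosen such that `η ^ (m + 1) ≤ ψ ^ (d + b)`
  set η := ψ ^ a with hη_def
  have hη : 0 < η := Real.rpow_pos_of_pos hψ a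
  have hη1 : η ≤ 1 := Real.rpow_le_one hψ.le hψ1 ha.le
  have hpois : ∀ e : ℝ, pois d e t (x - y) = pois d β t 0 * ψ ^ ((d : ℝ) + e) := by
    intro e
    have e2 := pois_zero_mul (d := d) (b := β) ht
    rw [eq_div_of_mul_eq (by positivity) e2, hψ_def, Real.div_rpow ht.le (by positivity),
      Real.rpow_add ht, Real.rpow_natCast]
    unfold pois
    rw [← hr_def]
    field_simp
  have hp0 := pois_nonneg (b := β) ht (0 : Euc d)
  have hder : deriv (fun s => K s x y) t = H 1 t := by
    refine HasDerivAt.deriv ((hHd 0 (by omega) t le_rfl).congr_of_eventuallyEq ?_)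
    filter_upwards [lt_mem_nhds (show t / 2 < t by linarith)] with s hs
    rw [hH0 s hs]
  have hδ : ∀ s ∈ Icc t (t + η * t), ‖H 0 s‖ ≤ c * 2 ^ β * pois d β t (x - y) := by
    intro s hs
    have hs0 : 0 < s := ht.trans_le hs.1
    have hs2 : s ≤ 2 * t := by nlinarith [hs.2]
    rw [hH0 s (by linarith [hs.1]), mul_assoc]
    refine (h.norm_le hs0 x y).trans (mul_le_mul_of_nonneg_left ?_ hc.le)
    unfold pois
    rw [← mul_div_assoc, ← Real.mul_rpow (by norm_num) ht.le]
    have := hs.1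
    gcongr
  have key := hW H t (η * t) _ _ (by positivity) (by positivity)
    (fun k hk s hs => hHd k (by omega) s hs.1) hδ (fun s hs => hHb s hs.1)
  have h1 : (η * t) ^ (m + 2) = η * η ^ (m + 1) * t ^ (m + 2) := by rw [mul_pow]; ring
  have h2 : ψ ^ ((d : ℝ) + β) = η * ψ ^ ((d : ℝ) + b) := by
    rw [hη_def, ← Real.rpow_add hψ]
    congr 1
    rw [ha_def]
    ring
  have h3 : η ^ (m + 1) ≤ ψ ^ ((d : ℝ) + b) := by
    rw [hη_def, ← Real.rpow_natCast, ← Real.rpow_mul hψ.le]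
    refine Real.rpow_le_rpow_of_exponent_ge hψ hψ1 ?_
    rw [div_le_iff₀ ha] at hm
    push_cast
    nlinarith
  have h4 : η * (t * ‖H 1 t‖) ≤ η * (W * (c * 2 ^ β + timeConst d c M C (m + 2)) *
      (pois d β t 0 * ψ ^ ((d : ℝ) + b))) := by
    calc η * (t * ‖H 1 t‖) = η * t * ‖H 1 t‖ := by ring
      _ ≤ _ := key
      _ = η * (W * (c * 2 ^ β * (pois d β t 0 * ψ ^ ((d : ℝ) + b)) +
          timeConst d c M C (m + 2) * (pois d β t 0 * η ^ (m + 1)))) := by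
          rw [hpois β, h1, h2]
          field_simp
      _ ≤ η * (W * (c * 2 ^ β * (pois d β t 0 * ψ ^ ((d : ℝ) + b)) +
          timeConst d c M C (m + 2) * (pois d β t 0 * ψ ^ ((d : ℝ) + b)))) := by gcongr
      _ = _ := by ring
  rw [kerQ, hder, norm_mul, Complex.norm_real, Real.norm_of_nonneg ht.le, hpois b]
  exact le_of_mul_le_mul_left h4 hη

end
end TentHardy

namespace TentHardy

noncomputable section

open scoped NNReal

variable {d : ℕ}

/-! ### Composition of the kernels of `𝒬` -/

/-- What is used of the kernel of `𝒬`: measurability, Poisson type decay, and the smallness of the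
composition of two such kernels when the times are of different size. -/
structure IsCalderonKernel (b : ℝ) (A : ℝ≥0) (k : ℝ → Euc d → Euc d → ℂ) : Prop where
  measurable : Measurable ({p : ℝ × Euc d × Euc d | 0 < p.1}.indicator fun p => k p.1 p.2.1 p.2.2)
  bound : ∀ t, 0 < t → ∀ x y, ‖k t x y‖ₑ ≤ A * ENNReal.ofReal (pois d b t (x - y))
  comp : ∀ t s, 0 < t → 0 < s → ∀ x y,
    ‖∫ u, k t x u * k s u y‖ₑ ≤ A * nker b (x, t) (y, s)

lemma pois_le_of_le_two_mul_norm {b r : ℝ} (hb : 0 < b) (hr : 0 < r) {v w : Euc d}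
    (hvw : ‖w‖ ≤ 2 * ‖v‖) : pois d b r v ≤ 2 ^ ((d : ℝ) + b) * pois d b r w := by
  unfold pois
  rw [← mul_div_assoc, div_le_div_iff₀ (by positivity) (by positivity)]
  calc r ^ b * (r + ‖w‖) ^ ((d : ℝ) + b) ≤ r ^ b * (2 * (r + ‖v‖)) ^ ((d : ℝ) + b) := by
        gcongr
        linarith
    _ = _ := by rw [Real.mul_rpow (by norm_num) (by positivity)]; ring

lemma pois_half_le {b r : ℝ} (hb : 0 < b) (hr : 0 < r) (w : Euc d) :
    pois d b (r / 2) w ≤ 2 ^ ((d : ℝ) + b) * pois d b r w := by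
  unfold pois
  rw [← mul_div_assoc, div_le_div_iff₀ (by positivity) (by positivity)]
  calc (r / 2) ^ b * (r + ‖w‖) ^ ((d : ℝ) + b)
      ≤ r ^ b * (2 * (r / 2 + ‖w‖)) ^ ((d : ℝ) + b) := by
        gcongr <;> linarith [norm_nonneg w]
    _ = _ := by rw [Real.mul_rpow (by norm_num) (by positivity)]; ring

/-- Of `x - u` and `u - y`, one has at least half the length of `x - y`. -/
lemma pois_mul_pois_le {b r : ℝ} (hb : 0 < b) (hr : 0 < r) (x y u : Euc d) :
    pois d b r (x - u) * pois d b r (u - y) ≤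
      2 ^ ((d : ℝ) + b) * pois d b r (x - y) * (pois d b r (u - x) + pois d b r (u - y)) := by
  have h1 := pois_nonneg (b := b) hr (x - u)
  have h2 := pois_nonneg (b := b) hr (u - y)
  have h3 := pois_nonneg (b := b) hr (x - y)
  have h4 : (0 : ℝ) ≤ 2 ^ ((d : ℝ) + b) := by positivity
  rw [← pois_neg b r x u]
  have htri : ‖x - y‖ ≤ ‖x - u‖ + ‖u - y‖ := norm_sub_le_norm_sub_add_norm_sub x u y
  rcases le_total ‖u - y‖ ‖x - u‖ with hle | hle
  · have := mul_le_mul_of_nonneg_right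
      (pois_le_of_le_two_mul_norm hb hr (v := x - u) (w := x - y) (by linarith)) h2
    nlinarith [mul_nonneg (mul_nonneg h4 h3) h1]
  · have := mul_le_mul_of_nonneg_left
      (pois_le_of_le_two_mul_norm hb hr (v := u - y) (w := x - y) (by linarith)) h1
    nlinarith [mul_nonneg (mul_nonneg h4 h3) h2]

lemma lintegral_pois_mul_pois_le {b r : ℝ} {C : ℝ≥0} (hb : 0 < b) (hC : PoisMass d b C)
    (hr : 0 < r) (x y : Euc d) :
    ∫⁻ u, ENNReal.ofReal (pois d b r (x - u) * pois d b r (u - y)) ≤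
      ENNReal.ofReal (2 ^ ((d : ℝ) + b) * pois d b r (x - y)) * (C + C) := by
  have hm : ∀ z : Euc d, Measurable fun u : Euc d => ENNReal.ofReal (pois d b r (u - z)) :=
    fun z => ((measurable_pois b).comp (measurable_const.prodMk
      (measurable_id.sub_const z))).ennreal_ofReal
  calc _ ≤ ∫⁻ u, ENNReal.ofReal (2 ^ ((d : ℝ) + b) * pois d b r (x - y)) *
        (ENNReal.ofReal (pois d b r (u - x)) + ENNReal.ofReal (pois d b r (u - y))) := by
        refine lintegral_mono fun u => ?_
        rw [← ENNReal.ofReal_add (pois_nonneg hr _) (pois_nonneg hr _),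
          ← ENNReal.ofReal_mul (mul_nonneg (by positivity) (pois_nonneg hr _))]
        exact ENNReal.ofReal_le_ofReal (pois_mul_pois_le hb hr x y u)
    _ ≤ _ := by
        rw [lintegral_const_mul' _ _ ENNReal.ofReal_ne_top, lintegral_add_left (hm x)]
        gcongr
        · exact hC r x hr
        · exact hC r y hr

variable {β γ c M : ℝ} {K : ℝ → Euc d → Euc d → ℂ} {T : ℝ → L2 d →L[ℂ] L2 d} {C : ℝ≥0}

namespace IsHeatFlow

lemma continuous_exp (h : IsHeatFlow β γ c M K T) (hC : PoisMass d β C) (p : Euc d × Euc d) :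
    Continuous fun s : ℝ => K (Real.exp s) p.1 p.2 := by
  rw [continuous_iff_continuousAt]
  intro s
  exact ContinuousAt.comp (f := Real.exp) (g := fun t => K t p.1 p.2)
    (h.differentiableAt hC (Real.exp_pos s) p.1 p.2).continuousAt Real.continuous_exp.continuousAt

/-- The kernel is continuous in time, hence jointly measurable, and so are the difference
quotients and their limit. -/
lemma measurable_deriv (h : IsHeatFlow β γ c M K T) (hC : PoisMass d β C) :
    Measurable ({p : ℝ × Euc d × Euc d | 0 < p.1}.indicator
      fun p => deriv (fun s => K s p.2.1 p.2.2) p.1) := by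
  have h1 : Measurable (Function.uncurry fun (s : ℝ) (p : Euc d × Euc d) =>
      K (Real.exp s) p.1 p.2) :=
    measurable_uncurry_of_continuous_of_measurable (h.continuous_exp hC)
      fun s => h.measurable_kernel (Real.exp_pos s)
  have hS : MeasurableSet {p : ℝ × Euc d × Euc d | 0 < p.1} :=
    measurableSet_lt measurable_const measurable_fst
  have h2 : ∀ a : ℝ, Measurable fun p : ℝ × Euc d × Euc d =>
      K (Real.exp (Real.log (p.1 + a))) p.2.1 p.2.2 := fun a =>
    h1.comp ((Real.measurable_log.comp (measurable_fst.add_const a)).prodMk measurable_snd)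
  refine measurable_of_tendsto_metrizable (f := fun n : ℕ =>
    {p : ℝ × Euc d × Euc d | 0 < p.1}.indicator fun p => ((1 / ((n : ℝ) + 1))⁻¹ : ℝ) •
      (K (Real.exp (Real.log (p.1 + 1 / ((n : ℝ) + 1)))) p.2.1 p.2.2 -
        K (Real.exp (Real.log (p.1 + 0))) p.2.1 p.2.2))
    (fun n => Measurable.indicator (((h2 _).sub (h2 0)).const_smul (1 / ((n : ℝ) + 1))⁻¹) hS) ?_
  rw [tendsto_pi_nhds]
  intro p
  by_cases hp : 0 < p.1
  · have hp' : p ∈ {p : ℝ × Euc d × Euc d | 0 < p.1} := hp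
    simp only [indicator_of_mem hp']
    have hd := (h.differentiableAt hC hp p.2.1 p.2.2).hasDerivAt.tendsto_slope_zero_right
    have hu : Tendsto (fun n : ℕ => 1 / ((n : ℝ) + 1)) atTop (𝓝[>] 0) :=
      tendsto_nhdsWithin_iff.2 ⟨tendsto_one_div_add_atTop_nhds_zero_nat,
        Eventually.of_forall fun n => mem_Ioi.2 (by positivity)⟩
    refine (hd.comp hu).congr fun n => ?_
    have hn : 0 < p.1 + 1 / ((n : ℝ) + 1) := by positivity
    simp only [Function.comp_apply]
    rw [Real.exp_log hn, add_zero, Real.exp_log hp]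
  · have hp' : p ∉ {p : ℝ × Euc d × Euc d | 0 < p.1} := hp
    simp only [indicator_of_notMem hp']
    exact tendsto_const_nhds

lemma measurable_deriv_right (h : IsHeatFlow β γ c M K T) (hC : PoisMass d β C) {t : ℝ}
    (ht : 0 < t) (x : Euc d) : Measurable fun y => deriv (fun s => K s x y) t := by
  have h1 : Measurable fun y : Euc d => ((t, x, y) : ℝ × Euc d × Euc d) := by fun_prop
  convert (h.measurable_deriv hC).comp h1 using 1
  ext y
  rw [Function.comp_apply, indicator_of_mem (show (t, x, y) ∈ {p : ℝ × Euc d × Euc d | 0 < p.1} from ht)]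

lemma measurable_deriv_left (h : IsHeatFlow β γ c M K T) (hC : PoisMass d β C) {t : ℝ}
    (ht : 0 < t) (y : Euc d) : Measurable fun x => deriv (fun s => K s x y) t := by
  have h1 : Measurable fun x : Euc d => ((t, x, y) : ℝ × Euc d × Euc d) := by fun_prop
  convert (h.measurable_deriv hC).comp h1 using 1
  ext x
  rw [Function.comp_apply, indicator_of_mem (show (t, x, y) ∈ {p : ℝ × Euc d × Euc d | 0 < p.1} from ht)]

end IsHeatFlow

/-- The time derivative of `K` has decay of exponent `b`. -/
def DerivBound (b A : ℝ) (K : ℝ → Euc d → Euc d → ℂ) : Prop :=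
  ∀ t, 0 < t → ∀ x y, ‖kerQ K t x y‖ ≤ A * pois d b t (x - y)

lemma DerivBound.norm_deriv_le {b A : ℝ} (hA : DerivBound b A K) {t : ℝ} (ht : 0 < t)
    (x y : Euc d) : ‖deriv (fun s => K s x y) t‖ ≤ t⁻¹ * (A * pois d b t (x - y)) := by
  rw [le_inv_mul_iff₀ ht]
  have := hA t ht x y
  rwa [kerQ, norm_mul, Complex.norm_real, Real.norm_of_nonneg ht.le] at this

lemma DerivBound.norm_deriv_le_const {b A : ℝ} (hA : DerivBound b A K) (hb : 0 < b) (hA0 : 0 ≤ A)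
    {t s : ℝ} (ht : 0 < t) (hts : t ≤ s) (x y : Euc d) :
    ‖deriv (fun s => K s x y) s‖ ≤ t⁻¹ * (A * pois d b t 0) := by
  have hs := ht.trans_le hts
  refine (hA.norm_deriv_le hs x y).trans ?_
  have h1 : pois d b s (x - y) ≤ pois d b s 0 := by
    unfold pois
    gcongr
    simp
  have h2 : pois d b s 0 ≤ pois d b t 0 := by
    have e1 := pois_zero_mul (d := d) (b := b) hs
    have e2 := pois_zero_mul (d := d) (b := b) ht
    rw [eq_div_of_mul_eq (by positivity) e1, eq_div_of_mul_eq (by positivity) e2]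
    gcongr
  have h3 := pois_nonneg (b := b) hs (x - y)
  have h4 := h1.trans h2
  gcongr

namespace IsHeatFlow

lemma hasDerivAt_integral_right (h : IsHeatFlow β γ c M K T) (hC : PoisMass d β C) {b A : ℝ}
    (hA : DerivBound b A K) (hb : 0 < b) (hA0 : 0 ≤ A) {g : Euc d → ℂ} (hg : Integrable g) {s : ℝ}
    (hs : 0 < s) (y : Euc d) : HasDerivAt (fun σ => ∫ u, g u * K σ u y)
      (∫ u, g u * deriv (fun σ => K σ u y) s) s := by
  have hs2 : 0 < s / 2 := by positivity
  refine (hasDerivAt_integral_of_dominated_loc_of_deriv_le (μ := volume)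
    (F := fun σ u => g u * K σ u y)
    (F' := fun σ u => g u * deriv (fun σ => K σ u y) σ) (s := Ioi (s / 2))
    (bound := fun u => ‖g u‖ * ((s / 2)⁻¹ * (A * pois d b (s / 2) 0))) (Ioi_mem_nhds (by linarith))
    ?_ ?_ ?_ ?_ ?_ ?_).2
  · filter_upwards [lt_mem_nhds hs] with σ hσ
    exact hg.aestronglyMeasurable.mul (h.measurable_left hσ y).aestronglyMeasurable
  · refine (hg.norm.mul_const (c * pois d β s 0)).mono'
      (hg.aestronglyMeasurable.mul (h.measurable_left hs y).aestronglyMeasurable)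
      (Eventually.of_forall fun u => ?_)
    rw [norm_mul]
    exact mul_le_mul_of_nonneg_left (h.norm_le_const hs u y) (norm_nonneg _)
  · exact hg.aestronglyMeasurable.mul (h.measurable_deriv_left hC hs y).aestronglyMeasurable
  · refine Eventually.of_forall fun u σ hσ => ?_
    rw [norm_mul]
    exact mul_le_mul_of_nonneg_left (hA.norm_deriv_le_const hb hA0 hs2 (mem_Ioi.1 hσ).le u y)
      (norm_nonneg _)
  · exact hg.norm.mul_const _
  · refine Eventually.of_forall fun u σ hσ => ?_
    exact (h.differentiableAt hC (hs2.trans (mem_Ioi.1 hσ)) u y).hasDerivAt.const_mul _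

lemma hasDerivAt_integral_left (h : IsHeatFlow β γ c M K T) (hC : PoisMass d β C) {b A : ℝ}
    (hA : DerivBound b A K) (hb : 0 < b) (hA0 : 0 ≤ A) {g : Euc d → ℂ} (hg : Integrable g) {s : ℝ}
    (hs : 0 < s) (x : Euc d) : HasDerivAt (fun σ => ∫ u, K σ x u * g u)
      (∫ u, deriv (fun σ => K σ x u) s * g u) s := by
  have hs2 : 0 < s / 2 := by positivity
  refine (hasDerivAt_integral_of_dominated_loc_of_deriv_le (μ := volume)
    (F := fun σ u => K σ x u * g u)
    (F' := fun σ u => deriv (fun σ => K σ x u) σ * g u) (s := Ioi (s / 2))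
    (bound := fun u => ((s / 2)⁻¹ * (A * pois d b (s / 2) 0)) * ‖g u‖) (Ioi_mem_nhds (by linarith))
    ?_ ?_ ?_ ?_ ?_ ?_).2
  · filter_upwards [lt_mem_nhds hs] with σ hσ
    exact (h.measurable_right hσ x).aestronglyMeasurable.mul hg.aestronglyMeasurable
  · refine (hg.norm.const_mul (c * pois d β s 0)).mono'
      ((h.measurable_right hs x).aestronglyMeasurable.mul hg.aestronglyMeasurable)
      (Eventually.of_forall fun u => ?_)
    rw [norm_mul]
    exact mul_le_mul_of_nonneg_right (h.norm_le_const hs x u) (norm_nonneg _)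
  · exact (h.measurable_deriv_right hC hs x).aestronglyMeasurable.mul hg.aestronglyMeasurable
  · refine Eventually.of_forall fun u σ hσ => ?_
    rw [norm_mul]
    exact mul_le_mul_of_nonneg_right (hA.norm_deriv_le_const hb hA0 hs2 (mem_Ioi.1 hσ).le x u)
      (norm_nonneg _)
  · exact hg.norm.const_mul _
  · refine Eventually.of_forall fun u σ hσ => ?_
    exact (h.differentiableAt hC (hs2.trans (mem_Ioi.1 hσ)) x u).hasDerivAt.mul_const _

lemma integrable_deriv_right (h : IsHeatFlow β γ c M K T) (hC : PoisMass d β C) {b A : ℝ}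
    (hA : DerivBound b A K) {C' : ℝ≥0} (hC' : PoisMass d b C') {t : ℝ}
    (ht : 0 < t) (x : Euc d) : Integrable fun u => deriv (fun σ => K σ x u) t := by
  have hp : Integrable fun u : Euc d => pois d b t (u - x) := by
    refine ⟨((measurable_pois b).comp (measurable_const.prodMk
      (measurable_id.sub_const x))).aestronglyMeasurable, ?_⟩
    rw [hasFiniteIntegral_iff_ofReal (Eventually.of_forall fun u => pois_nonneg ht _)]
    exact (hC' t x ht).trans_lt ENNReal.coe_lt_top
  refine ((hp.const_mul A).const_mul t⁻¹).mono'
    (h.measurable_deriv_right hC ht x).aestronglyMeasurable (Eventually.of_forall fun u => ?_)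
  rw [pois_neg]
  exact hA.norm_deriv_le ht x u

/-- The composition of two time derivatives depends on the times through their sum only. -/
lemma integral_deriv_mul_deriv (h : IsHeatFlow β γ c M K T) (hC : PoisMass d β C) {b A : ℝ}
    (hA : DerivBound b A K) (hb : 0 < b) (hA0 : 0 ≤ A) {C' : ℝ≥0} (hC' : PoisMass d b C')
    {t s : ℝ} (ht : 0 < t) (hs : 0 < s) (x y : Euc d) :
    ∫ u, deriv (fun σ => K σ x u) t * deriv (fun σ => K σ u y) s =
      deriv (deriv fun σ => K σ x y) (t + s) := by
  have h1 : ∀ σ, 0 < σ → ∫ u, deriv (fun σ => K σ x u) t * K σ u y =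
      deriv (fun σ => K σ x y) (t + σ) := by
    intro σ hσ
    have e1 := (h.hasDerivAt_integral_left hC hA hb hA0 (h.integrable_left hC hσ y) ht x).deriv
    rw [← e1, ← deriv_comp_add_const]
    refine Filter.EventuallyEq.deriv_eq ?_
    filter_upwards [lt_mem_nhds ht] with τ hτ
    rw [h.chapman_kolmogorov hC hτ hσ]
  have e2 := (h.hasDerivAt_integral_right hC hA hb hA0
    (h.integrable_deriv_right hC hA hC' ht x) hs y).deriv
  rw [← e2, ← deriv_comp_const_add]
  refine Filter.EventuallyEq.deriv_eq ?_
  filter_upwards [lt_mem_nhds hs] with σ hσ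
  exact h1 σ hσ

/-- The kernel of `Q_t Q_s` is `t s ∂ₜ² K(t + s)`. -/
lemma integral_kerQ_mul_kerQ (h : IsHeatFlow β γ c M K T) (hC : PoisMass d β C) {b A : ℝ}
    (hA : DerivBound b A K) (hb : 0 < b) (hA0 : 0 ≤ A) {C' : ℝ≥0} (hC' : PoisMass d b C')
    {t s : ℝ} (ht : 0 < t) (hs : 0 < s) (x y : Euc d) :
    ∫ u, kerQ K t x u * kerQ K s u y = (t * s : ℝ) * deriv (deriv fun σ => K σ x y) (t + s) := by
  rw [← h.integral_deriv_mul_deriv hC hA hb hA0 hC' ht hs, ← integral_const_mul]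
  refine integral_congr_ae (Eventually.of_forall fun u => ?_)
  simp only [kerQ]
  push_cast
  ring

end IsHeatFlow

/-- The kernel of `𝒬`, with a constant that depends on the parameters only. -/
lemma exists_isCalderonKernel (d : ℕ) {β b c : ℝ} (M : ℝ) (hb : 0 < b) (hbβ : b < β) (hc : 0 < c) :
    ∃ A : ℝ≥0, ∀ (γ : ℝ) (K : ℝ → Euc d → Euc d → ℂ) (T : ℝ → L2 d →L[ℂ] L2 d),
      IsHeatFlow β γ c M K T → IsCalderonKernel b A (kerQ K) := by
  obtain ⟨A, hA0, hA⟩ := exists_norm_kerQ_le d (M := M) hb hbβ hc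
  obtain ⟨C, hC⟩ := exists_poisMass d (hb.trans hbβ)
  obtain ⟨C', hC'⟩ := exists_poisMass d hb
  set A' : ℝ≥0 := A.toNNReal with hA'
  have hAA : ENNReal.ofReal A = A' := rfl
  set B : ℝ := 2 ^ ((d : ℝ) + b) with hB
  have hB0 : 0 ≤ B := by positivity
  refine ⟨max A' (A' * A' * B.toNNReal * B.toNNReal * (4 * (C' + C'))), fun γ K T h => ?_⟩
  have hD : DerivBound b A K := hA γ K T h
  have hbd : ∀ t, 0 < t → ∀ x y,
      ‖kerQ K t x y‖ₑ ≤ A' * ENNReal.ofReal (pois d b t (x - y)) := by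
    intro t ht x y
    rw [← hAA, ← ENNReal.ofReal_mul hA0, ← ofReal_norm]
    exact ENNReal.ofReal_le_ofReal (hD t ht x y)
  refine ⟨?_, fun t ht x y => (hbd t ht x y).trans ?_, fun t s ht hs x y => ?_⟩
  · have h1 : Measurable fun p : ℝ × Euc d × Euc d => (p.1 : ℂ) :=
      Complex.measurable_ofReal.comp measurable_fst
    convert h1.mul (h.measurable_deriv hC) using 1
    ext p
    by_cases hp : p ∈ {p : ℝ × Euc d × Euc d | 0 < p.1}
    · simp [indicator_of_mem hp, kerQ]
    · simp [indicator_of_notMem hp]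
  · refine mul_le_mul_left ?_ _
    exact ENNReal.coe_le_coe.2 (le_max_left _ _)
  -- the composition depends on `t + s` only, up to the factor `t s`, so that equal times suffice
  · set τ := (t + s) / 2 with hτ
    have hτ0 : 0 < τ := by positivity
    have e1 := h.integral_kerQ_mul_kerQ hC hD hb hA0 hC' ht hs x y
    have e2 := h.integral_kerQ_mul_kerQ hC hD hb hA0 hC' hτ0 hτ0 x y
    rw [show τ + τ = t + s by rw [hτ]; ring] at e2
    have e3 : ∫ u, kerQ K t x u * kerQ K s u y =
        ((4 * (t * s / (t + s) ^ 2) : ℝ) : ℂ) * ∫ u, kerQ K τ x u * kerQ K τ u y := by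
      rw [e1, e2, ← mul_assoc, ← Complex.ofReal_mul]
      congr 2
      rw [hτ]
      field_simp
      ring
    have e4 : ‖∫ u, kerQ K τ x u * kerQ K τ u y‖ₑ ≤
        A' * A' * (ENNReal.ofReal (B * pois d b τ (x - y)) * (C' + C')) := by
      refine (enorm_integral_le_lintegral_enorm _).trans ?_
      calc _ ≤ ∫⁻ u, (A' * A' : ℝ≥0∞) *
            ENNReal.ofReal (pois d b τ (x - u) * pois d b τ (u - y)) := by
            refine lintegral_mono fun u => ?_
            rw [enorm_mul, ENNReal.ofReal_mul (pois_nonneg hτ0 _), mul_mul_mul_comm]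
            exact mul_le_mul' (hbd τ hτ0 x u) (hbd τ hτ0 u y)
        _ ≤ _ := by
            rw [lintegral_const_mul' _ _ (ENNReal.mul_ne_top ENNReal.coe_ne_top
              ENNReal.coe_ne_top)]
            gcongr
            exact lintegral_pois_mul_pois_le hb hC' hτ0 x y
    have hts : 0 ≤ t * s / (t + s) ^ 2 := by positivity
    have hpt := pois_nonneg (b := b) (by positivity : 0 < t + s) (x - y)
    rw [e3, enorm_mul]
    have e5 : ‖((4 * (t * s / (t + s) ^ 2) : ℝ) : ℂ)‖ₑ =
        4 * ENNReal.ofReal (t * s / (t + s) ^ 2) := by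
      rw [← ofReal_norm, Complex.norm_real, Real.norm_of_nonneg (by positivity),
        ENNReal.ofReal_mul (by norm_num), ENNReal.ofReal_ofNat]
    have e6 : ENNReal.ofReal (B * pois d b τ (x - y)) ≤
        B.toNNReal * (B.toNNReal * ENNReal.ofReal (pois d b (t + s) (x - y))) := by
      have : ∀ r : ℝ, ((r.toNNReal : ℝ≥0) : ℝ≥0∞) = ENNReal.ofReal r := fun r => rfl
      rw [this, ← ENNReal.ofReal_mul hB0, ← ENNReal.ofReal_mul hB0]
      exact ENNReal.ofReal_le_ofReal
        (mul_le_mul_of_nonneg_left (pois_half_le hb (by positivity) _) hB0)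
    rw [e5, nker]
    calc _ ≤ 4 * ENNReal.ofReal (t * s / (t + s) ^ 2) * (A' * A' *
          (B.toNNReal * (B.toNNReal * ENNReal.ofReal (pois d b (t + s) (x - y))) * (C' + C'))) := by
          refine mul_le_mul_right (e4.trans ?_) _
          gcongr
      _ = ((A' * A' * B.toNNReal * B.toNNReal * (4 * (C' + C')) : ℝ≥0) : ℝ≥0∞) *
          ENNReal.ofReal (t * s / (t + s) ^ 2 * pois d b (t + s) (x - y)) := by
          rw [ENNReal.ofReal_mul hts]
          push_cast
          ring
      _ ≤ _ := by
          refine mul_le_mul_left ?_ _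
          exact ENNReal.coe_le_coe.2 (le_max_right _ _)

end
end TentHardy

namespace TentHardy

noncomputable section

open scoped NNReal

variable {d : ℕ}

/-! ### The operator `π_L` on test functions -/

/-- A function into a normed space, continuous and with compact support in the half-space. -/
structure IsTest {X : Type*} [NormedAddCommGroup X] (f : Euc d × ℝ → X) : Prop where
  continuous : Continuous f
  compact : HasCompactSupport f
  support : tsupport f ⊆ halfSpace d

section Test

variable {X : Type*} [NormedAddCommGroup X] {f : Euc d × ℝ → X}

lemma isTest_of_mem [NormedSpace ℂ X] (hf : f ∈ testFunctions d X) : IsTest f := by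
  refine Submodule.span_induction ?_ ?_ ?_ ?_ hf
  · rintro _ ⟨φ, v, hφ, hc, hs, rfl⟩
    have hsub : tsupport (fun z => φ z • v) ⊆ tsupport φ :=
      closure_mono (Function.support_smul_subset_left _ _)
    exact ⟨hφ.smul continuous_const, hc.smul_right, hsub.trans hs⟩
  · exact ⟨continuous_zero, HasCompactSupport.zero, by simp⟩
  · intro f g _ _ hf hg
    exact ⟨hf.continuous.add hg.continuous, hf.compact.add hg.compact,
      (tsupport_add f g).trans (union_subset hf.support hg.support)⟩
  · intro a f _ hf
    refine ⟨hf.continuous.const_smul a, hf.compact.smul_left, ?_⟩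
    exact (closure_mono (Function.support_const_smul_subset a f)).trans hf.support

lemma IsTest.stronglyMeasurable (hf : IsTest f) : StronglyMeasurable f :=
  hf.continuous.stronglyMeasurable

/-- A test function is bounded and is supported in a box. -/
lemma IsTest.exists_box (hf : IsTest f) : ∃ R s t B : ℝ, 0 < s ∧ 0 ≤ B ∧ (∀ z, ‖f z‖ ≤ B) ∧
    ∀ z, z ∉ Metric.ball (0 : Euc d) R ×ˢ Icc s t → f z = 0 := by
  obtain ⟨B, hB⟩ := hf.continuous.bounded_above_of_compact_support hf.compact
  have hK : IsCompact (tsupport f) := hf.compact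
  rcases (tsupport f).eq_empty_or_nonempty with he | hne
  · refine ⟨1, 1, 1, max B 0, one_pos, le_max_right _ _, fun z => (hB z).trans (le_max_left _ _),
      fun z _ => image_eq_zero_of_notMem_tsupport (by simp [he])⟩
  · obtain ⟨z₀, hz₀, hmin⟩ := hK.exists_isMinOn hne continuous_snd.continuousOn
    obtain ⟨R, hR⟩ := hK.isBounded.subset_ball (0 : Euc d × ℝ)
    refine ⟨R, z₀.2, R, max B 0, hf.support hz₀, le_max_right _ _,
      fun z => (hB z).trans (le_max_left _ _), fun z hz => ?_⟩
    refine image_eq_zero_of_notMem_tsupport fun hzs => hz ?_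
    have h1 := hR hzs
    rw [mem_ball_zero_iff, Prod.norm_def, max_lt_iff] at h1
    exact ⟨mem_ball_zero_iff.2 h1.1, hmin hzs, (le_abs_self _).trans h1.2.le⟩

lemma IsTest.lintegral_rpow_lt_top (hf : IsTest f) (k : ℕ) {q : ℝ} (hq : 0 < q) :
    ∫⁻ z, ‖f z‖ₑ ^ q ∂hsMeasure d k < ∞ := by
  obtain ⟨R, s, t, B, hs, hB, hb, h0⟩ := hf.exists_box
  set S := Metric.ball (0 : Euc d) R ×ˢ Icc s t with hS
  have hSm : MeasurableSet S := measurableSet_ball.prod measurableSet_Icc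
  calc ∫⁻ z, ‖f z‖ₑ ^ q ∂hsMeasure d k
      ≤ ∫⁻ z, S.indicator (fun _ => ENNReal.ofReal B ^ q) z ∂hsMeasure d k := by
        refine lintegral_mono fun z => ?_
        by_cases hz : z ∈ S
        · rw [indicator_of_mem hz, ← ofReal_norm]
          exact ENNReal.rpow_le_rpow (ENNReal.ofReal_le_ofReal (hb z)) hq.le
        · rw [h0 z hz, enorm_zero, ENNReal.zero_rpow_of_pos hq]
          exact zero_le
    _ < ∞ := by
        rw [lintegral_indicator hSm, setLIntegral_const]
        exact ENNReal.mul_lt_top (ENNReal.rpow_lt_top_of_nonneg hq.le ENNReal.ofReal_ne_top)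
          (hsMeasure_prod_lt_top k measurableSet_ball (volume_ball_ne_top _ _) hs)

lemma IsTest.lintegral_lt_top (hf : IsTest f) (k : ℕ) : ∫⁻ z, ‖f z‖ₑ ∂hsMeasure d k < ∞ := by
  simpa using hf.lintegral_rpow_lt_top k one_pos

lemma IsTest.integrable_slice (hf : IsTest f) (t : ℝ) : Integrable fun y => f (y, t) := by
  obtain ⟨R, s, t', B, _, _, _, h0⟩ := hf.exists_box
  refine Continuous.integrable_of_hasCompactSupport
    (hf.continuous.comp (by fun_prop : Continuous fun y : Euc d => (y, t))) ?_
  refine HasCompactSupport.intro (isCompact_closedBall 0 R) fun y hy => h0 _ fun hz => hy ?_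
  exact Metric.ball_subset_closedBall hz.1

end Test

section HsIntegral

variable {X : Type*} [NormedAddCommGroup X] [NormedSpace ℂ X] {G : Euc d × ℝ → X}

lemma integrable_hsMeasure_one_iff : Integrable G (hsMeasure d 1) ↔
    Integrable (fun z : Euc d × ℝ => ((z.2 : ℂ)⁻¹) • G z)
      (volume.prod (volume.restrict (Ioi (0 : ℝ)))) := by
  have hm : Measurable fun z : Euc d × ℝ => ENNReal.ofReal ((z.2 ^ 1)⁻¹) := by fun_prop
  rw [hsMeasure, integrable_withDensity_iff_integrable_smul' hm
    (Eventually.of_forall fun z => ENNReal.ofReal_lt_top), ← volume_restrict_halfSpace]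
  refine integrable_congr ?_
  filter_upwards [ae_restrict_mem measurableSet_halfSpace] with z hz
  have hz' : 0 < z.2 := hz
  rw [ENNReal.toReal_ofReal (by positivity), pow_one, ← Complex.ofReal_inv, Complex.coe_smul]

lemma integral_hsMeasure_one (hG : Integrable G (hsMeasure d 1)) :
    ∫ z, G z ∂hsMeasure d 1 = ∫ t in Ioi (0 : ℝ), ((t : ℂ)⁻¹) • ∫ y, G (y, t) := by
  have hm : Measurable fun z : Euc d × ℝ => ENNReal.ofReal ((z.2 ^ 1)⁻¹) := by fun_prop
  have h1 : ∫ z, G z ∂hsMeasure d 1 = ∫ z, ((z.2 : ℂ)⁻¹) • G z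
      ∂(volume.prod (volume.restrict (Ioi (0 : ℝ)))) := by
    rw [hsMeasure, integral_withDensity_eq_integral_toReal_smul hm
      (Eventually.of_forall fun z => ENNReal.ofReal_lt_top), ← volume_restrict_halfSpace]
    refine integral_congr_ae ?_
    filter_upwards [ae_restrict_mem measurableSet_halfSpace] with z hz
    have hz' : 0 < z.2 := hz
    rw [ENNReal.toReal_ofReal (by positivity), pow_one, ← Complex.ofReal_inv, Complex.coe_smul]
  rw [h1, integral_prod_symm _ (integrable_hsMeasure_one_iff.1 hG)]
  exact integral_congr_ae (Eventually.of_forall fun t =>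
    integral_smul ((t : ℂ)⁻¹) fun y => G (y, t))

lemma integrableOn_hsMeasure_one (hG : Integrable G (hsMeasure d 1)) :
    IntegrableOn (fun t : ℝ => ((t : ℂ)⁻¹) • ∫ y, G (y, t)) (Ioi 0) := by
  have h1 := (integrable_hsMeasure_one_iff.1 hG).integral_prod_right
  exact h1.congr (Eventually.of_forall fun t => integral_smul ((t : ℂ)⁻¹) fun y => G (y, t))

end HsIntegral

variable {b : ℝ} {A C : ℝ≥0} {K : ℝ → Euc d → Euc d → ℂ}

/-- The kernel `k(t, x, y)` of `𝒬`, extended by zero to `t ≤ 0`. -/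
def cutKer (K : ℝ → Euc d → Euc d → ℂ) (t : ℝ) (x y : Euc d) : ℂ :=
  {p : ℝ × Euc d × Euc d | 0 < p.1}.indicator (fun p => kerQ K p.1 p.2.1 p.2.2) (t, x, y)

lemma cutKer_of_pos {t : ℝ} (ht : 0 < t) (x y : Euc d) : cutKer K t x y = kerQ K t x y :=
  indicator_of_mem (show (t, x, y) ∈ {p : ℝ × Euc d × Euc d | 0 < p.1} from ht) _

lemma cutKer_of_nonpos {t : ℝ} (ht : ¬ 0 < t) (x y : Euc d) : cutKer K t x y = 0 :=
  indicator_of_notMem (show (t, x, y) ∉ {p : ℝ × Euc d × Euc d | 0 < p.1} from ht) _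

namespace IsCalderonKernel

lemma measurable_cutKer (hK : IsCalderonKernel b A (kerQ K)) {α : Type*} [MeasurableSpace α]
    {t : α → ℝ} {x y : α → Euc d} (ht : Measurable t) (hx : Measurable x) (hy : Measurable y) :
    Measurable fun a => cutKer K (t a) (x a) (y a) :=
  hK.measurable.comp (ht.prodMk (hx.prodMk hy))

lemma enorm_cutKer_le (hK : IsCalderonKernel b A (kerQ K)) (t : ℝ) (x y : Euc d) :
    ‖cutKer K t x y‖ₑ ≤ A * ENNReal.ofReal (pois d b t (x - y)) := by
  by_cases ht : 0 < t
  · rw [cutKer_of_pos ht]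
    exact hK.bound t ht x y
  · rw [cutKer_of_nonpos ht, enorm_zero]
    exact zero_le

end IsCalderonKernel

lemma pois_le_zero_of_le {s t : ℝ} (hb : 0 < b) (hs : 0 < s) (hst : s ≤ t) (x : Euc d) :
    pois d b t x ≤ pois d b s 0 := by
  have ht := hs.trans_le hst
  have h1 : pois d b t x ≤ pois d b t 0 := by
    unfold pois
    gcongr
    simp
  refine h1.trans ?_
  have e1 := pois_zero_mul (d := d) (b := b) ht
  have e2 := pois_zero_mul (d := d) (b := b) hs
  rw [eq_div_of_mul_eq (by positivity) e1, eq_div_of_mul_eq (by positivity) e2]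
  gcongr

variable {X : Type*} [NormedAddCommGroup X] [NormedSpace ℂ X] {f : Euc d × ℝ → X}

lemma opQ_eq (g : Euc d → X) (z : Euc d × ℝ) :
    opQ K g z = ∫ y, cutKer K z.2 z.1 y • g y := by
  unfold opQ
  split_ifs with hz
  · simp only [cutKer_of_pos hz]
  · simp [cutKer_of_nonpos hz]

namespace IsCalderonKernel

lemma stronglyMeasurable_opQ (hK : IsCalderonKernel b A (kerQ K)) {g : Euc d → X}
    (hg : StronglyMeasurable g) : StronglyMeasurable (opQ K g) := by
  have h1 : StronglyMeasurable fun p : (Euc d × ℝ) × Euc d => cutKer K p.1.2 p.1.1 p.2 • g p.2 :=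
    (hK.measurable_cutKer (by fun_prop) (by fun_prop) (by fun_prop)).stronglyMeasurable.smul
      (hg.comp_measurable measurable_snd)
  have h2 := h1.integral_prod_right' (ν := (volume : Measure (Euc d)))
  convert h2 using 1
  ext z
  exact opQ_eq g z

lemma integrable_kerQ_smul (hK : IsCalderonKernel b A (kerQ K)) (hb : 0 < b) {g : Euc d → X}
    (hg : Integrable g) {t : ℝ} (ht : 0 < t) (x : Euc d) :
    Integrable fun y => kerQ K t x y • g y := by
  have hm : Measurable fun y => kerQ K t x y := by
    simp_rw [← cutKer_of_pos (K := K) ht]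
    exact hK.measurable_cutKer measurable_const measurable_const measurable_id
  refine ⟨hm.aestronglyMeasurable.smul hg.aestronglyMeasurable, ?_⟩
  calc ∫⁻ y, ‖kerQ K t x y • g y‖ₑ ≤ ∫⁻ y, A * ENNReal.ofReal (pois d b t 0) * ‖g y‖ₑ := by
        refine lintegral_mono fun y => ?_
        rw [enorm_smul]
        gcongr
        refine (hK.bound t ht x y).trans ?_
        gcongr
        exact pois_le_zero_of_le hb ht le_rfl _
    _ < ∞ := by
        rw [lintegral_const_mul' _ _ (ENNReal.mul_ne_top ENNReal.coe_ne_top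
          ENNReal.ofReal_ne_top)]
        exact ENNReal.mul_lt_top (ENNReal.mul_lt_top ENNReal.coe_lt_top ENNReal.ofReal_lt_top) hg.2

lemma stronglyMeasurable_integrand (hK : IsCalderonKernel b A (kerQ K)) (hf : IsTest f) :
    StronglyMeasurable fun p : Euc d × (Euc d × ℝ) => cutKer K p.2.2 p.1 p.2.1 • f p.2 :=
  (hK.measurable_cutKer (by fun_prop) (by fun_prop) (by fun_prop)).stronglyMeasurable.smul
    (hf.stronglyMeasurable.comp_measurable measurable_snd)

lemma integrable_integrand (hK : IsCalderonKernel b A (kerQ K)) (hb : 0 < b) (hf : IsTest f)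
    (x : Euc d) : Integrable (fun z : Euc d × ℝ => cutKer K z.2 x z.1 • f z) (hsMeasure d 1) := by
  obtain ⟨R, s, t, B, hs, hB, _, h0⟩ := hf.exists_box
  refine ⟨((hK.stronglyMeasurable_integrand hf).comp_measurable
    measurable_prodMk_left).aestronglyMeasurable, ?_⟩
  calc ∫⁻ z, ‖cutKer K z.2 x z.1 • f z‖ₑ ∂hsMeasure d 1
      ≤ ∫⁻ z, A * ENNReal.ofReal (pois d b s 0) * ‖f z‖ₑ ∂hsMeasure d 1 := by
        refine lintegral_mono fun z => ?_
        by_cases hz : z ∈ Metric.ball (0 : Euc d) R ×ˢ Icc s t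
        · rw [enorm_smul]
          gcongr
          refine (hK.enorm_cutKer_le _ _ _).trans ?_
          gcongr
          exact pois_le_zero_of_le hb hs hz.2.1 _
        · simp [h0 z hz]
    _ < ∞ := by
        rw [lintegral_const_mul' _ _ (ENNReal.mul_ne_top ENNReal.coe_ne_top
          ENNReal.ofReal_ne_top)]
        exact ENNReal.mul_lt_top (ENNReal.mul_lt_top ENNReal.coe_lt_top ENNReal.ofReal_lt_top)
          (hf.lintegral_lt_top 1)

lemma opPi_eq (hK : IsCalderonKernel b A (kerQ K)) (hb : 0 < b) (hf : IsTest f) (x : Euc d) :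
    opPi K f x = ∫ z, cutKer K z.2 x z.1 • f z ∂hsMeasure d 1 := by
  rw [integral_hsMeasure_one (hK.integrable_integrand hb hf x)]
  unfold opPi
  simp only [opQ_eq]

lemma stronglyMeasurable_opPi (hK : IsCalderonKernel b A (kerQ K)) (hb : 0 < b) (hf : IsTest f) :
    StronglyMeasurable (opPi K f) := by
  have := (hK.stronglyMeasurable_integrand hf).integral_prod_right' (ν := hsMeasure d 1)
  convert this using 1
  ext x
  exact hK.opPi_eq hb hf x

lemma piConverges (hK : IsCalderonKernel b A (kerQ K)) (hb : 0 < b) (hf : IsTest f) :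
    PiConverges K f := by
  refine fun x => ⟨fun t ht => hK.integrable_kerQ_smul hb (hf.integrable_slice t) ht x, ?_⟩
  have := integrableOn_hsMeasure_one (hK.integrable_integrand hb hf x)
  simpa only [opQ_eq] using this


lemma lintegral_cutKer_le (hK : IsCalderonKernel b A (kerQ K)) (hC : PoisMass d b C) (t : ℝ)
    (y : Euc d) : ∫⁻ x, ‖cutKer K t x y‖ₑ ≤ A * C := by
  by_cases ht : 0 < t
  · refine (lintegral_mono fun x => hK.enorm_cutKer_le t x y).trans ?_
    rw [lintegral_const_mul' _ _ ENNReal.coe_ne_top]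
    gcongr
    exact hC t y ht
  · simp [cutKer_of_nonpos ht]

/-- Absolute convergence of the double integral that defines `𝒬(π_L f)`. -/
lemma lintegral_integrand_lt_top (hK : IsCalderonKernel b A (kerQ K)) (hC : PoisMass d b C)
    (hf : IsTest f) : ∫⁻ x, ∫⁻ z, ‖cutKer K z.2 x z.1 • f z‖ₑ ∂hsMeasure d 1 < ∞ := by
  rw [lintegral_lintegral_swap
    (f := fun x (z : Euc d × ℝ) => ‖cutKer K z.2 x z.1 • f z‖ₑ)
    (hK.stronglyMeasurable_integrand hf).enorm.aemeasurable]
  calc _ ≤ ∫⁻ z, A * C * ‖f z‖ₑ ∂hsMeasure d 1 := by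
        refine lintegral_mono fun z => ?_
        simp only [enorm_smul]
        rw [lintegral_mul_const' _ _ enorm_ne_top]
        gcongr
        exact hK.lintegral_cutKer_le hC _ _
    _ < ∞ := by
        rw [lintegral_const_mul' _ _ (ENNReal.mul_ne_top ENNReal.coe_ne_top ENNReal.coe_ne_top)]
        exact ENNReal.mul_lt_top (ENNReal.mul_lt_top ENNReal.coe_lt_top ENNReal.coe_lt_top)
          (hf.lintegral_lt_top 1)

lemma integrable_opPi (hK : IsCalderonKernel b A (kerQ K)) (hb : 0 < b) (hC : PoisMass d b C)
    (hf : IsTest f) : Integrable (opPi K f) := by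
  refine ⟨(hK.stronglyMeasurable_opPi hb hf).aestronglyMeasurable, ?_⟩
  refine lt_of_le_of_lt (lintegral_mono fun x => ?_) (hK.lintegral_integrand_lt_top hC hf)
  rw [hK.opPi_eq hb hf x]
  exact enorm_integral_le_lintegral_enorm _

/-- The composition `𝒬 π_L` is an integral operator on the half-space. -/
lemma opQ_opPi_eq [CompleteSpace X] (hK : IsCalderonKernel b A (kerQ K)) (hb : 0 < b)
    (hC : PoisMass d b C) (hf : IsTest f) {z : Euc d × ℝ} (hz : 0 < z.2) :
    opQ K (opPi K f) z =
      ∫ w, (∫ u, kerQ K z.2 z.1 u * cutKer K w.2 u w.1) • f w ∂hsMeasure d 1 := by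
  have hm1 : Measurable fun u => kerQ K z.2 z.1 u := by
    simp_rw [← cutKer_of_pos (K := K) hz]
    exact hK.measurable_cutKer measurable_const measurable_const measurable_id
  have hint : Integrable (fun p : Euc d × (Euc d × ℝ) =>
      kerQ K z.2 z.1 p.1 • cutKer K p.2.2 p.1 p.2.1 • f p.2) (volume.prod (hsMeasure d 1)) := by
    have hsm : StronglyMeasurable fun p : Euc d × (Euc d × ℝ) =>
        kerQ K z.2 z.1 p.1 • cutKer K p.2.2 p.1 p.2.1 • f p.2 :=
      (hm1.comp measurable_fst).stronglyMeasurable.smul (hK.stronglyMeasurable_integrand hf)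
    refine ⟨hsm.aestronglyMeasurable, ?_⟩
    rw [HasFiniteIntegral, lintegral_prod _ hsm.enorm.aemeasurable]
    calc _ ≤ ∫⁻ u, A * ENNReal.ofReal (pois d b z.2 0) *
          ∫⁻ w, ‖cutKer K w.2 u w.1 • f w‖ₑ ∂hsMeasure d 1 := by
          refine lintegral_mono fun u => ?_
          simp only [enorm_smul (kerQ K z.2 z.1 u)]
          rw [lintegral_const_mul' _ _ enorm_ne_top]
          gcongr
          refine (hK.bound _ hz _ _).trans ?_
          gcongr
          exact pois_le_zero_of_le hb hz le_rfl _
      _ < ∞ := by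
          rw [lintegral_const_mul' _ _ (ENNReal.mul_ne_top ENNReal.coe_ne_top
            ENNReal.ofReal_ne_top)]
          exact ENNReal.mul_lt_top (ENNReal.mul_lt_top ENNReal.coe_lt_top ENNReal.ofReal_lt_top)
            (hK.lintegral_integrand_lt_top hC hf)
  calc opQ K (opPi K f) z
      = ∫ u, ∫ w, kerQ K z.2 z.1 u • cutKer K w.2 u w.1 • f w ∂hsMeasure d 1 := by
        rw [opQ, if_pos hz]
        refine integral_congr_ae (Eventually.of_forall fun u => ?_)
        simp only
        rw [hK.opPi_eq hb hf, integral_smul]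
    _ = _ := by
        rw [integral_integral_swap hint]
        refine integral_congr_ae (Eventually.of_forall fun w => ?_)
        simp only [smul_smul]
        exact integral_smul_const _ _

lemma enorm_opQ_opPi_le [CompleteSpace X] (hK : IsCalderonKernel b A (kerQ K)) (hb : 0 < b)
    (hC : PoisMass d b C) (hf : IsTest f) {z : Euc d × ℝ} (hz : 0 < z.2) :
    ‖opQ K (opPi K f) z‖ₑ ≤ A * tentOp b (fun w => ‖f w‖ₑ) z := by
  rw [hK.opQ_opPi_eq hb hC hf hz, tentOp, ← lintegral_const_mul' _ _ ENNReal.coe_ne_top]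
  refine (enorm_integral_le_lintegral_enorm _).trans (lintegral_mono_ae ?_)
  filter_upwards [ae_hsMeasure_pos 1] with w hw
  rw [enorm_smul, ← mul_assoc]
  gcongr
  simp only [cutKer_of_pos hw]
  exact hK.comp z.2 w.2 hz hw z.1 w.1

lemma memNeps_opPi (hK : IsCalderonKernel b A (kerQ K)) (hb : 0 < b) (hC : PoisMass d b C)
    (hf : IsTest f) {ε : ℝ} (hε : 0 ≤ ε) : MemNeps ε (opPi K f) := by
  have hi := hK.integrable_opPi hb hC hf
  have hm : Measurable fun x : Euc d => (1 + ‖x‖) ^ ((d : ℝ) + ε) :=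
    Measurable.pow_const (by fun_prop) _
  refine ⟨hi.locallyIntegrable, hi.norm.mono'
    (hi.aestronglyMeasurable.norm.aemeasurable.div hm.aemeasurable).aestronglyMeasurable
    (Eventually.of_forall fun x => ?_)⟩
  have h1 : (1 : ℝ) ≤ (1 + ‖x‖) ^ ((d : ℝ) + ε) :=
    Real.one_le_rpow (by linarith [norm_nonneg x]) (by positivity)
  rw [norm_div, norm_norm, Real.norm_of_nonneg (by linarith)]
  exact div_le_self (norm_nonneg _) h1

lemma inDomain_opPi (hK : IsCalderonKernel b A (kerQ K)) (hb : 0 < b) (hC : PoisMass d b C)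
    (hf : IsTest f) (L : L2 d →ₗ.[ℂ] L2 d) : InDomain L K (opPi K f) where
  memN := ⟨fun _ => hK.memNeps_opPi hb hC hf (Real.sSup_nonneg fun _ h => h.1.le),
    fun _ => ⟨1, one_pos, hK.memNeps_opPi hb hC hf zero_le_one⟩⟩
  integrable _ ht x := hK.integrable_kerQ_smul hb (hK.integrable_opPi hb hC hf) ht x
  measurable := (hK.stronglyMeasurable_opQ (hK.stronglyMeasurable_opPi hb hf)).aestronglyMeasurable

end IsCalderonKernel
end
end TentHardy

namespace TentHardy

noncomputable section

open scoped NNReal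

variable {d : ℕ}

/-! ### Density of the test functions in the tent space -/

section Density

variable {X : Type*} [NormedAddCommGroup X]

lemma tentNorm_eq_areaNorm (p q : ℝ) (f : Euc d × ℝ → X) :
    tentNorm p q f = areaNorm p q fun z => ‖f z‖ₑ := by
  unfold tentNorm areaNorm areaFun areaPow
  simp_rw [← ENNReal.rpow_mul, one_div_mul_eq_div]

lemma tentNorm_congr {p q : ℝ} {f g : Euc d × ℝ → X}
    (h : f =ᵐ[volume.restrict (halfSpace d)] g) : tentNorm p q f = tentNorm p q g := by
  have h' : f =ᵐ[hsMeasure d (d + 1)] g := (ac_hsMeasure (d + 1)).ae_le h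
  have : areaFun q f = areaFun q g := by
    funext x
    unfold areaFun
    congr 1
    refine lintegral_congr_ae ?_
    filter_upwards [ae_restrict_of_ae h'] with z hz
    rw [hz]
  rw [tentNorm, tentNorm, this]

/-- A continuous cutoff function, equal to `1` on a box of the half-space. -/
lemma exists_cutoff (R t : ℝ) {s : ℝ} (hs : 0 < s) : ∃ χ : Euc d × ℝ → ℝ, Continuous χ ∧
    HasCompactSupport χ ∧ tsupport χ ⊆ halfSpace d ∧ (∀ z, 0 ≤ χ z ∧ χ z ≤ 1) ∧
    (∀ z ∈ Metric.ball (0 : Euc d) R ×ˢ Icc s t, χ z = 1) ∧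
    ∀ z, z ∉ Metric.ball (0 : Euc d) (R + 1) ×ˢ Icc (s / 2) (t + 1) → χ z = 0 := by
  have hK : IsCompact (Metric.closedBall (0 : Euc d) R ×ˢ Icc s t) :=
    (isCompact_closedBall 0 R).prod isCompact_Icc
  have hU : IsOpen (Metric.ball (0 : Euc d) (R + 1) ×ˢ Ioo (s / 2) (t + 1)) :=
    Metric.isOpen_ball.prod isOpen_Ioo
  have hsub : Metric.closedBall (0 : Euc d) R ×ˢ Icc s t ⊆
      Metric.ball (0 : Euc d) (R + 1) ×ˢ Ioo (s / 2) (t + 1) :=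
    prod_mono (Metric.closedBall_subset_ball (by linarith))
      (Icc_subset_Ioo (by linarith) (by linarith))
  obtain ⟨χ, h1, h2, h3, h4⟩ := exists_continuousMap_one_of_isCompact_subset_isOpen hK hU hsub
  refine ⟨χ, χ.continuous, h2, fun z hz => ?_, fun z => h4 z, fun z hz => ?_, fun z hz => ?_⟩
  · have : s / 2 < z.2 := (h3 hz).2.1
    show 0 < z.2
    linarith
  · exact h1 ⟨Metric.ball_subset_closedBall hz.1, hz.2⟩
  · refine image_eq_zero_of_notMem_tsupport fun hzs => hz ?_
    exact ⟨(h3 hzs).1, Ioo_subset_Icc_self (h3 hzs).2⟩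

/-- Dominated convergence, in the cones and then in `x`. -/
lemma tendsto_tentNorm_of_dominated {p q : ℝ} (hp : 0 < p) (hq : 0 < q) {f : Euc d × ℝ → X}
    (hf : StronglyMeasurable f) (hfin : tentNorm p q f ≠ ∞) {F : ℕ → Euc d × ℝ → X}
    (hF : ∀ n, StronglyMeasurable (F n)) (hle : ∀ n z, ‖F n z‖ₑ ≤ ‖f z‖ₑ)
    (hlim : ∀ z, 0 < z.2 → ∀ᶠ n in atTop, F n z = 0) :
    Tendsto (fun n => tentNorm p q (F n)) atTop (𝓝 0) := by
  simp_rw [tentNorm_eq_areaNorm] at hfin ⊢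
  unfold areaNorm at hfin ⊢
  have hfin' : ∫⁻ x, areaPow q (fun z => ‖f z‖ₑ) x ^ (p / q) ≠ ∞ := fun h => by
    rw [h, ENNReal.top_rpow_of_pos (by positivity)] at hfin
    exact hfin rfl
  have hm := measurable_areaPow (q := q) hf.enorm
  have hae : ∀ᵐ x, areaPow q (fun z => ‖f z‖ₑ) x ≠ ∞ := by
    filter_upwards [ae_lt_top (hm.pow_const (p / q)) hfin'] with x hx h
    rw [h, ENNReal.top_rpow_of_pos (by positivity)] at hx
    exact hx.ne rfl
  have hmono : ∀ n x, areaPow q (fun z => ‖F n z‖ₑ) x ≤ areaPow q (fun z => ‖f z‖ₑ) x :=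
    fun n x => lintegral_mono fun z => ENNReal.rpow_le_rpow (hle n z) hq.le
  have h1 : ∀ᵐ x, Tendsto (fun n => areaPow q (fun z => ‖F n z‖ₑ) x ^ (p / q)) atTop (𝓝 0) := by
    filter_upwards [hae] with x hx
    have h2 : Tendsto (fun n => areaPow q (fun z => ‖F n z‖ₑ) x) atTop
        (𝓝 (∫⁻ _ in cone x, 0 ∂hsMeasure d (d + 1))) := by
      refine tendsto_lintegral_of_dominated_convergence (fun z => ‖f z‖ₑ ^ q)
        (fun n => (hF n).enorm.pow_const q)
        (fun n => Eventually.of_forall fun z => ENNReal.rpow_le_rpow (hle n z) hq.le) hx ?_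
      filter_upwards [ae_restrict_of_ae (ae_hsMeasure_pos (d + 1))] with z hz
      refine tendsto_const_nhds.congr' ?_
      filter_upwards [hlim z hz] with n hn
      rw [hn, enorm_zero, ENNReal.zero_rpow_of_pos hq]
    rw [lintegral_zero] at h2
    simpa [ENNReal.zero_rpow_of_pos (div_pos hp hq)] using h2.ennrpow_const (p / q)
  have h3 := tendsto_lintegral_of_dominated_convergence _
    (fun n => (measurable_areaPow (q := q) (hF n).enorm).pow_const (p / q))
    (fun n => Eventually.of_forall fun x =>
      ENNReal.rpow_le_rpow (hmono n x) (by positivity)) hfin' h1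
  rw [lintegral_zero] at h3
  simpa [ENNReal.zero_rpow_of_pos (inv_pos.2 hp)] using h3.ennrpow_const (1 / p)

variable [NormedSpace ℂ X]

/-- Approximation in `L^q` by continuous functions that become test functions after multiplication
by a cutoff function. -/
lemma exists_eLpNorm_sub_le_mul_mem_testFunctions {q : ℝ≥0∞} (hq' : q ≠ ∞)
    {F : Euc d × ℝ → X} (hF : MemLp F q volume) {ε : ℝ≥0∞} (hε : ε ≠ 0) :
    ∃ g : Euc d × ℝ → X, eLpNorm (F - g) q volume ≤ ε ∧ Continuous g ∧
      ∀ χ : Euc d × ℝ → ℂ, Continuous χ → HasCompactSupport χ → tsupport χ ⊆ halfSpace d →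
        (fun z => χ z • g z) ∈ testFunctions d X := by
  refine hF.induction_dense hq' (P := fun g => Continuous g ∧
      ∀ χ : Euc d × ℝ → ℂ, Continuous χ → HasCompactSupport χ → tsupport χ ⊆ halfSpace d →
        (fun z => χ z • g z) ∈ testFunctions d X) ?_ ?_ ?_ hε
  · intro c S hS hSfin ε hε
    rcases eq_or_ne c 0 with rfl | hc
    · refine ⟨0, by simp, continuous_zero, fun χ _ _ _ => ?_⟩
      have e : (fun z => χ z • (0 : Euc d × ℝ → X) z) = 0 := by
        funext z
        simp
      rw [e]
      exact zero_mem _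
    have hc' : ‖c‖ₑ ≠ 0 := by simpa using hc
    have h1 : MemLp (S.indicator fun _ : Euc d × ℝ => (1 : ℂ)) q volume :=
      memLp_indicator_const q hS 1 (Or.inr hSfin.ne)
    obtain ⟨φ, hφ, _⟩ := h1.exists_boundedContinuous_eLpNorm_sub_le hq'
      (ENNReal.div_ne_zero.2 ⟨hε, (enorm_ne_top : ‖c‖ₑ ≠ ∞)⟩)
    refine ⟨fun z => φ z • c, ?_, φ.continuous.smul continuous_const, fun χ h1 h2 h3 => ?_⟩
    · have e : ((fun z => φ z • c) - S.indicator fun _ => c) =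
          fun z => (φ z - S.indicator (fun _ => (1 : ℂ)) z) • c := by
        funext z
        by_cases hz : z ∈ S <;> simp [hz, sub_smul]
      refine (eLpNorm_le_nnreal_smul_eLpNorm_of_ae_le_mul (c := ‖c‖₊)
        (g := (S.indicator fun _ => (1 : ℂ)) - ⇑φ) (Eventually.of_forall fun z => ?_) q).trans ?_
      · rw [e, nnnorm_smul, mul_comm, Pi.sub_apply, ← nnnorm_neg (φ z - _), neg_sub]
      · rw [ENNReal.smul_def, smul_eq_mul, ← enorm_eq_nnnorm]
        calc _ ≤ ‖c‖ₑ * (ε / ‖c‖ₑ) := mul_le_mul_right hφ _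
          _ = ε := ENNReal.mul_div_cancel hc' enorm_ne_top
    · refine Submodule.subset_span ⟨fun z => χ z * φ z, c, h1.mul φ.continuous, h2.mul_right,
        (tsupport_mul_subset_left).trans h3, ?_⟩
      funext z
      rw [mul_smul]
  · rintro f g ⟨hf, hf'⟩ ⟨hg, hg'⟩
    refine ⟨hf.add hg, fun χ h1 h2 h3 => ?_⟩
    have e : (fun z => χ z • (f + g) z) = (fun z => χ z • f z) + fun z => χ z • g z := by
      funext z
      simp
    rw [e]
    exact add_mem (hf' χ h1 h2 h3) (hg' χ h1 h2 h3)
  · exact fun f hf => hf.1.aestronglyMeasurable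

/-- Approximation of a bounded function supported in a box of the half-space. -/
lemma exists_testFunction_tentNorm_sub_le {p q : ℝ} (hp : 1 ≤ p) (hq : 1 < q)
    {R s t B : ℝ} (hs : 0 < s) {F : Euc d × ℝ → X} (hF : StronglyMeasurable F)
    (hB : ∀ z, ‖F z‖ ≤ B) (h0 : ∀ z, z ∉ Metric.ball (0 : Euc d) R ×ˢ Icc s t → F z = 0)
    {ε : ℝ≥0∞} (hε : ε ≠ 0) : ∃ h ∈ testFunctions d X, tentNorm p q (F - h) ≤ ε := by
  have hp0 : 0 < p := by linarith
  have hq0 : 0 < q := by linarith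
  -- the approximant `χ g` has the error `χ (F - g)`, supported in a box, on which the measures
  -- `dy dt / t^{d+1}` and `dy dt` are comparable
  obtain ⟨χ, hχ, hχc, hχs, hχ1, hχ2, hχ3⟩ := exists_cutoff (d := d) R t hs
  set V := volume (Metric.ball (0 : Euc d) (R + 1 + (t + 1))) with hV
  have hVtop : V ≠ ∞ := volume_ball_ne_top _ _
  set W := ENNReal.ofReal (((s / 2) ^ (d + 1))⁻¹) with hW
  have hFp : MemLp F (ENNReal.ofReal q) volume := by
    have hS : MeasurableSet (Metric.ball (0 : Euc d) R ×ˢ Icc s t) :=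
      measurableSet_ball.prod measurableSet_Icc
    have hfin : volume (Metric.ball (0 : Euc d) R ×ˢ Icc s t) ≠ ∞ := by
      rw [Measure.volume_eq_prod, Measure.prod_prod]
      exact ENNReal.mul_ne_top (volume_ball_ne_top _ _) (by simp)
    refine (memLp_indicator_const (ENNReal.ofReal q) hS B (Or.inr hfin)).mono
      hF.aestronglyMeasurable (Eventually.of_forall fun z => ?_)
    by_cases hz : z ∈ Metric.ball (0 : Euc d) R ×ˢ Icc s t
    · rw [indicator_of_mem hz]
      exact (hB z).trans (le_abs_self _)
    · simp [h0 z hz]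
  obtain ⟨δ, hδ0, hδ⟩ : ∃ δ : ℝ≥0, 0 < δ ∧ (W ^ (1 / q) * V ^ (1 / p)) * δ < ε := by
    obtain ⟨δ, h1, h2⟩ := ENNReal.exists_nnreal_pos_mul_lt (a := W ^ (1 / q) * V ^ (1 / p))
      (ENNReal.mul_ne_top (ENNReal.rpow_ne_top_of_nonneg (by positivity) ENNReal.ofReal_ne_top)
        (ENNReal.rpow_ne_top_of_nonneg (by positivity) hVtop)) hε
    exact ⟨δ, h1, by rwa [mul_comm]⟩
  obtain ⟨g, hg, hgc, hgt⟩ := exists_eLpNorm_sub_le_mul_mem_testFunctions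
    ENNReal.ofReal_ne_top hFp (ENNReal.coe_ne_zero.2 hδ0.ne')
  have hgm : StronglyMeasurable g := hgc.stronglyMeasurable
  refine ⟨_, hgt (fun z => (χ z : ℂ)) (Complex.continuous_ofReal.comp hχ)
    (hχc.comp_left (g := ((↑) : ℝ → ℂ)) Complex.ofReal_zero)
    ((closure_mono (Function.support_comp_subset Complex.ofReal_zero χ)).trans hχs), ?_⟩
  have hpt : ∀ z, ‖(F - fun z => (χ z : ℂ) • g z) z‖ₑ ≤ ‖(F - g) z‖ₑ := by
    intro z
    have e : (F - fun z => (χ z : ℂ) • g z) z = (χ z : ℂ) • (F - g) z := by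
      simp only [Pi.sub_apply, smul_sub]
      by_cases hz : z ∈ Metric.ball (0 : Euc d) R ×ˢ Icc s t
      · simp [hχ2 z hz]
      · simp [h0 z hz]
    rw [e, enorm_smul]
    refine mul_le_of_le_one_left zero_le ?_
    rw [← ofReal_norm, Complex.norm_real, Real.norm_of_nonneg (hχ1 z).1]
    exact ENNReal.ofReal_le_one.2 (hχ1 z).2
  have hsupp : ∀ z, z ∉ Metric.ball (0 : Euc d) (R + 1) ×ˢ Icc (s / 2) (t + 1) →
      ‖(F - fun z => (χ z : ℂ) • g z) z‖ₑ = 0 := by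
    intro z hz
    have hz' : z ∉ Metric.ball (0 : Euc d) R ×ˢ Icc s t := fun h => hz
      ⟨Metric.ball_subset_ball (by linarith) h.1, by linarith [h.2.1], by linarith [h.2.2]⟩
    simp [hχ3 z hz, h0 z hz']
  have hint : ∫⁻ z, ‖(F - fun z => (χ z : ℂ) • g z) z‖ₑ ^ q ∂hsMeasure d (d + 1) ≤
      W * ∫⁻ z, ‖(F - g) z‖ₑ ^ q := by
    have hm : Measurable fun z : Euc d × ℝ => ENNReal.ofReal ((z.2 ^ (d + 1))⁻¹) := by fun_prop
    rw [← lintegral_const_mul' _ _ ENNReal.ofReal_ne_top]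
    refine (lintegral_withDensity_le_lintegral_mul _ hm _).trans
      ((setLIntegral_le_lintegral _ _).trans (lintegral_mono fun z => ?_))
    rw [Pi.mul_apply]
    by_cases hz : z ∈ Metric.ball (0 : Euc d) (R + 1) ×ˢ Icc (s / 2) (t + 1)
    · gcongr
      · exact hz.2.1
      · exact hpt z
    · rw [hsupp z hz, ENNReal.zero_rpow_of_pos hq0, mul_zero]
      exact zero_le
  have hnorm : (∫⁻ z, ‖(F - g) z‖ₑ ^ q) ^ (1 / q) ≤ δ := by
    rw [eLpNorm_eq_lintegral_rpow_enorm_toReal (by simpa using hq0) ENNReal.ofReal_ne_top,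
      ENNReal.toReal_ofReal hq0.le] at hg
    exact hg
  rw [tentNorm_eq_areaNorm, areaNorm]
  calc _ ≤ ((W * ∫⁻ z, ‖(F - g) z‖ₑ ^ q) ^ (p / q) * V) ^ (1 / p) := by
        gcongr
        refine (lintegral_areaPow_rpow_le_of_box hp0 hq0 hsupp).trans ?_
        gcongr
    _ = (W ^ (1 / q) * V ^ (1 / p)) * (∫⁻ z, ‖(F - g) z‖ₑ ^ q) ^ (1 / q) := by
        rw [ENNReal.mul_rpow_of_nonneg _ _ (by positivity), ← ENNReal.rpow_mul,
          show p / q * (1 / p) = 1 / q by field_simp,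
          ENNReal.mul_rpow_of_nonneg _ _ (by positivity)]
        ring
    _ ≤ (W ^ (1 / q) * V ^ (1 / p)) * δ := by gcongr
    _ ≤ ε := hδ.le

/-- Density of the test functions: truncation to a box and to bounded values, then approximation in
`L^q`. -/
lemma exists_testFunction_tentNorm_sub_lt {p q : ℝ} (hp : 1 ≤ p) (hq : 1 < q)
    {f : Euc d × ℝ → X} (hf : MemTent p q f) {ε : ℝ≥0∞} (hε : ε ≠ 0)
    (hε' : ε ≠ ∞) : ∃ h ∈ testFunctions d X, tentNorm p q (f - h) < ε := by
  obtain ⟨⟨g, hg, hfg⟩, hfin⟩ := hf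
  set S : ℕ → Set (Euc d × ℝ) := fun n =>
    (Metric.ball (0 : Euc d) n ×ˢ Icc ((n : ℝ) + 1)⁻¹ n) ∩ {z | ‖g z‖ ≤ n} with hS
  have hSm : ∀ n, MeasurableSet (S n) := fun n =>
    (measurableSet_ball.prod measurableSet_Icc).inter
      (measurableSet_le hg.norm.measurable measurable_const)
  have hlim : Tendsto (fun n => tentNorm p q (g - (S n).indicator g)) atTop (𝓝 0) := by
    refine tendsto_tentNorm_of_dominated (by linarith) (by linarith) hg
      (tentNorm_congr hfg ▸ hfin.ne) (fun n => hg.sub (hg.indicator (hSm n))) (fun n z => ?_)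
      fun z hz => ?_
    · by_cases hzS : z ∈ S n <;> simp [hzS]
    · obtain ⟨N, hN⟩ := exists_nat_gt (max (max ‖z.1‖ z.2) (max (z.2)⁻¹ ‖g z‖))
      simp only [max_lt_iff] at hN
      filter_upwards [eventually_ge_atTop N] with n hn
      have hn' : (N : ℝ) ≤ n := by exact_mod_cast hn
      have hzS : z ∈ S n := by
        refine ⟨⟨mem_ball_zero_iff.2 (by linarith), ?_, by linarith⟩, ?_⟩
        · exact inv_le_of_inv_le₀ hz (by linarith)
        · show ‖g z‖ ≤ n
          linarith
      simp [hzS]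
  obtain ⟨n, hn⟩ := (hlim.eventually (gt_mem_nhds (ENNReal.half_pos hε))).exists
  obtain ⟨h, hh, hlt⟩ := exists_testFunction_tentNorm_sub_le (p := p) (q := q) hp hq
    (by positivity : 0 < ((n : ℝ) + 1)⁻¹) (hg.indicator (hSm n)) (B := n) (R := n) (t := n)
    (fun z => by
      by_cases hz : z ∈ S n
      · rw [indicator_of_mem hz]
        exact hz.2
      · simp [hz])
    (fun z hz => indicator_of_notMem (fun h => hz h.1) _) (ENNReal.half_pos hε).ne'
  refine ⟨h, hh, ?_⟩
  have hhm := (isTest_of_mem hh).stronglyMeasurable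
  calc tentNorm p q (f - h) = tentNorm p q ((g - (S n).indicator g) + ((S n).indicator g - h)) := by
        refine tentNorm_congr ?_
        filter_upwards [hfg] with z hz
        simp [hz]
    _ ≤ _ := tentNorm_add_le hp hq.le (hg.sub (hg.indicator (hSm n))).aestronglyMeasurable
        ((hg.indicator (hSm n)).sub hhm).aestronglyMeasurable
    _ < ε / 2 + ε / 2 := ENNReal.add_lt_add_of_lt_of_le (ne_top_of_le_ne_top
        (ENNReal.div_ne_top hε' two_ne_zero) hlt) hn hlt
    _ = ε := ENNReal.add_halves ε

end Density
end
end TentHardy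

namespace TentHardy

noncomputable section

open scoped NNReal

variable {d : ℕ}

/-! ### The extension of `π_L` to the tent space -/

/-- Since `ν < π / 2`, the right half-plane lies in the resolvent set of `-L`. -/
lemma hasLeftResolvent_of_resolventBound {L : L2 d →ₗ.[ℂ] L2 d} {T : ℝ → L2 d →L[ℂ] L2 d}
    {ν M : ℝ} (hν : ν < Real.pi / 2) (hM : ResolventBound L ν M) (hT : IsSemigroupOf L T) :
    HasLeftResolvent T M := by
  intro l hl
  have hz : -l ∉ sector ν := fun h => by
    have h1 := Complex.abs_arg_le_pi_div_two_iff.1 (le_trans h hν.le)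
    rw [Complex.neg_re] at h1
    linarith
  obtain ⟨R, hR, hRM⟩ := hM _ hz
  refine ⟨-R, by rwa [smul_neg, ← neg_smul], fun u g hug => ?_⟩
  obtain ⟨y, rfl, rfl⟩ := (LinearPMap.mem_graph_iff L).1 ((hT.generator u g).2 hug)
  have := hR.2 y
  rw [neg_apply, ← map_neg]
  convert this using 2
  simp only [neg_smul]
  abel

lemma exists_isHeatFlow {β γ c ν M : ℝ} {L : L2 d →ₗ.[ℂ] L2 d} {K : ℝ → Euc d → Euc d → ℂ}
    (hβ : 0 < β) (hγ : 0 < γ) (hc : 0 < c) (hν : ν < Real.pi / 2) (hM : ResolventBound L ν M)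
    (hK : IsHeatKernel L K) (hA : KernelAssumptions β γ c K) :
    ∃ T, IsHeatFlow β γ c M K T := by
  obtain ⟨T, hT, hTK⟩ := hK
  exact ⟨T, hβ, hγ, hc, hTK, hA, hT.zero, hT.add, hT.cont,
    hasLeftResolvent_of_resolventBound hν hM hT⟩

lemma areaNorm_le_mul {p q : ℝ} (hp : 0 < p) (hq : 0 < q) {f g : Euc d × ℝ → ℝ≥0∞} {A : ℝ≥0}
    (h : ∀ z, f z ≤ A * g z) : areaNorm p q f ≤ A * areaNorm p q g := by
  have h1 : ∀ x, areaPow q f x ≤ A ^ q * areaPow q g x := fun x => by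
    unfold areaPow
    rw [← lintegral_const_mul' _ _ (ENNReal.rpow_ne_top_of_nonneg hq.le ENNReal.coe_ne_top)]
    refine lintegral_mono fun z => ?_
    rw [← ENNReal.mul_rpow_of_nonneg _ _ hq.le]
    exact ENNReal.rpow_le_rpow (h z) hq.le
  unfold areaNorm
  calc _ ≤ (∫⁻ x, (A : ℝ≥0∞) ^ p * areaPow q g x ^ (p / q)) ^ (1 / p) := by
        gcongr with x
        refine (ENNReal.rpow_le_rpow (h1 x) (by positivity)).trans ?_
        rw [ENNReal.mul_rpow_of_nonneg _ _ (by positivity), ← ENNReal.rpow_mul,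
          mul_div_cancel₀ _ hq.ne']
    _ = _ := by
        rw [lintegral_const_mul' _ _ (ENNReal.rpow_ne_top_of_nonneg hp.le ENNReal.coe_ne_top),
          ENNReal.mul_rpow_of_nonneg _ _ (by positivity), ← ENNReal.rpow_mul,
          mul_one_div_cancel hp.ne', ENNReal.rpow_one]

lemma carlFun_le_mul {q : ℝ} (hq : 0 < q) {f g : Euc d × ℝ → ℝ≥0∞} {A : ℝ≥0}
    (h : ∀ z, f z ≤ A * g z) (x : Euc d) : carlFun q f x ≤ A * carlFun q g x := by
  refine carlFun_le hq _ fun a r hr hx => ?_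
  calc _ ≤ ∫⁻ z in tent (Metric.ball a r), (A : ℝ≥0∞) ^ q * g z ^ q ∂hsMeasure d 1 := by
        refine lintegral_mono fun z => ?_
        rw [← ENNReal.mul_rpow_of_nonneg _ _ hq.le]
        exact ENNReal.rpow_le_rpow (h z) hq.le
    _ = (A : ℝ≥0∞) ^ q * ∫⁻ z in tent (Metric.ball a r), g z ^ q ∂hsMeasure d 1 :=
        lintegral_const_mul' _ _ (ENNReal.rpow_ne_top_of_nonneg hq.le ENNReal.coe_ne_top)
    _ ≤ (A : ℝ≥0∞) ^ q * (volume (Metric.ball a r) * carlFun q g x ^ q) := by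
        gcongr
        exact lintegral_tent_le hq g hr hx
    _ = _ := by rw [ENNReal.mul_rpow_of_nonneg _ _ hq.le]; ring

section

variable {X : Type*} [NormedAddCommGroup X] {f : Euc d × ℝ → X}

lemma memTent_of_isTest {p q : ℝ} (hp : 0 < p) (hq : 0 < q) (hf : IsTest f) : MemTent p q f := by
  refine ⟨hf.stronglyMeasurable.aestronglyMeasurable, ?_⟩
  obtain ⟨R, s, t, B, hs, hB, hb, h0⟩ := hf.exists_box
  rw [tentNorm_eq_areaNorm, areaNorm]
  refine ENNReal.rpow_lt_top_of_nonneg (by positivity) ?_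
  exact lintegral_areaPow_ne_top hp hq (R := R) (s := s) (t := t)
    (fun z hz => by rw [h0 z hz, enorm_zero]) (hf.lintegral_rpow_lt_top _ hq).ne

variable [NormedSpace ℂ X]

variable (d X) in
/-- The inclusion of the test functions into the tent space. -/
def testToTent (p q : ℝ) [hp : Fact (1 ≤ p)] [hq : Fact (1 < q)] :
    testFunctions d X →ₗ[ℂ] TentSpace d X p q where
  toFun f := (⟨f.1, memTent_of_isTest (zero_lt_one.trans_le hp.out)
    (zero_lt_one.trans hq.out) (isTest_of_mem f.2)⟩ : tentSubmodule d X p q)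
  map_add' _ _ := rfl
  map_smul' _ _ := rfl

lemma denseRange_testToTent (p q : ℝ) [hp : Fact (1 ≤ p)] [hq : Fact (1 < q)] :
    DenseRange (testToTent d X p q) := by
  refine Metric.denseRange_iff.2 fun f ε hε => ?_
  obtain ⟨h, hh, hlt⟩ := exists_testFunction_tentNorm_sub_lt hp.out hq.out f.2
    (ENNReal.ofReal_pos.2 hε).ne' ENNReal.ofReal_ne_top
  refine ⟨⟨h, hh⟩, ?_⟩
  rw [dist_eq_norm, tentSpace_norm_def]
  exact (ENNReal.lt_ofReal_iff_toReal_lt hlt.ne_top).1 hlt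

variable {b : ℝ} {A C D : ℝ≥0} {K : ℝ → Euc d → Euc d → ℂ}

namespace IsCalderonKernel

lemma opPi_add (hK : IsCalderonKernel b A (kerQ K)) (hb : 0 < b) {g : Euc d × ℝ → X}
    (hf : IsTest f) (hg : IsTest g) (hfg : IsTest (f + g)) :
    opPi K (f + g) = opPi K f + opPi K g := by
  funext x
  rw [Pi.add_apply, hK.opPi_eq hb hf, hK.opPi_eq hb hg, hK.opPi_eq hb hfg,
    ← integral_add (hK.integrable_integrand hb hf x) (hK.integrable_integrand hb hg x)]
  simp only [Pi.add_apply, smul_add]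

lemma opPi_smul (hK : IsCalderonKernel b A (kerQ K)) (hb : 0 < b) (a : ℂ)
    (hf : IsTest f) (haf : IsTest (a • f)) : opPi K (a • f) = a • opPi K f := by
  funext x
  rw [Pi.smul_apply, hK.opPi_eq hb hf, hK.opPi_eq hb haf, ← integral_smul]
  simp only [Pi.smul_apply, smul_comm _ a]

variable [CompleteSpace X]

lemma enorm_opQ_opPi_le' (hK : IsCalderonKernel b A (kerQ K)) (hb : 0 < b)
    (hC : PoisMass d b C) (hf : IsTest f) (z : Euc d × ℝ) :
    ‖opQ K (opPi K f) z‖ₑ ≤ A * tentOp b (fun w => ‖f w‖ₑ) z := by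
  by_cases hz : 0 < z.2
  · exact hK.enorm_opQ_opPi_le hb hC hf hz
  · rw [opQ, if_neg hz, enorm_zero]
    exact zero_le

lemma tentNorm_opQ_opPi_le (hK : IsCalderonKernel b A (kerQ K)) (hb : 0 < b)
    (hC : PoisMass d b C) {p q : ℝ} (hp : 1 ≤ p) (hq : 1 < q)
    (hD : ∀ f : Euc d × ℝ → ℝ≥0∞, Measurable f →
      areaNorm p q (tentOp b f) ≤ D * ENNReal.ofReal p ^ (1 / q) * areaNorm p q f)
    (hf : IsTest f) :
    tentNorm p q (opQ K (opPi K f)) ≤ A * (D * ENNReal.ofReal p ^ (1 / q) * tentNorm p q f) := by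
  rw [tentNorm_eq_areaNorm, tentNorm_eq_areaNorm]
  refine (areaNorm_le_mul (by linarith) (by linarith) (hK.enorm_opQ_opPi_le' hb hC hf)).trans ?_
  gcongr
  exact hD _ hf.stronglyMeasurable.enorm

lemma opPi_mem_hardySubmodule (hK : IsCalderonKernel b A (kerQ K)) (hb : 0 < b)
    (hC : PoisMass d b C) {p q : ℝ} [hp : Fact (1 ≤ p)] [hq : Fact (1 < q)]
    (hD : ∀ f : Euc d × ℝ → ℝ≥0∞, Measurable f →
      areaNorm p q (tentOp b f) ≤ D * ENNReal.ofReal p ^ (1 / q) * areaNorm p q f)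
    (L : L2 d →ₗ.[ℂ] L2 d) (hf : IsTest f) : opPi K f ∈ hardySubmodule X L K p q := by
  have hdom := hK.inDomain_opPi hb hC hf L
  have hp0 : 0 < p := zero_lt_one.trans_le hp.out
  have hq0 : 0 < q := zero_lt_one.trans hq.out
  refine ⟨hdom, hdom.measurable,
    (hK.tentNorm_opQ_opPi_le hb hC hp.out hq.out hD hf).trans_lt ?_⟩
  exact ENNReal.mul_lt_top ENNReal.coe_lt_top (ENNReal.mul_lt_top (ENNReal.mul_lt_top
    ENNReal.coe_lt_top (ENNReal.rpow_lt_top_of_nonneg (by positivity) ENNReal.ofReal_ne_top))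
    (memTent_of_isTest hp0 hq0 hf).2)

/-- The bounded extension of `π_L`, by density of the test functions in the tent space. -/
theorem exists_extendsPi (hK : IsCalderonKernel b A (kerQ K)) (hb : 0 < b)
    (hC : PoisMass d b C) {p q : ℝ} [hp : Fact (1 ≤ p)] [hq : Fact (1 < q)]
    (hD : ∀ f : Euc d × ℝ → ℝ≥0∞, Measurable f →
      areaNorm p q (tentOp b f) ≤ D * ENNReal.ofReal p ^ (1 / q) * areaNorm p q f)
    (L : L2 d →ₗ.[ℂ] L2 d) :
    ∃ P : TentSpace d X p q →L[ℂ] HardyCompletion X L K p q, ExtendsPi L K p q P ∧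
      (∀ P' : TentSpace d X p q →L[ℂ] HardyCompletion X L K p q,
        ExtendsPi L K p q P' → P' = P) ∧
      ∀ f : TentSpace d X p q, ‖P f‖ ≤ A * D * p ^ (1 / q) * ‖f‖ := by
  have hp0 : 0 < p := zero_lt_one.trans_le hp.out
  have hq0 : 0 < q := zero_lt_one.trans hq.out
  have hmem : ∀ f : testFunctions d X, opPi K f.1 ∈ hardySubmodule X L K p q := fun f =>
    hK.opPi_mem_hardySubmodule hb hC hD L (isTest_of_mem f.2)
  let π₀ : testFunctions d X →ₗ[ℂ] HardySpace X L K p q :=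
    { toFun := fun f => (⟨opPi K f.1, hmem f⟩ : hardySubmodule X L K p q)
      map_add' := fun f g => Subtype.ext (hK.opPi_add hb (isTest_of_mem f.2)
        (isTest_of_mem g.2) (isTest_of_mem (f + g).2))
      map_smul' := fun a f => Subtype.ext (hK.opPi_smul hb a (isTest_of_mem f.2)
        (isTest_of_mem (a • f).2)) }
  let π₁ : testFunctions d X →ₗ[ℂ] HardyCompletion X L K p q :=
    (UniformSpace.Completion.toComplL (𝕜 := ℂ) (E := HardySpace X L K p q)).toLinearMap ∘ₗ π₀
  have hbound : ∀ f, ‖π₁ f‖ ≤ A * D * p ^ (1 / q) * ‖testToTent d X p q f‖ := fun f => by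
    have h1 := hK.tentNorm_opQ_opPi_le hb hC hp.out hq.out hD (isTest_of_mem f.2)
    have h2 : tentNorm p q f.1 ≠ ∞ := (memTent_of_isTest hp0 hq0 (isTest_of_mem f.2)).2.ne
    have e : ‖π₁ f‖ = (tentNorm p q (opQ K (opPi K f.1))).toReal :=
      (UniformSpace.Completion.norm_coe (π₀ f)).trans (hardySpace_norm_def L K p q (π₀ f))
    rw [e, tentSpace_norm_def]
    refine (ENNReal.toReal_mono ?_ h1).trans (le_of_eq ?_)
    · exact ENNReal.mul_ne_top ENNReal.coe_ne_top (ENNReal.mul_ne_top (ENNReal.mul_ne_top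
        ENNReal.coe_ne_top (ENNReal.rpow_ne_top_of_nonneg (by positivity) ENNReal.ofReal_ne_top))
        h2)
    · rw [ENNReal.toReal_mul, ENNReal.toReal_mul, ENNReal.toReal_mul, ← ENNReal.toReal_rpow,
        ENNReal.toReal_ofReal hp0.le, ENNReal.coe_toReal, ENNReal.coe_toReal]
      simp only [mul_assoc]
      rfl
  have hdense := denseRange_testToTent (d := d) (X := X) p q
  refine ⟨π₁.extendOfNorm (testToTent d X p q), fun f hf => ⟨_, hmem ⟨f, hf⟩,
    LinearMap.extendOfNorm_eq hdense ⟨_, hbound⟩ ⟨f, hf⟩⟩, fun P' hP' => ?_,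
    LinearMap.norm_extendOfNorm_apply_le hdense _ hbound⟩
  refine (LinearMap.extendOfNorm_unique hdense _ hbound P' (LinearMap.ext fun f => ?_)).symm
  obtain ⟨_, _, h⟩ := hP' f.1 f.2
  exact h

lemma bmoNorm_opPi_le (hK : IsCalderonKernel b A (kerQ K)) (hb : 0 < b)
    (hC : PoisMass d b C) {q : ℝ} (hq : 1 < q)
    (hD : ∀ (f : Euc d × ℝ → ℝ≥0∞) (x : Euc d), Measurable f →
      carlFun q (tentOp b f) x ≤ D * carlFun q f x)
    (p : ℝ≥0∞) (hf : IsTest f) :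
    bmoNorm K p q (opPi K f) ≤ (A * D : ℝ≥0) * carlesonNorm p q f := by
  refine eLpNorm_le_nnreal_smul_eLpNorm_of_ae_le_mul' (Eventually.of_forall fun x => ?_) p
  rw [enorm_eq_self, enorm_eq_self, ENNReal.coe_mul, mul_assoc]
  calc carlFun q (fun z => ‖opQ K (opPi K f) z‖ₑ) x
      ≤ A * carlFun q (tentOp b fun w => ‖f w‖ₑ) x :=
        carlFun_le_mul (by linarith) (hK.enorm_opQ_opPi_le' hb hC hf) x
    _ ≤ A * (D * carlFun q (fun w => ‖f w‖ₑ) x) := by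
        gcongr
        exact hD _ x hf.stronglyMeasurable.enorm

end IsCalderonKernel

end
end
end TentHardy

theorem lemma3p6 (d : ℕ) (hd : 0 < d) (β c ν M : ℝ) (hβ : 0 < β) (hc : 0 < c)
    (hν : ν < Real.pi / 2) :
    ∃ C : ℝ, 0 < C ∧
      ∀ (α γ : ℝ) (L : L2 d →ₗ.[ℂ] L2 d) (K : ℝ → Euc d → Euc d → ℂ),
        0 ≤ α → α < ν → 0 < γ → γ ≤ 1 →
        IsSectorial L α → ResolventBound L ν M → IsHeatKernel L K → KernelAssumptions β γ c K →
      ∀ (X : Type u) [NormedAddCommGroup X] [NormedSpace ℂ X] [CompleteSpace X]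
        (q : ℝ) [Fact (1 < q)],
        (∀ f ∈ testFunctions d X, PiConverges K f) ∧
        (∀ (p : ℝ) [Fact (1 ≤ p)],
          ∃ P : TentSpace d X p q →L[ℂ] HardyCompletion X L K p q,
            ExtendsPi L K p q P ∧
            (∀ P' : TentSpace d X p q →L[ℂ] HardyCompletion X L K p q,
              ExtendsPi L K p q P' → P' = P) ∧
            ∀ f : TentSpace d X p q, ‖P f‖ ≤ C * p ^ (1 / q) * ‖f‖) ∧
        ∀ p : ENNReal, 1 ≤ p → ∀ f ∈ testFunctions d X,
          InDomain L K (opPi K f) ∧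
          bmoNorm K p q (opPi K f) ≤ ENNReal.ofReal C * carlesonNorm p q f ∧
          (carlesonNorm p q f < ⊤ → MemBMO L K p q (opPi K f)) := by
  obtain ⟨b, hb, hb1, hbβ⟩ : ∃ b : ℝ, 0 < b ∧ b ≤ 1 / 2 ∧ b < β :=
    ⟨min β 1 / 2, by positivity, by linarith [min_le_right β 1], by linarith [min_le_left β 1]⟩
  obtain ⟨A, hA⟩ := exists_isCalderonKernel d M hb hbβ hc
  obtain ⟨D₀, hD₀⟩ := exists_tentConst d hb
  obtain ⟨D₁, _, hD₁⟩ := exists_areaNorm_tentOp_le hd hb hb1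
  obtain ⟨D₂, _, hD₂⟩ := exists_carlFun_tentOp_le hd hb hb1 hD₀
  obtain ⟨m, hm⟩ := exists_poisMass d hb
  refine ⟨A * (D₁ + D₂) + 1, by positivity, ?_⟩
  intro α γ L K _ _ hγ _ _ hM hLK hK X _ _ _ q hq
  obtain ⟨T, hT⟩ := exists_isHeatFlow hβ hγ hc hν hM hLK hK
  have hk := hA γ K T hT
  refine ⟨fun f hf => hk.piConverges hb (isTest_of_mem hf), fun p hp => ?_, fun p _ f hf => ?_⟩
  · obtain ⟨P, hP, huniq, hbound⟩ := hk.exists_extendsPi (X := X) hb hm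
      (fun f hf => hD₁ p q f hp.out hq.out hf) L
    refine ⟨P, hP, huniq, fun f => (hbound f).trans ?_⟩
    have hp0 : 0 ≤ p := zero_le_one.trans hp.out
    gcongr
    have : (0 : ℝ) ≤ A * D₂ := by positivity
    rw [mul_add]
    linarith
  · have hle : bmoNorm K p q (opPi K f) ≤
        ENNReal.ofReal (A * (D₁ + D₂) + 1) * carlesonNorm p q f := by
      refine (hk.bmoNorm_opPi_le hb hm hq.out (fun f x hf => hD₂ q f x hq.out hf) p
        (isTest_of_mem hf)).trans ?_
      gcongr
      rw [← ENNReal.ofReal_coe_nnreal]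
      refine ENNReal.ofReal_le_ofReal ?_
      have : (0 : ℝ) ≤ A * D₁ := by positivity
      push_cast
      rw [mul_add]
      linarith
    have hdom := hk.inDomain_opPi hb hm (isTest_of_mem hf) L
    exact ⟨hdom, hle, fun hfin => ⟨hdom, hle.trans_lt
      (ENNReal.mul_lt_top ENNReal.ofReal_lt_top hfin)⟩⟩
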